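/- A permutation $\pi$ of length $n$ is a bijection of $\{1,\dots,n\}$ to itself, written as the sequence $\pi(1)\cdots\pi(n)$. A permutation $\sigma$ of length $k$ is contained in $\pi$ if $\pi$ has a subsequence of length $k$ whose entries are in the same relative order as those of $\sigma$. A permutation class is a set of permutations that, with each of its members, contains every permutation contained in that member. The sum of permutations $\pi$ of length $k$ and $\sigma$ of length $\ell$ is the permutation $\pi\oplus\sigma$ of length $k+\ell$ with $(\pi\oplus\sigma)(i)=\pi(i)$ for $1\le i\le k$ and $(\pi\oplus\sigma)(i)=\sigma(i-k)+k$ for $k+1\le i\le k+\ell$. A permutation is sum indecomposable if it is not the sum of two nonempty permutations. Proposition. Let $n\ge 6$. If a permutation class $\mathcal C$ contains at least $4$ sum indecomposable permutations of length $n$, then $\mathcal C$ contains at least $4$ sum indecomposable permutations of length $n-1$. This is best possible in the sense that the number $4$ cannot be replaced by $5$, under any restriction on $n$: for every $n\ge 6$ there is a permutation class that contains exactly $5$ sum indecomposable permutations of length $n$ but only (exactly) $4$ of length $n-1$. -/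

import Mathlib

/-- A (finite) permutation of unspecified length: a length `n` together with a bijection of an
`n`-element linearly ordered set of indices onto an `n`-element linearly ordered set of values.
Indices and values are numbered from `0` rather than from `1`. -/
abbrev FinPerm : Type := Σ n : ℕ, Equiv.Perm (Fin n)

namespace FinPerm

/-- `σ` is contained in `π`: some subsequence of `π` (with indices `e 0 < e 1 < ⋯`) is
order isomorphic to `σ`. -/
def IsContained (σ π : FinPerm) : Prop :=
  ∃ e : Fin σ.1 ↪o Fin π.1, ∀ i j : Fin σ.1, σ.2 i < σ.2 j ↔ π.2 (e i) < π.2 (e j)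

/-- The direct sum `π ⊕ σ`: the first `k` indices carry `π`, and the last `l` indices carry `σ`
with its values shifted up by `k`. -/
def directSum {k l : ℕ} (π : Equiv.Perm (Fin k)) (σ : Equiv.Perm (Fin l)) :
    Equiv.Perm (Fin (k + l)) :=
  finSumFinEquiv.permCongr (Equiv.sumCongr π σ)

theorem directSum_castAdd {k l : ℕ} (π : Equiv.Perm (Fin k)) (σ : Equiv.Perm (Fin l))
    (i : Fin k) : directSum π σ (Fin.castAdd l i) = Fin.castAdd l (π i) := by
  simp [directSum]

theorem directSum_natAdd {k l : ℕ} (π : Equiv.Perm (Fin k)) (σ : Equiv.Perm (Fin l))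
    (i : Fin l) : directSum π σ (Fin.natAdd k i) = Fin.natAdd k (σ i) := by
  simp [directSum]

/-- A permutation is sum indecomposable if it is not the sum of two nonempty permutations. -/
def IsSumIndecomposable (ρ : FinPerm) : Prop :=
  ¬ ∃ (k l : ℕ) (π : Equiv.Perm (Fin k)) (σ : Equiv.Perm (Fin l)),
      0 < k ∧ 0 < l ∧ ρ = ⟨k + l, directSum π σ⟩

/-- A permutation class is a set of permutations closed downward under containment. -/
def IsClass (C : Set FinPerm) : Prop :=
  ∀ π ∈ C, ∀ σ : FinPerm, IsContained σ π → σ ∈ C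

/-- The set of sum indecomposable permutations of length `n` in `C`. -/
def sumIndecomposables (C : Set FinPerm) (n : ℕ) : Set (Equiv.Perm (Fin n)) :=
  {π | (⟨n, π⟩ : FinPerm) ∈ C ∧ IsSumIndecomposable ⟨n, π⟩}

/-- The number of sum indecomposable permutations of length `n` in `C` (always finite, as there
are only finitely many permutations of each length). -/
noncomputable def numSumIndecomposables (C : Set FinPerm) (n : ℕ) : ℕ :=
  (sumIndecomposables C n).ncard

end FinPerm

/-! Suppose a class had four sum indecomposables of length `m + 2` but at most three of length `m +
1`. Every indecomposable pattern can be shortened at either end: if deleting the first entry leaves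
a sum, then deleting the second does not, and symmetrically on the right. So each of the four
patterns has a left child `L` and a right child `R`, and is drawn as an arc from `L` to `R` on at
most three vertices, the available patterns of length `m + 1`.

An arc is a loop only for three patterns: the decreasing one, an increasing one followed by a
minimum, and a maximum followed by an increasing one (`loop_of_L_R`). If two different members give
the same arc, then some loop pattern is among their children (`parallel`): such members differ only
by exchanging two entries near the ends, and their other deletions would need too many vertices.

Assume first that no loop pattern is a vertex. Then the four arcs are distinct non-loops on three
vertices, so two of them are opposite. Along an arc the comparisons of inner neighbouring entries
move by one place (`arc_shift`). An opposite pair therefore makes them periodic with period two;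
period one would force a loop pattern (`antiparallel`), so ascents and descents alternate. The other
two arcs either close a triangle with the pair, whose odd total shift contradicts the alternation
(`triangle`), or form a second opposite pair sharing a vertex with the first. In that case no inner
deletion matches an available child, so all inner entries are cut entries; the patterns are then so
rigid that two of the members coincide (`double_antiparallel`).

Now let a loop pattern be a vertex. The longer loop pattern of the same kind has only this child, so
it can be adjoined to the members: `Mem` asks for nothing but available children. A pattern with a
loop child has a monotone core in which almost all neighbouring positions are bonds, that is, also
adjacent in value. Deletion at a bond is indecomposable, and a pattern can be recovered from that
deletion and the direction of the bond. Hence at most three members share a bond in the same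
direction (`four_bonds`). Together with the explicit shapes of patterns having a loop child, this
excludes the cases of one, two and three loop vertices (`one_loop_case`, `two_loops_case`,
`three_loops_case`).

The argument needs `m ≥ 6`. Lengths 6 and 7 are settled by a verified exhaustive search
(`noFour_six`, `noFour_seven`).

For sharpness, take the class generated by the two increasing oscillations of length `n` and three
oscillations with one or both end points doubled. Deleting an inner point disconnects an
oscillation, so the only indecomposables of length `n - 1` are two oscillations and two with one
doubled end (`exists_five_four`). -/

namespace Pattern

/-! ### Patterns as integer sequences: deletion, indecomposability, reverse complement -/

/-- The sequences `p`, `q` have the same relative order on the window `0, …, m`. -/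
def Eqv (m : ℕ) (p q : ℕ → ℤ) : Prop :=
  ∀ i ≤ m, ∀ j ≤ m, (p i < p j ↔ q i < q j)

/-- The entries of `p` in the window `0, …, m` are distinct. -/
def Inj (m : ℕ) (p : ℕ → ℤ) : Prop :=
  ∀ i ≤ m, ∀ j ≤ m, p i = p j → i = j

/-- The pattern `p` on the window `0, …, m` is sum indecomposable: every gap is crossed by an
inversion. -/
def Con (m : ℕ) (p : ℕ → ℤ) : Prop :=
  ∀ k, 0 < k → k ≤ m → ∃ i, i < k ∧ ∃ j, k ≤ j ∧ j ≤ m ∧ p j < p i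

/-- Deletion of the entry at position `r`. -/
def del (p : ℕ → ℤ) (r : ℕ) : ℕ → ℤ := fun i => if i < r then p i else p (i + 1)

/-- The reverse complement of a pattern on the window `0, …, m`. -/
def rc (m : ℕ) (p : ℕ → ℤ) : ℕ → ℤ := fun i => -p (m - i)

theorem del_lt {p : ℕ → ℤ} {r i : ℕ} (h : i < r) : del p r i = p i := if_pos h

theorem del_ge {p : ℕ → ℤ} {r i : ℕ} (h : r ≤ i) : del p r i = p (i + 1) := if_neg (by omega)

theorem Eqv.refl (m : ℕ) (p : ℕ → ℤ) : Eqv m p p := fun _ _ _ _ => Iff.rfl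

theorem Eqv.symm {m : ℕ} {p q : ℕ → ℤ} (h : Eqv m p q) : Eqv m q p :=
  fun i hi j hj => (h i hi j hj).symm

theorem Eqv.trans {m : ℕ} {p q r : ℕ → ℤ} (h : Eqv m p q) (h' : Eqv m q r) : Eqv m p r :=
  fun i hi j hj => (h i hi j hj).trans (h' i hi j hj)

theorem Eqv.of_eq {m : ℕ} {p q : ℕ → ℤ} (h : ∀ i ≤ m, p i = q i) : Eqv m p q :=
  fun i hi j hj => by rw [h i hi, h j hj]

theorem Eqv.con {m : ℕ} {p q : ℕ → ℤ} (h : Eqv m p q) (hp : Con m p) : Con m q := by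
  intro k hk hk'
  obtain ⟨i, hi, j, hj, hj', hlt⟩ := hp k hk hk'
  exact ⟨i, hi, j, hj, hj', (h j hj' i (by omega)).1 hlt⟩

theorem Inj.ne {m : ℕ} {p : ℕ → ℤ} (h : Inj m p) {i j : ℕ} (hi : i ≤ m) (hj : j ≤ m)
    (hij : i ≠ j) : p i ≠ p j := fun e => hij (h i hi j hj e)

/-- To compare injective patterns it is enough to compare pairs in increasing order. -/
theorem Eqv.of_lt {m : ℕ} {p q : ℕ → ℤ} (hp : Inj m p) (hq : Inj m q)
    (h : ∀ i j, i < j → j ≤ m → (p i < p j ↔ q i < q j)) : Eqv m p q := by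
  intro i hi j hj
  rcases lt_trichotomy i j with hlt | rfl | hlt
  · exact h i j hlt hj
  · simp
  · have h1 := h j i hlt hi
    have h2 := hp.ne hi hj (by omega)
    have h3 := hq.ne hi hj (by omega)
    omega

theorem inj_del {m : ℕ} {p : ℕ → ℤ} (hp : Inj (m + 1) p) (r : ℕ) : Inj m (del p r) := by
  intro i hi j hj e
  unfold del at e
  split_ifs at e <;> have := hp _ (by omega) _ (by omega) e <;> omega

/-- Comparing deletions at the same position. -/
theorem Eqv.del_same {m r : ℕ} {p q : ℕ → ℤ} (h : Eqv m (del p r) (del q r)) (hr : r ≤ m + 1)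
    {i j : ℕ} (hi : i ≤ m + 1) (hj : j ≤ m + 1) (hir : i ≠ r) (hjr : j ≠ r) :
    (p i < p j ↔ q i < q j) := by
  have key := h (if i < r then i else i - 1) (by split_ifs <;> omega)
    (if j < r then j else j - 1) (by split_ifs <;> omega)
  have e : ∀ (f : ℕ → ℤ) (k : ℕ), k ≠ r → del f r (if k < r then k else k - 1) = f k := by
    intro f k hk
    split_ifs with h1
    · exact del_lt h1
    · rw [del_ge (by omega)]; congr 1; omega
  rwa [e p i hir, e p j hjr, e q i hir, e q j hjr] at key

theorem eqv_del {m : ℕ} {p q : ℕ → ℤ} (h : Eqv (m + 1) p q) (r : ℕ) :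
    Eqv m (del p r) (del q r) := by
  intro i hi j hj
  unfold del
  split_ifs <;> exact h _ (by omega) _ (by omega)

/-- An inversion certificate for indecomposability of a deletion. -/
theorem con_del_of {m r : ℕ} {p : ℕ → ℤ} (hr : r ≤ m + 1)
    (h : ∀ k, k ≤ m → (r = 0 → 0 < k) → (r = m + 1 → k < m) →
      ∃ i, i ≤ k ∧ i ≠ r ∧ ∃ j, k < j ∧ j ≤ m + 1 ∧ j ≠ r ∧ p j < p i) :
    Con m (del p r) := by
  intro k hk hkm
  have e1 : ∀ i < r, del p r i = p i := fun i hi => del_lt hi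
  have e2 : ∀ i, r < i → del p r (i - 1) = p i := fun i hi => by
    rw [del_ge (by omega)]; congr 1; omega
  by_cases hkr : k ≤ r
  · obtain ⟨i, hi, hir, j, hj, hj', hjr, hlt⟩ := h (k - 1) (by omega) (by omega) (by omega)
    refine ⟨i, by omega, ?_⟩
    rw [e1 i (by omega)]
    rcases lt_or_gt_of_ne hjr with h1 | h1
    · exact ⟨j, by omega, by omega, by rw [e1 j h1]; exact hlt⟩
    · exact ⟨j - 1, by omega, by omega, by rw [e2 j h1]; exact hlt⟩
  · obtain ⟨i, hi, hir, j, hj, hj', hjr, hlt⟩ := h k (by omega) (by omega) (by omega)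
    rcases lt_or_gt_of_ne hir with h1 | h1
    · refine ⟨i, by omega, ?_⟩
      rw [e1 i h1]
      exact ⟨j - 1, by omega, by omega, by rw [e2 j (by omega)]; exact hlt⟩
    · refine ⟨i - 1, by omega, ?_⟩
      rw [e2 i h1]
      exact ⟨j - 1, by omega, by omega, by rw [e2 j (by omega)]; exact hlt⟩

/-- The crossing inversions of an indecomposable deletion, in terms of the original pattern. -/
theorem Con.of_del {m r : ℕ} {p : ℕ → ℤ} (h : Con m (del p r)) (hr : r ≤ m + 1)
    {k : ℕ} (hk : k ≤ m) (h0 : r = 0 → 0 < k) (h1 : r = m + 1 → k < m) :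
    ∃ i, i ≤ k ∧ i ≠ r ∧ ∃ j, k < j ∧ j ≤ m + 1 ∧ j ≠ r ∧ p j < p i := by
  rcases Nat.eq_zero_or_pos m with rfl | hm
  · omega
  by_cases hkr : k < r
  · obtain ⟨i, hi, j, hj, hj', hlt⟩ := h (k + 1) (by omega) (by omega)
    rw [del_lt (by omega : i < r)] at hlt
    refine ⟨i, by omega, by omega, ?_⟩
    unfold del at hlt
    split_ifs at hlt
    · exact ⟨j, by omega, by omega, by omega, hlt⟩
    · exact ⟨j + 1, by omega, by omega, by omega, hlt⟩
  · by_cases hk0 : k = 0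
    · omega
    obtain ⟨i, hi, j, hj, hj', hlt⟩ := h k (by omega) (by omega)
    rw [del_ge (by omega : r ≤ j)] at hlt
    unfold del at hlt
    split_ifs at hlt
    · exact ⟨i, by omega, by omega, j + 1, by omega, by omega, by omega, hlt⟩
    · exact ⟨i + 1, by omega, by omega, j + 1, by omega, by omega, by omega, hlt⟩

/-- A gap of an indecomposable pattern is crossed by an inversion. -/
theorem Con.cross {m : ℕ} {p : ℕ → ℤ} (h : Con (m + 1) p) {k : ℕ} (hk : k ≤ m) :
    ∃ i, i ≤ k ∧ ∃ j, k < j ∧ j ≤ m + 1 ∧ p j < p i := by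
  obtain ⟨i, hi, j, hj, hj', hlt⟩ := h (k + 1) (by omega) (by omega)
  exact ⟨i, by omega, j, by omega, hj', hlt⟩

theorem rc_le {m i : ℕ} {p : ℕ → ℤ} (_ : i ≤ m) : rc m p (m - i) = -p i := by
  unfold rc; congr 2; omega

theorem Eqv.rc {m : ℕ} {p q : ℕ → ℤ} (h : Eqv m p q) : Eqv m (rc m p) (rc m q) := by
  intro i hi j hj
  have := h (m - j) (by omega) (m - i) (by omega)
  unfold Pattern.rc
  omega

theorem rc_rc (m : ℕ) (p : ℕ → ℤ) : Eqv m (rc m (rc m p)) p := by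
  apply Eqv.of_eq
  intro i hi
  unfold rc
  rw [neg_neg]; congr 1; omega

theorem eqv_rc_iff {m : ℕ} {p q : ℕ → ℤ} : Eqv m (rc m p) (rc m q) ↔ Eqv m p q :=
  ⟨fun h => (rc_rc m p).symm.trans (h.rc.trans (rc_rc m q)), Eqv.rc⟩

theorem Inj.rc {m : ℕ} {p : ℕ → ℤ} (h : Inj m p) : Inj m (rc m p) := by
  intro i hi j hj e
  unfold Pattern.rc at e
  have := h (m - i) (by omega) (m - j) (by omega) (by omega)
  omega

theorem Con.rc {m : ℕ} {p : ℕ → ℤ} (h : Con m p) : Con m (rc m p) := by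
  intro k hk hkm
  obtain ⟨i, hi, j, hj, hj', hlt⟩ := h (m + 1 - k) (by omega) (by omega)
  refine ⟨m - j, by omega, m - i, by omega, by omega, ?_⟩
  rw [rc_le hj', rc_le (by omega)]
  omega

theorem con_rc_iff {m : ℕ} {p : ℕ → ℤ} : Con m (rc m p) ↔ Con m p :=
  ⟨fun h => (rc_rc m p).con h.rc, Con.rc⟩

theorem del_rc {m r : ℕ} (p : ℕ → ℤ) (hr : r ≤ m + 1) :
    Eqv m (del (rc (m + 1) p) r) (rc m (del p (m + 1 - r))) := by
  apply Eqv.of_eq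
  intro i hi
  unfold del rc
  dsimp only
  split_ifs <;> first | omega | (congr 2; omega)

end Pattern

/-! ### Left and right children, repeated deletions, bonds and loop patterns -/

namespace Pattern

/-- If no inversion avoiding `r` crosses a gap, everything before the gap lies below everything
after it, apart from `r`. An entry whose deletion leaves a sum is called a cut entry below; in an
indecomposable pattern every inversion across this gap involves it. -/
theorem cut_of_not_con {m r : ℕ} {p : ℕ → ℤ} (hi : Inj (m + 1) p) (hr : r ≤ m + 1)
    (h : ¬ Con m (del p r)) :
    ∃ k ≤ m, (r = 0 → 0 < k) ∧ (r = m + 1 → k < m) ∧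
      ∀ a b, a ≤ k → a ≠ r → k < b → b ≤ m + 1 → b ≠ r → p a < p b := by
  by_contra hcon
  apply h
  apply con_del_of hr
  intro k hk h0 h1
  by_contra hno
  apply hcon
  refine ⟨k, hk, h0, h1, ?_⟩
  intro a b ha har hb hb' hbr
  by_contra hlt
  have := hi.ne (show a ≤ m + 1 by omega) hb' (by omega)
  exact hno ⟨a, ha, har, b, hb, hb', hbr, by omega⟩

/-- The shape of an indecomposable pattern whose first entry is a cut entry. -/
theorem cut_first {m : ℕ} {p : ℕ → ℤ} (hi : Inj (m + 1) p) (hc : Con (m + 1) p)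
    (h : ¬ Con m (del p 0)) :
    ∃ k, 1 ≤ k ∧ k ≤ m ∧ (∀ a b, 1 ≤ a → a ≤ k → k < b → b ≤ m + 1 → p a < p b) ∧
      (∀ a, 1 ≤ a → a ≤ k → p a < p 0) ∧ ∃ j, k < j ∧ j ≤ m + 1 ∧ p j < p 0 := by
  obtain ⟨k, hk, h0, -, hlt⟩ := cut_of_not_con hi (by omega) h
  have h0 := h0 rfl
  obtain ⟨i, hik, j, hj, hj', hij⟩ := hc.cross hk
  have hi0 : i = 0 := by
    by_contra hne
    have := hlt i j hik hne hj hj' (by omega)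
    omega
  subst hi0
  refine ⟨k, h0, hk, fun a b ha hak hb hb' => hlt a b hak (by omega) hb hb' (by omega), ?_,
    j, hj, hj', hij⟩
  intro a ha hak
  have := hlt a j hak (by omega) hj hj' (by omega)
  omega

/-- The shape of an indecomposable pattern whose last entry is a cut entry. -/
theorem cut_last {m : ℕ} {p : ℕ → ℤ} (hi : Inj (m + 1) p) (hc : Con (m + 1) p)
    (h : ¬ Con m (del p (m + 1))) :
    ∃ k, 1 ≤ k ∧ k ≤ m ∧ (∀ a b, a < k → k ≤ b → b ≤ m → p a < p b) ∧
      (∀ b, k ≤ b → b ≤ m → p (m + 1) < p b) ∧ ∃ i, i < k ∧ p (m + 1) < p i := by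
  obtain ⟨k, hk, -, h0, hlt⟩ := cut_of_not_con hi (by omega) h
  have h0 := h0 rfl
  obtain ⟨i, hik, j, hj, hj', hij⟩ := hc.cross hk
  have hi0 : j = m + 1 := by
    by_contra hne
    have := hlt i j hik (by omega) hj hj' (by omega)
    omega
  subst hi0
  refine ⟨k + 1, by omega, by omega,
    fun a b ha hb hb' => hlt a b (by omega) (by omega) (by omega) (by omega) (by omega), ?_,
    i, by omega, hij⟩
  intro b hb hb'
  have := hlt i b hik (by omega) (by omega) (by omega) (by omega)
  omega

/-- Let the first entry be a cut entry with gap `k`. It lies above an entry beyond `k`, and this one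
inversion crosses all gaps up to `k`. Gaps further right are crossed by inversions that cannot start
at position 1, since that entry lies below everything beyond `k`. -/
theorem con_del_one {m : ℕ} {p : ℕ → ℤ} (hi : Inj (m + 1) p) (hc : Con (m + 1) p)
    (h : ¬ Con m (del p 0)) : Con m (del p 1) := by
  obtain ⟨k, hk1, hkm, hcut, htop, j, hj, hj', hlt⟩ := cut_first hi hc h
  apply con_del_of (by omega)
  intro g hg _ _
  by_cases hgk : g ≤ k
  · exact ⟨0, by omega, by omega, j, by omega, by omega, by omega, hlt⟩
  · obtain ⟨a, ha, b, hb, hb', hab⟩ := hc.cross hg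
    have ha1 : a ≠ 1 := by
      rintro rfl
      have := hcut 1 b (by omega) (by omega) (by omega) hb'
      omega
    exact ⟨a, ha, ha1, b, hb, hb', by omega, hab⟩

theorem con_del_penult {m : ℕ} {p : ℕ → ℤ} (hi : Inj (m + 1) p) (hc : Con (m + 1) p)
    (h : ¬ Con m (del p (m + 1))) : Con m (del p m) := by
  have h1 : Con m (del (rc (m + 1) p) 1) := by
    apply con_del_one hi.rc hc.rc
    intro hcon
    exact h (con_rc_iff.1 ((del_rc p (by omega)).con hcon))
  exact con_rc_iff.1 ((del_rc p (by omega)).con h1)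

open Classical in
/-- The position removed to form the left child. -/
noncomputable def sL (m : ℕ) (p : ℕ → ℤ) : ℕ := if Con m (del p 0) then 0 else 1

open Classical in
/-- The position removed to form the right child. -/
noncomputable def tR (m : ℕ) (p : ℕ → ℤ) : ℕ := if Con m (del p (m + 1)) then m + 1 else m

/-- The left child: remove the first entry if possible and the second one otherwise. -/
noncomputable def L (m : ℕ) (p : ℕ → ℤ) : ℕ → ℤ := del p (sL m p)

/-- The right child: remove the last entry if possible and the penultimate one otherwise. -/
noncomputable def R (m : ℕ) (p : ℕ → ℤ) : ℕ → ℤ := del p (tR m p)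

theorem sL_cases (m : ℕ) (p : ℕ → ℤ) :
    (sL m p = 0 ∧ Con m (del p 0)) ∨ (sL m p = 1 ∧ ¬ Con m (del p 0)) := by
  unfold sL; split_ifs <;> simp_all

theorem tR_cases (m : ℕ) (p : ℕ → ℤ) :
    (tR m p = m + 1 ∧ Con m (del p (m + 1))) ∨ (tR m p = m ∧ ¬ Con m (del p (m + 1))) := by
  unfold tR; split_ifs <;> simp_all

theorem con_L {m : ℕ} {p : ℕ → ℤ} (hi : Inj (m + 1) p) (hc : Con (m + 1) p) : Con m (L m p) := by
  unfold L
  rcases sL_cases m p with ⟨h, h'⟩ | ⟨h, h'⟩ <;> rw [h]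
  · exact h'
  · exact con_del_one hi hc h'

theorem con_R {m : ℕ} {p : ℕ → ℤ} (hi : Inj (m + 1) p) (hc : Con (m + 1) p) : Con m (R m p) := by
  unfold R
  rcases tR_cases m p with ⟨h, h'⟩ | ⟨h, h'⟩ <;> rw [h]
  · exact h'
  · exact con_del_penult hi hc h'

theorem sL_le (m : ℕ) (p : ℕ → ℤ) : sL m p ≤ 1 := by
  rcases sL_cases m p with h | h <;> omega

theorem L_pos {m i : ℕ} (p : ℕ → ℤ) (h : 1 ≤ i) : L m p i = p (i + 1) :=
  del_ge ((sL_le m p).trans h)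

theorem L_zero (m : ℕ) (p : ℕ → ℤ) :
    (sL m p = 0 ∧ L m p 0 = p 1) ∨ (sL m p = 1 ∧ L m p 0 = p 0) := by
  unfold L
  rcases sL_cases m p with ⟨h, -⟩ | ⟨h, -⟩ <;> rw [h] <;> simp [del]

theorem R_lt {m i : ℕ} (p : ℕ → ℤ) (h : i < m) : R m p i = p i := by
  apply del_lt
  rcases tR_cases m p with ⟨h, -⟩ | ⟨h, -⟩ <;> omega

theorem R_last (m : ℕ) (p : ℕ → ℤ) :
    (tR m p = m + 1 ∧ R m p m = p m) ∨ (tR m p = m ∧ R m p m = p (m + 1)) := by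
  unfold R
  rcases tR_cases m p with ⟨h, -⟩ | ⟨h, -⟩ <;> rw [h] <;> simp [del]

theorem sL_rc {m : ℕ} (p : ℕ → ℤ) : tR m (rc (m + 1) p) = m + 1 - sL m p := by
  have h : Con m (del (rc (m + 1) p) (m + 1)) ↔ Con m (del p 0) := by
    have := del_rc p (le_refl (m + 1))
    rw [Nat.sub_self] at this
    exact ⟨fun h => con_rc_iff.1 (this.con h), fun h => this.symm.con (con_rc_iff.2 h)⟩
  unfold tR sL
  split_ifs <;> simp_all

theorem tR_rc {m : ℕ} (p : ℕ → ℤ) : sL m (rc (m + 1) p) = m + 1 - tR m p := by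
  have h : Con m (del (rc (m + 1) p) 0) ↔ Con m (del p (m + 1)) := by
    have := del_rc p (Nat.zero_le (m + 1))
    exact ⟨fun h => con_rc_iff.1 (this.con h), fun h => this.symm.con (con_rc_iff.2 h)⟩
  unfold tR sL
  split_ifs <;> simp_all

theorem tR_le (m : ℕ) (p : ℕ → ℤ) : tR m p ≤ m + 1 := by
  rcases tR_cases m p with h | h <;> omega

theorem L_rc {m : ℕ} (p : ℕ → ℤ) : Eqv m (L m (rc (m + 1) p)) (rc m (R m p)) := by
  unfold L R
  have h := del_rc p (show sL m (rc (m + 1) p) ≤ m + 1 by have := sL_le m (rc (m + 1) p); omega)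
  have h2 := tR_le m p
  rwa [tR_rc, show m + 1 - (m + 1 - tR m p) = tR m p by omega, ← tR_rc] at h

theorem R_rc {m : ℕ} (p : ℕ → ℤ) : Eqv m (R m (rc (m + 1) p)) (rc m (L m p)) := by
  unfold L R
  have h := del_rc p (tR_le m (rc (m + 1) p))
  have h2 := sL_le m p
  rwa [sL_rc, show m + 1 - (m + 1 - sL m p) = sL m p by omega, ← sL_rc] at h

theorem mono_of_step {p : ℕ → ℤ} {i j : ℕ} (h : ∀ a, i ≤ a → a < j → p a < p (a + 1)) :
    ∀ a b, i ≤ a → a < b → b ≤ j → p a < p b := by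
  intro a b ha hab
  induction b, hab using Nat.le_induction with
  | base => exact fun hb => h a ha (by omega)
  | succ b hab ih =>
    intro hb
    have := ih (by omega)
    have := h b (by omega) (by omega)
    omega

theorem anti_of_step {p : ℕ → ℤ} {i j : ℕ} (h : ∀ a, i ≤ a → a < j → p (a + 1) < p a) :
    ∀ a b, i ≤ a → a < b → b ≤ j → p b < p a := by
  intro a b ha hab hb
  have := mono_of_step (p := fun i => -p i) (fun a ha hb => by have := h a ha hb; omega)
    a b ha hab hb
  omega

/-- A predicate that is constant along steps is constant. -/
theorem const_of_step {P : ℕ → Prop} {i j : ℕ} (h : ∀ a, i ≤ a → a < j → (P a ↔ P (a + 1))) :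
    ∀ a b, i ≤ a → a ≤ j → i ≤ b → b ≤ j → (P a ↔ P b) := by
  have key : ∀ a, i ≤ a → a ≤ j → (P i ↔ P a) := by
    intro a ha
    induction a, ha using Nat.le_induction with
    | base => exact fun _ => Iff.rfl
    | succ b hab ih => exact fun hb => (ih (by omega)).trans (h b hab (by omega))
  exact fun a b ha ha' hb hb' => (key a ha ha').symm.trans (key b hb hb')

/-- If deleting `i` or `j` gives the same pattern then `p` is monotone on `[i, j]`. -/
theorem run_mono {m i j : ℕ} {p : ℕ → ℤ} (hp : Inj (m + 1) p) (hij : i < j) (hj : j ≤ m + 1)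
    (h : Eqv m (del p i) (del p j)) :
    (∀ a b, i ≤ a → a < b → b ≤ j → p a < p b) ∨ (∀ a b, i ≤ a → a < b → b ≤ j → p b < p a) := by
  -- For `i ≤ a < j`, index `a` holds the entry `a + 1` after the deletion of `i`, but the entry `a`
  -- after the deletion of `j`. Hence consecutive comparisons inside the interval all agree.
  have step : ∀ a, i ≤ a → a < j - 1 → (p a < p (a + 1) ↔ p (a + 1) < p (a + 1 + 1)) := by
    intro a ha haj
    have := h a (by omega) (a + 1) (by omega)
    rw [del_ge ha, del_ge (by omega), del_lt (by omega), del_lt (by omega)] at this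
    exact this.symm
  have cst := const_of_step (P := fun a => p a < p (a + 1)) step
  by_cases h0 : p i < p (i + 1)
  · left
    apply mono_of_step
    intro a ha haj
    exact (cst i a (by omega) (by omega) (by omega) (by omega)).1 h0
  · right
    apply anti_of_step
    intro a ha haj
    have h1 := (cst i a (by omega) (by omega) (by omega) (by omega)).not.1 h0
    have := hp.ne (show a ≤ m + 1 by omega) (show a + 1 ≤ m + 1 by omega) (by omega)
    omega

/-- If deleting `i` or `j` gives the same pattern then no outside entry separates `[i, j]`. -/
theorem run_sep {m i j : ℕ} {p : ℕ → ℤ} (hj : j ≤ m + 1)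
    (h : Eqv m (del p i) (del p j)) {k : ℕ} (hk : k ≤ m + 1) (hkij : k < i ∨ j < k) :
    ∀ a b, i ≤ a → a ≤ j → i ≤ b → b ≤ j → (p k < p a ↔ p k < p b) := by
  apply const_of_step
  intro a ha haj
  rcases hkij with hki | hjk
  · have := h k (by omega) a (by omega)
    rw [del_lt hki, del_ge ha, del_lt (by omega), del_lt haj] at this
    exact this.symm
  · have := h (k - 1) (by omega) a (by omega)
    rw [del_ge (by omega), del_ge ha, del_ge (by omega), del_lt haj,
      show k - 1 + 1 = k by omega] at this
    exact this.symm

/-- No entry of `p` has a value between those at the adjacent positions `b`, `b + 1`. -/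
def Bond (m : ℕ) (p : ℕ → ℤ) (b : ℕ) : Prop :=
  ∀ k ≤ m, k ≠ b → k ≠ b + 1 → (p k < p b ↔ p k < p (b + 1))

theorem Bond.gt {m b : ℕ} {p : ℕ → ℤ} (h : Bond m p b) (hp : Inj m p) (hb : b + 1 ≤ m) {k : ℕ}
    (hk : k ≤ m) (h1 : k ≠ b) (h2 : k ≠ b + 1) : (p b < p k ↔ p (b + 1) < p k) := by
  have := h k hk h1 h2
  have := hp.ne hk (show b ≤ m by omega) h1
  have := hp.ne hk hb h2
  omega

/-- The entry at `b + 1` has the same inversions with third entries as the one at `b`, so it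
replaces `b` in any crossing inversion. -/
theorem Bond.con {m b : ℕ} {p : ℕ → ℤ} (hp : Inj (m + 1) p) (hc : Con (m + 1) p) (hb : b ≤ m)
    (hb0 : 0 < m) (h : Bond (m + 1) p b) : Con m (del p b) := by
  apply con_del_of (by omega)
  intro k hk h0 _
  rcases lt_or_ge k b with hkb | hkb
  · obtain ⟨i, hi, j, hj, hj', hlt⟩ := hc.cross hk
    by_cases hjb : j = b
    · subst hjb
      have := h.gt hp (by omega) (show i ≤ m + 1 by omega) (by omega) (by omega)
      exact ⟨i, by omega, by omega, j + 1, by omega, by omega, by omega, by omega⟩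
    · exact ⟨i, by omega, by omega, j, by omega, by omega, by omega, by omega⟩
  · rcases Nat.lt_or_ge b k with hbk | hbk
    · obtain ⟨i, hi, j, hj, hj', hlt⟩ := hc.cross hk
      by_cases hib : i = b
      · subst hib
        have := h j hj' (by omega) (by omega)
        exact ⟨i + 1, by omega, by omega, j, by omega, by omega, by omega, by omega⟩
      · exact ⟨i, by omega, by omega, j, by omega, by omega, by omega, by omega⟩
    · have hbk : k = b := by omega
      subst hbk
      obtain ⟨i, hi, j, hj, hj', hlt⟩ := hc.cross (show k - 1 ≤ m by omega)
      by_cases hjb : j = k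
      · subst hjb
        have := h.gt hp (by omega) (show i ≤ m + 1 by omega) (by omega) (by omega)
        exact ⟨i, by omega, by omega, j + 1, by omega, by omega, by omega, by omega⟩
      · exact ⟨i, by omega, by omega, j, by omega, by omega, by omega, by omega⟩

theorem Bond.del_eqv {m b : ℕ} {p : ℕ → ℤ} (hp : Inj (m + 1) p) (hb : b ≤ m)
    (h : Bond (m + 1) p b) : Eqv m (del p b) (del p (b + 1)) := by
  apply Eqv.of_lt (inj_del hp _) (inj_del hp _)
  intro i j hij hj
  rcases lt_trichotomy i b with hi | rfl | hi
  · rw [del_lt hi, del_lt (by omega : i < b + 1)]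
    rcases lt_trichotomy j b with h' | rfl | h'
    · rw [del_lt h', del_lt (by omega)]
    · rw [del_ge le_rfl, del_lt (by omega)]
      exact (h i (by omega) (by omega) (by omega)).symm
    · rw [del_ge h'.le, del_ge (by omega)]
  · rw [del_ge le_rfl, del_ge (by omega : i ≤ j), del_lt (by omega : i < i + 1),
      del_ge (by omega : i + 1 ≤ j)]
    exact (h.gt hp (by omega) (by omega) (by omega) (by omega)).symm
  · rw [del_ge (by omega), del_ge (by omega), del_ge (by omega), del_ge (by omega)]

/-- Two patterns with a bond of the same direction at the same place are determined by the
deletions there. -/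
theorem Bond.eqv {m b : ℕ} {p q : ℕ → ℤ} (hp : Inj (m + 1) p) (hq : Inj (m + 1) q) (hb : b ≤ m)
    (h : Bond (m + 1) p b) (h' : Bond (m + 1) q b)
    (hd : p b < p (b + 1) ↔ q b < q (b + 1)) (he : Eqv m (del p b) (del q b)) :
    Eqv (m + 1) p q := by
  apply Eqv.of_lt hp hq
  intro i j hij hj
  by_cases hib : i = b
  · subst hib
    by_cases hjb : j = i + 1
    · subst hjb; exact hd
    · rw [h.gt hp (by omega) hj (by omega) hjb, h'.gt hq (by omega) hj (by omega) hjb]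
      exact he.del_same (by omega) (by omega) hj (by omega) (by omega)
  · by_cases hjb : j = b
    · subst hjb
      rw [h i (by omega) (by omega) (by omega), h' i (by omega) (by omega) (by omega)]
      exact he.del_same (by omega) (by omega) (by omega) (by omega) (by omega)
    · exact he.del_same (by omega) (by omega) (by omega) (by omega) (by omega)

/-- The decreasing pattern. -/
def IsD (m : ℕ) (p : ℕ → ℤ) : Prop := ∀ a b, a < b → b ≤ m → p b < p a

/-- An increasing pattern followed by a new minimum. -/
def IsS (m : ℕ) (p : ℕ → ℤ) : Prop :=
  (∀ a b, a < b → b < m → p a < p b) ∧ ∀ a, a < m → p m < p a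

/-- A maximum followed by an increasing pattern. -/
def IsS' (m : ℕ) (p : ℕ → ℤ) : Prop :=
  (∀ a b, 0 < a → a < b → b ≤ m → p a < p b) ∧ ∀ a, 0 < a → a ≤ m → p a < p 0

/-- The patterns with a single indecomposable deletion. -/
def IsLoop (m : ℕ) (p : ℕ → ℤ) : Prop := IsD m p ∨ IsS m p ∨ IsS' m p

/-- Equal children mean that deleting `sL` or `tR` has the same effect, so `p` is monotone between
these positions and no outer entry separates the values there. Indecomposability then fixes the at
most one outer entry. If both end entries were cut entries, the order relations at the two cuts
would clash. -/
theorem loop_of_L_R {m : ℕ} {p : ℕ → ℤ} (hm : 1 ≤ m) (hp : Inj (m + 1) p) (hc : Con (m + 1) p)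
    (h : Eqv m (L m p) (R m p)) : IsLoop (m + 1) p := by
  unfold L R at h
  obtain ⟨c0, hc0, d0, hd0, hd0', hcd0⟩ := hc.cross (show 0 ≤ m by omega)
  obtain rfl : c0 = 0 := by omega
  obtain ⟨c1, hc1, d1, hd1, hd1', hcd1⟩ := hc.cross (le_refl m)
  obtain rfl : d1 = m + 1 := by omega
  rcases sL_cases m p with ⟨hs, h0⟩ | ⟨hs, h0⟩ <;> rcases tR_cases m p with ⟨ht, h1⟩ | ⟨ht, h1⟩ <;>
    rw [hs, ht] at h
  · rcases run_mono hp (by omega) le_rfl h with hm | hm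
    · have := hm 0 d0 le_rfl (by omega) hd0'
      omega
    · exact Or.inl fun a b hab hb => hm a b (by omega) hab hb
  · have hs := run_sep (by omega) h (le_refl (m + 1)) (by omega)
    have hs1 := hs c1 0 (by omega) hc1 (by omega) (by omega)
    rcases run_mono hp (by omega) (by omega) h with hm | hm
    · refine Or.inr (Or.inl ⟨fun a b hab hb => hm a b (by omega) hab (by omega), ?_⟩)
      intro a ha
      exact (hs c1 a (by omega) hc1 (by omega) (by omega)).1 hcd1
    · refine Or.inl fun a b hab hb => ?_
      rcases Nat.lt_or_ge b (m + 1) with h' | h'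
      · exact hm a b (by omega) hab (by omega)
      · obtain rfl : b = m + 1 := by omega
        exact (hs c1 a (by omega) hc1 (by omega) (by omega)).1 hcd1
  · have hs := run_sep le_rfl h (Nat.zero_le (m + 1)) (by omega)
    have htop : ∀ a, 0 < a → a ≤ m + 1 → p a < p 0 := by
      intro a ha ha'
      have := hs d0 a (by omega) (by omega) (by omega) (by omega)
      have := hp.ne ha' (Nat.zero_le (m + 1)) (by omega)
      omega
    rcases run_mono hp (by omega) le_rfl h with hm | hm
    · exact Or.inr (Or.inr ⟨fun a b ha hab hb => hm a b (by omega) hab hb, htop⟩)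
    · refine Or.inl fun a b hab hb => ?_
      rcases Nat.eq_zero_or_pos a with rfl | h'
      · exact htop b (by omega) hb
      · exact hm a b (by omega) hab hb
  · obtain ⟨k, hk, hk', ha, hb, -⟩ := cut_first hp hc h0
    obtain ⟨l, hl, hl', ha', hb', -⟩ := cut_last hp hc h1
    rcases Nat.lt_or_ge 1 m with h2 | h2
    · have hs0 := run_sep (by omega) h (Nat.zero_le (m + 1)) (by omega) 1 m (by omega) (by omega)
        (by omega) (by omega)
      have h3 := hb 1 (by omega) (by omega)
      have h4 := ha' 0 m (by omega) (by omega) le_rfl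
      omega
    · obtain rfl : m = 1 := by omega
      obtain rfl : k = 1 := by omega
      obtain rfl : l = 1 := by omega
      have := ha' 0 1 (by omega) (by omega) (by omega)
      have := hb 1 (by omega) (by omega)
      omega

end Pattern

/-! ### Members with three available children; exchanging the second and the last entry -/

namespace Pattern

theorem fin_three_four : ∀ a b c d : Fin 3, a ≠ b → a ≠ c → a ≠ d → b ≠ c → b ≠ d → c ≠ d → False := by
  omega

theorem fin_three_third : ∀ a b c d : Fin 3, a ≠ b → c ≠ a → c ≠ b → d ≠ a → d ≠ b → c = d := by
  decide

/-- A set `T` of patterns with at most three classes, coloured by `col`. -/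
structure Ctx (m : ℕ) (T : (ℕ → ℤ) → Prop) (col : (ℕ → ℤ) → Fin 3) : Prop where
  cl : ∀ {x y}, T x → Eqv m x y → T y
  col_iff : ∀ {x y}, T x → T y → (col x = col y ↔ Eqv m x y)

/-- An indecomposable pattern all of whose indecomposable deletions lie in `T`. -/
structure Mem (m : ℕ) (T : (ℕ → ℤ) → Prop) (p : ℕ → ℤ) : Prop where
  inj : Inj (m + 1) p
  con : Con (m + 1) p
  child : ∀ r ≤ m + 1, Con m (del p r) → T (del p r)

variable {m : ℕ} {T : (ℕ → ℤ) → Prop} {col : (ℕ → ℤ) → Fin 3} {p q : ℕ → ℤ}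

theorem Ctx.rc (h : Ctx m T col) : Ctx m (fun x => T (rc m x)) (fun x => col (rc m x)) :=
  ⟨fun hx he => h.cl hx he.rc, fun hx hy => (h.col_iff hx hy).trans eqv_rc_iff⟩

theorem Mem.rc (h : Ctx m T col) (hp : Mem m T p) :
    Mem m (fun x => T (rc m x)) (rc (m + 1) p) := by
  refine ⟨hp.inj.rc, hp.con.rc, fun r hr hc => ?_⟩
  have h1 := del_rc p hr
  have h2 := con_rc_iff.1 (h1.con hc)
  exact h.cl (hp.child _ (by omega) h2) ((rc_rc m _).symm.trans h1.symm.rc)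

theorem Mem.T_L (hp : Mem m T p) : T (L m p) :=
  hp.child _ ((sL_le m p).trans (by omega)) (con_L hp.inj hp.con)

theorem Mem.T_R (hp : Mem m T p) : T (R m p) :=
  hp.child _ (tR_le m p) (con_R hp.inj hp.con)

theorem IsD.eqv {m : ℕ} {p q : ℕ → ℤ} (h : IsD m p) (he : Eqv m p q) : IsD m q :=
  fun a b hab hb => (he b hb a (by omega)).1 (h a b hab hb)

theorem IsS.eqv {m : ℕ} {p q : ℕ → ℤ} (h : IsS m p) (he : Eqv m p q) : IsS m q :=
  ⟨fun a b hab hb => (he a (by omega) b (by omega)).1 (h.1 a b hab hb),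
    fun a ha => (he m le_rfl a (by omega)).1 (h.2 a ha)⟩

theorem IsS'.eqv {m : ℕ} {p q : ℕ → ℤ} (h : IsS' m p) (he : Eqv m p q) : IsS' m q :=
  ⟨fun a b ha hab hb => (he a (by omega) b (by omega)).1 (h.1 a b ha hab hb),
    fun a ha ha' => (he a (by omega) 0 (by omega)).1 (h.2 a ha ha')⟩

theorem IsLoop.eqv {m : ℕ} {p q : ℕ → ℤ} (h : IsLoop m p) (he : Eqv m p q) : IsLoop m q :=
  h.imp (·.eqv he) (Or.imp (·.eqv he) (·.eqv he))

theorem IsD.rc {m : ℕ} {p : ℕ → ℤ} (h : IsD m p) : IsD m (rc m p) := by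
  intro a b hab hb
  have := h (m - b) (m - a) (by omega) (by omega)
  unfold Pattern.rc
  omega

theorem IsS.rc {m : ℕ} {p : ℕ → ℤ} (h : IsS m p) : IsS' m (rc m p) := by
  refine ⟨fun a b ha hab hb => ?_, fun a ha ha' => ?_⟩
  · have := h.1 (m - b) (m - a) (by omega) (by omega)
    unfold Pattern.rc
    omega
  · have := h.2 (m - a) (by omega)
    unfold Pattern.rc
    rw [Nat.sub_zero]
    omega

theorem IsS'.rc {m : ℕ} {p : ℕ → ℤ} (h : IsS' m p) : IsS m (rc m p) := by
  refine ⟨fun a b hab hb => ?_, fun a ha => ?_⟩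
  · have := h.1 (m - b) (m - a) (by omega) (by omega) (by omega)
    unfold Pattern.rc
    omega
  · have := h.2 (m - a) (by omega) (by omega)
    unfold Pattern.rc
    rw [Nat.sub_self]
    omega

theorem IsLoop.rc {m : ℕ} {p : ℕ → ℤ} (h : IsLoop m p) : IsLoop m (rc m p) := by
  rcases h with h | h | h
  · exact Or.inl h.rc
  · exact Or.inr (Or.inr h.rc)
  · exact Or.inr (Or.inl h.rc)

theorem isLoop_rc_iff {m : ℕ} {p : ℕ → ℤ} : IsLoop m (rc m p) ↔ IsLoop m p :=
  ⟨fun h => h.rc.eqv (rc_rc m p), IsLoop.rc⟩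

/-- An inversion between the two end entries crosses every gap and survives every inner deletion. -/
theorem con_del_of_inv {r : ℕ} (hr : 1 ≤ r) (hr' : r ≤ m) (h : p (m + 1) < p 0) :
    Con m (del p r) :=
  con_del_of (by omega) fun _ _ _ _ =>
    ⟨0, by omega, by omega, m + 1, by omega, by omega, by omega, h⟩

/-- Two patterns that differ only in the relative order of the entries at `s` and `t`. -/
structure Swap (m : ℕ) (p q : ℕ → ℤ) (s t : ℕ) : Prop where
  lt : p s < p t
  gt : q t < q s
  agree : ∀ i j, i < j → j ≤ m + 1 → ¬ (i = s ∧ j = t) → (p i < p j ↔ q i < q j)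
  sep : ∀ k ≤ m + 1, k ≠ s → k ≠ t → (p k < p s ↔ p k < p t)

/-- The deletions at 1 and at `m + 1` are common to `p` and `q` and take two of the three classes.
The last entry lies below the first in both patterns, so all inner deletions are indecomposable, yet
those of `p` never agree with those of `q`. Only one of the two patterns can use the third class;
the other one repeats its end deletions everywhere inside, which makes it monotone on long runs. -/
theorem swap_one_last (hm : 4 ≤ m) (hT : Ctx m T col) (hp : Mem m T p) (hq : Mem m T q)
    (h : Swap m p q 1 (m + 1)) (h0 : ¬ Con m (del p 0)) (hc1 : Con m (del p 1))
    (hc2 : Con m (del p (m + 1))) (he1 : Eqv m (del p 1) (del q 1))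
    (he2 : Eqv m (del p (m + 1)) (del q (m + 1))) :
    IsLoop m (del p 1) ∨ IsLoop m (del p (m + 1)) := by
  obtain ⟨hlt, hgt, hag, hsep⟩ := h
  obtain ⟨k, hk1, hkm, hcut, htop, j, hkj, hjm, hj0⟩ := cut_first hp.inj hp.con h0
  have hag' : ∀ i j, i < j → j ≤ m + 1 → ¬ (i = 1 ∧ j = m + 1) → (p j < p i ↔ q j < q i) := by
    intro i j hij hj hne
    have h1 := hag i j hij hj hne
    have h2 := hp.inj.ne hj (show i ≤ m + 1 by omega) (by omega)
    have h3 := hq.inj.ne hj (show i ≤ m + 1 by omega) (by omega)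
    omega
  -- The entries 1 and `m + 1` are adjacent in value, so the first is the top of the lower block and
  -- the second is the bottom of the upper block.
  have hA : ∀ a, 2 ≤ a → a ≤ k → p a < p 1 := fun a ha hak =>
    (hsep a (by omega) (by omega) (by omega)).2 (hcut a (m + 1) (by omega) hak (by omega) le_rfl)
  have hB : ∀ b, k < b → b ≤ m → p (m + 1) < p b := fun b hb hbm => by
    have h1 := hcut 1 b le_rfl hk1 hb (by omega)
    have h2 := hsep b (by omega) (by omega) (by omega)
    have h3 := hp.inj.ne (show b ≤ m + 1 by omega) (le_refl (m + 1)) (by omega)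
    omega
  have hlast : p (m + 1) < p 0 := by
    rcases Nat.lt_or_ge m j with h1 | h1
    · obtain rfl : j = m + 1 := by omega
      exact hj0
    · exact (hB j hkj h1).trans hj0
  have hlastq : q (m + 1) < q 0 := (hag' 0 (m + 1) (by omega) le_rfl (by omega)).1 hlast
  have h10q : q 1 < q 0 := (hag' 0 1 (by omega) (by omega) (by omega)).1 (htop 1 le_rfl hk1)
  -- the order relations in `q`
  have qA1 : ∀ a, 2 ≤ a → a ≤ k → q a < q 1 := fun a ha hak =>
    (hag' 1 a (by omega) (by omega) (by omega)).1 (hA a ha hak)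
  have qA2 : ∀ a, 2 ≤ a → a ≤ k → q a < q (m + 1) := fun a ha hak =>
    (hag a (m + 1) (by omega) (by omega) (by omega)).1 (hcut a _ (by omega) hak (by omega) le_rfl)
  have qB1 : ∀ b, k < b → b ≤ m → q 1 < q b := fun b hb hbm =>
    (hag 1 b (by omega) (by omega) (by omega)).1 (hcut 1 b le_rfl hk1 hb (by omega))
  have hne12 : ¬ Eqv m (del p 1) (del p (m + 1)) := by
    intro he
    rcases run_mono hp.inj (by omega) le_rfl he with hr | hr
    · rcases Nat.lt_or_ge k 2 with hk2 | hk2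
      · have := hr 2 (m + 1) (by omega) (by omega) le_rfl
        have := hB 2 (by omega) (by omega)
        omega
      · have := hr 1 2 le_rfl (by omega) (by omega)
        have := hA 2 le_rfl hk2
        omega
    · have := hr 1 (m + 1) le_rfl (by omega) le_rfl
      omega
  have tp1 := hp.child 1 (by omega) hc1
  have tp2 := hp.child (m + 1) le_rfl hc2
  have tp : ∀ r, 2 ≤ r → r ≤ m → T (del p r) := fun r hr hr' =>
    hp.child r (by omega) (con_del_of_inv (by omega) hr' hlast)
  have tq : ∀ r, 2 ≤ r → r ≤ m → T (del q r) := fun r hr hr' =>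
    hq.child r (by omega) (con_del_of_inv (by omega) hr' hlastq)
  -- After an inner deletion the exchanged entries sit at indices 1 and `m`, and compare differently
  -- in `p` and `q`.
  have hpq : ∀ r r', 2 ≤ r → r ≤ m → 2 ≤ r' → r' ≤ m → ¬ Eqv m (del p r) (del q r') := by
    intro r r' h1 h2 h3 h4 he
    have := he 1 (by omega) m le_rfl
    rw [del_lt (by omega), del_ge (by omega), del_lt (by omega), del_ge (by omega)] at this
    omega
  have hcases : (∀ r, 2 ≤ r → r ≤ m → Eqv m (del p 1) (del p r) ∨ Eqv m (del p r) (del p (m + 1))) ∨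
      (∀ r, 2 ≤ r → r ≤ m → Eqv m (del q 1) (del q r) ∨ Eqv m (del q r) (del q (m + 1))) := by
    by_contra hcon
    push Not at hcon
    obtain ⟨⟨r, hr, hr', hr1, hr2⟩, r', hs, hs', hs1, hs2⟩ := hcon
    refine hpq r r' hr hr' hs hs' ((hT.col_iff (tp r hr hr') (tq r' hs hs')).1 ?_)
    apply fin_three_third (col (del p 1)) (col (del p (m + 1)))
    · rwa [Ne, hT.col_iff tp1 tp2]
    · rw [Ne, hT.col_iff (tp r hr hr') tp1]; exact fun h => hr1 h.symm
    · rwa [Ne, hT.col_iff (tp r hr hr') tp2]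
    · rw [Ne, hT.col_iff (tq r' hs hs') tp1]; exact fun h => hs1 (h.trans he1).symm
    · rw [Ne, hT.col_iff (tq r' hs hs') tp2]; exact fun h => hs2 (h.trans he2)
  rcases hcases with hP | hQ
  · have hPA : ∀ r, 2 ≤ r → r ≤ k → Eqv m (del p 1) (del p r) := by
      intro r hr hrk
      refine (hP r hr (by omega)).resolve_right fun he => ?_
      have := run_sep le_rfl he (show 1 ≤ m + 1 by omega) (by omega) r (m + 1) le_rfl (by omega)
        (by omega) le_rfl
      have := hA r hr hrk
      omega
    have hPB : ∀ r, k < r → 2 ≤ r → r ≤ m → Eqv m (del p r) (del p (m + 1)) := by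
      intro r hr hr2 hrm
      refine (hP r hr2 hrm).resolve_left fun he => ?_
      have := run_sep (by omega) he (le_refl (m + 1)) (by omega) 1 r le_rfl (by omega) (by omega)
        le_rfl
      have := hB r hr hrm
      have := hcut 1 r le_rfl hk1 hr (by omega)
      omega
    rcases Nat.lt_or_ge k 2 with hk2 | hk2
    · left; left
      have he := hPB 2 (by omega) le_rfl (by omega)
      have hs := run_sep le_rfl he (show 0 ≤ m + 1 by omega) (by omega)
      rcases run_mono hp.inj (by omega) le_rfl he with hr | hr
      · have := hr 2 (m + 1) (by omega) (by omega) le_rfl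
        have := hB 2 (by omega) (by omega)
        omega
      · intro a b hab hb
        rw [del_ge (by omega : 1 ≤ b)]
        rcases Nat.eq_zero_or_pos a with rfl | ha
        · rw [del_lt (by omega)]
          have h1 := hs (b + 1) (m + 1) (by omega) (by omega) (by omega) le_rfl
          have := hp.inj.ne (show b + 1 ≤ m + 1 by omega) (Nat.zero_le (m + 1)) (by omega)
          omega
        · rw [del_ge ha]
          exact hr _ _ (by omega) (by omega) (by omega)
    rcases Nat.lt_or_ge k m with hkm' | hkm'
    · exfalso
      have hk1' := hB (k + 1) (by omega) (by omega)
      have q1 := qA1 2 le_rfl hk2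
      have q2 := qA2 2 le_rfl hk2
      have q3 := qB1 (k + 1) (by omega) (by omega)
      -- With both blocks nontrivial, the deletions of `q` at 2 and at `k + 1` avoid both end
      -- classes, so both fall into the third class and agree. But the entry 1 separates the values
      -- at 2 and `k + 1`.
      have n1 : ¬ Eqv m (del q 2) (del q 1) := fun he => by
        have := run_sep (by omega) he.symm (le_refl (m + 1)) (by omega) 1 2 le_rfl (by omega)
          (by omega) le_rfl
        have := hq.inj.ne (show 1 ≤ m + 1 by omega) (le_refl (m + 1)) (by omega)
        omega
      have n2 : ¬ Eqv m (del q 2) (del q (m + 1)) := fun he => by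
        rcases run_mono hq.inj (by omega) le_rfl he with hr | hr
        · have := hr (k + 1) (m + 1) (by omega) (by omega) le_rfl
          omega
        · have := hr 2 (m + 1) (by omega) (by omega) le_rfl
          omega
      have n3 : ¬ Eqv m (del q (k + 1)) (del q 1) := fun he => by
        rcases run_mono hq.inj (by omega) (by omega) he.symm with hr | hr
        · have := hr 1 2 (by omega) (by omega) (by omega)
          omega
        · have := hr 1 (k + 1) (by omega) (by omega) le_rfl
          omega
      have n4 : ¬ Eqv m (del q (k + 1)) (del q (m + 1)) := fun he => by
        have := run_sep le_rfl he (show 1 ≤ m + 1 by omega) (by omega) (k + 1) (m + 1) le_rfl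
          (by omega) (by omega) le_rfl
        omega
      have he : Eqv m (del q 2) (del q (k + 1)) := by
        have t2 := tq 2 le_rfl (by omega)
        have tk := tq (k + 1) (by omega) (by omega)
        refine (hT.col_iff t2 tk).1 ?_
        apply fin_three_third (col (del p 1)) (col (del p (m + 1)))
        · rwa [Ne, hT.col_iff tp1 tp2]
        · rw [Ne, hT.col_iff t2 tp1]; exact fun h => n1 (h.trans he1)
        · rw [Ne, hT.col_iff t2 tp2]; exact fun h => n2 (h.trans he2)
        · rw [Ne, hT.col_iff tk tp1]; exact fun h => n3 (h.trans he1)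
        · rw [Ne, hT.col_iff tk tp2]; exact fun h => n4 (h.trans he2)
      have := run_sep (by omega) he (show 1 ≤ m + 1 by omega) (by omega) 2 (k + 1) le_rfl
        (by omega) (by omega) le_rfl
      omega
    · right; left
      obtain rfl : k = m := by omega
      rcases run_mono hp.inj (by omega) (by omega) (hPA k hk2 le_rfl) with hr | hr
      · have := hr 1 k le_rfl (by omega) le_rfl
        have := hA k hk2 le_rfl
        omega
      · intro a b hab hb
        rw [del_lt (by omega), del_lt (by omega)]
        rcases Nat.eq_zero_or_pos a with rfl | ha
        · exact htop b (by omega) hb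
        · exact hr _ _ (by omega) (by omega) (by omega)
  · rcases Nat.lt_or_ge k 2 with hk2 | hk2
    · right
      refine IsLoop.eqv ?_ he2.symm
      right; right
      have he := (hQ m (by omega) le_rfl).resolve_right fun he => by
        have := run_sep le_rfl he (show 1 ≤ m + 1 by omega) (by omega) m (m + 1) le_rfl (by omega)
          (by omega) le_rfl
        have := qB1 m (by omega) le_rfl
        omega
      have hs := run_sep (by omega) he (show 0 ≤ m + 1 by omega) (by omega)
      rcases run_mono hq.inj (by omega) (by omega) he with hr | hr
      · refine ⟨fun a b ha hab hb => ?_, fun a ha ha' => ?_⟩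
        · rw [del_lt (by omega), del_lt (by omega)]
          exact hr _ _ (by omega) (by omega) (by omega)
        · rw [del_lt (by omega), del_lt (by omega)]
          have h1 := hs a 1 (by omega) (by omega) (by omega) (by omega)
          have := hq.inj.ne (show a ≤ m + 1 by omega) (Nat.zero_le (m + 1)) (by omega)
          omega
      · have := hr 1 m le_rfl (by omega) le_rfl
        have := qB1 m (by omega) le_rfl
        omega
    · left
      refine IsLoop.eqv ?_ he1.symm
      right; right
      have he := (hQ 2 (by omega) (by omega)).resolve_left fun he => by
        have := run_sep (by omega) he (le_refl (m + 1)) (by omega) 1 2 le_rfl (by omega)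
          (by omega) le_rfl
        have := qA2 2 le_rfl hk2
        have := hq.inj.ne (show 2 ≤ m + 1 by omega) (le_refl (m + 1)) (by omega)
        omega
      have hs := run_sep le_rfl he (show 0 ≤ m + 1 by omega) (by omega)
      rcases run_mono hq.inj (by omega) le_rfl he with hr | hr
      · refine ⟨fun a b ha hab hb => ?_, fun a ha ha' => ?_⟩
        · rw [del_ge (by omega), del_ge (by omega)]
          exact hr _ _ (by omega) (by omega) (by omega)
        · rw [del_ge (by omega), del_lt (by omega)]
          have h1 := hs (a + 1) (m + 1) (by omega) (by omega) (by omega) le_rfl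
          have := hq.inj.ne (show a + 1 ≤ m + 1 by omega) (Nat.zero_le (m + 1)) (by omega)
          omega
      · have := hr 2 (m + 1) le_rfl (by omega) le_rfl
        have := qA2 2 le_rfl hk2
        omega

end Pattern

/-! ### Exchanging the first and the last entry -/

namespace Pattern

variable {m : ℕ} {T : (ℕ → ℤ) → Prop} {col : (ℕ → ℤ) → Fin 3} {p q : ℕ → ℤ}

theorem Swap.agree' {s t : ℕ} (h : Swap m p q s t) (hp : Inj (m + 1) p) (hq : Inj (m + 1) q)
    (i j : ℕ) (hij : i < j) (hj : j ≤ m + 1) (hne : ¬ (i = s ∧ j = t)) :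
    (p j < p i ↔ q j < q i) := by
  have h1 := h.agree i j hij hj hne
  have h2 := hp.ne hj (show i ≤ m + 1 by omega) (by omega)
  have h3 := hq.ne hj (show i ≤ m + 1 by omega) (by omega)
  omega

theorem Swap.sep' {s t : ℕ} (h : Swap m p q s t) (hp : Inj (m + 1) p) (hs : s ≤ m + 1)
    (ht : t ≤ m + 1) {k : ℕ} (hk : k ≤ m + 1) (hks : k ≠ s) (hkt : k ≠ t) :
    (p s < p k ↔ p t < p k) := by
  have h1 := h.sep k hk hks hkt
  have h2 := hp.ne hk hs hks
  have h3 := hp.ne hk ht hkt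
  omega

/-- The case of a swap of the two end entries in which all middle deletions of `q` repeat an
end deletion. -/
theorem swap_ends_aux (hm : 4 ≤ m) (hT : Ctx m T col) (hp : Mem m T p) (hq : Mem m T q)
    (h : Swap m p q 0 (m + 1)) (hc1 : Con m (del p 0)) (hc2 : Con m (del p (m + 1)))
    (he1 : Eqv m (del p 0) (del q 0)) (he2 : Eqv m (del p (m + 1)) (del q (m + 1)))
    (hne : ¬ Eqv m (del p 0) (del p (m + 1)))
    (hall : ∀ r, 1 ≤ r → r ≤ m → Eqv m (del q 0) (del q r) ∨ Eqv m (del q r) (del q (m + 1))) :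
    IsLoop m (del p 0) ∨ IsLoop m (del p (m + 1)) := by
  have hlt := h.lt
  have hgt := h.gt
  have hag := h.agree
  have hag' := h.agree' hp.inj hq.inj
  -- Call an inner entry low or high according to its position relative to the two exchanged values,
  -- which are adjacent. In `q` the last entry separates a low entry from the first one, so deleting
  -- a low entry can only repeat the deletion of the last. High entries behave symmetrically.
  have hlow : ∀ r, 1 ≤ r → r ≤ m → p r < p 0 → ∀ a b, r ≤ a → a < b → b ≤ m + 1 → q a < q b := by
    intro r hr hrm hr0
    have q1 := (hag' 0 r (by omega) (by omega) (by omega)).1 hr0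
    have q2 := (hag r (m + 1) (by omega) le_rfl (by omega)).1 (by omega)
    have he := (hall r hr hrm).resolve_left fun he => by
      have := run_sep (by omega) he (le_refl (m + 1)) (by omega) 0 r le_rfl (by omega) (by omega)
        le_rfl
      omega
    rcases run_mono hq.inj (by omega) le_rfl he with h1 | h1
    · exact h1
    · have := h1 r (m + 1) le_rfl (by omega) le_rfl
      omega
  have hhigh : ∀ r, 1 ≤ r → r ≤ m → p 0 < p r → ∀ a b, a < b → b ≤ r → q a < q b := by
    intro r hr hrm hr0
    have q1 := (hag 0 r (by omega) (by omega) (by omega)).1 hr0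
    have he := (hall r hr hrm).resolve_right fun he => by
      have := run_sep le_rfl he (Nat.zero_le (m + 1)) (by omega) (m + 1) r (by omega) le_rfl le_rfl
        (by omega)
      omega
    rcases run_mono hq.inj (by omega) (by omega) he with h1 | h1
    · exact fun a b hab hb => h1 a b (by omega) hab hb
    · have := h1 0 r le_rfl (by omega) le_rfl
      omega
  -- the second entry is high and the penultimate entry is low
  have h1 : p 0 < p 1 := by
    by_contra hcon
    have hl : p 1 < p 0 := by
      have := hp.inj.ne (show 1 ≤ m + 1 by omega) (Nat.zero_le _) (by omega)
      omega
    have hr := hlow 1 le_rfl (by omega) hl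
    obtain ⟨i, hi, j, hj, hj', hij⟩ := hp.con.cross (le_refl m)
    obtain rfl : j = m + 1 := by omega
    rcases Nat.eq_zero_or_pos i with rfl | hi0
    · omega
    · have := (hag i (m + 1) (by omega) le_rfl (by omega)).2 (hr i _ hi0 (by omega) le_rfl)
      omega
  have hmm : p m < p 0 := by
    by_contra hcon
    have hl : p 0 < p m := by
      have := hp.inj.ne (show m ≤ m + 1 by omega) (Nat.zero_le _) (by omega)
      omega
    have hr := hhigh m (by omega) le_rfl hl
    obtain ⟨i, hi, j, hj, hj', hij⟩ := hp.con.cross (Nat.zero_le m)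
    obtain rfl : i = 0 := by omega
    rcases Nat.lt_or_ge j (m + 1) with hi0 | hi0
    · have := (hag 0 j (by omega) (by omega) (by omega)).2 (hr 0 j (by omega) (by omega))
      omega
    · obtain rfl : j = m + 1 := by omega
      omega
  have q01 := (hag 0 1 (by omega) (by omega) (by omega)).1 h1
  have q0m := (hag' 0 m (by omega) (by omega) (by omega)).1 hmm
  have qm : q m < q (m + 1) := (hag m (m + 1) (by omega) le_rfl (by omega)).1 (by omega)
  rcases lt_or_gt_of_ne (hp.inj.ne (show 2 ≤ m + 1 by omega) (Nat.zero_le _) (by omega)) with h2 | h2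
  · left
    refine IsLoop.eqv ?_ he1.symm
    right; right
    have hr := hlow 2 (by omega) (by omega) h2
    refine ⟨fun a b ha hab hb => ?_, fun a ha ha' => ?_⟩
    · rw [del_ge (by omega), del_ge (by omega)]
      exact hr _ _ (by omega) (by omega) (by omega)
    · rw [del_ge (by omega), del_ge (by omega), Nat.zero_add]
      rcases Nat.lt_or_ge a m with ham | ham
      · have := hr (a + 1) (m + 1) (by omega) (by omega) le_rfl
        omega
      · obtain rfl : a = m := by omega
        omega
  rcases lt_or_gt_of_ne (hp.inj.ne (show m - 1 ≤ m + 1 by omega) (Nat.zero_le _) (by omega))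
    with h3 | h3
  swap
  · right
    refine IsLoop.eqv ?_ he2.symm
    right; left
    have hr := hhigh (m - 1) (by omega) (by omega) h3
    refine ⟨fun a b hab hb => ?_, fun a ha => ?_⟩
    · rw [del_lt (by omega), del_lt (by omega)]
      exact hr _ _ (by omega) (by omega)
    · rw [del_lt (by omega), del_lt (by omega)]
      rcases Nat.eq_zero_or_pos a with rfl | ha0
      · omega
      · have := hr 0 a (by omega) (by omega)
        omega
  -- Now 1 and 2 are high while `m - 1` and `m` are low. Both neighbouring pairs turn out to be
  -- bonds of `p`, and the deletions at 0, 1, `m` and `m + 1` are four different children.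
  exfalso
  have hr2 := hhigh 2 (by omega) (by omega) h2
  have hrm := hlow (m - 1) (by omega) (by omega) h3
  have q12 := hr2 1 2 (by omega) le_rfl
  have p12 := (hag 1 2 (by omega) (by omega) (by omega)).2 q12
  have qmm := hrm (m - 1) m le_rfl (by omega) (by omega)
  have pmm := (hag (m - 1) m (by omega) (by omega) (by omega)).2 qmm
  have b1 : Bond (m + 1) p 1 := by
    intro k hk hk1 hk2
    have he := (hall 2 (by omega) (by omega)).resolve_right fun he => by
      have := run_sep le_rfl he (Nat.zero_le (m + 1)) (by omega) (m + 1) 2 (by omega) le_rfl le_rfl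
        (by omega)
      have := (hag 0 2 (by omega) (by omega) (by omega)).1 h2
      omega
    change p k < p 1 ↔ p k < p 2
    rcases Nat.eq_zero_or_pos k with rfl | hk0
    · omega
    · have h4 := run_sep (by omega) he hk (by omega) 1 2 (by omega) (by omega) (by omega) le_rfl
      rw [hag' 1 k (by omega) hk (by omega), hag' 2 k (by omega) hk (by omega)]
      exact h4
  have b2 : Bond (m + 1) p (m - 1) := by
    intro k hk hk1 hk2
    have he := (hall (m - 1) (by omega) (by omega)).resolve_left fun he => by
      have := run_sep (by omega) he (le_refl (m + 1)) (by omega) 0 (m - 1) le_rfl (by omega)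
        (by omega) le_rfl
      have := (hag' 0 (m - 1) (by omega) (by omega) (by omega)).1 h3
      have := hrm (m - 1) (m + 1) le_rfl (by omega) le_rfl
      omega
    rcases Nat.lt_or_ge k (m + 1) with hk0 | hk0
    · have h4 := run_sep le_rfl he hk (by omega) (m - 1) (m - 1 + 1) (by omega) (by omega)
        (by omega) (by omega)
      rw [hag k (m - 1) (by omega) (by omega) (by omega),
        hag k (m - 1 + 1) (by omega) (by omega) (by omega)]
      exact h4
    · obtain rfl : k = m + 1 := by omega
      rw [show m - 1 + 1 = m by omega]
      omega
  have c1 := b1.con hp.inj hp.con (by omega) (by omega)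
  have e2 := b2.del_eqv hp.inj (by omega)
  rw [show m - 1 + 1 = m by omega] at e2
  have c2 := e2.con (b2.con hp.inj hp.con (by omega) (by omega))
  have t0 := hp.child 0 (by omega) hc1
  have t1 := hp.child 1 (by omega) c1
  have t2 := hp.child m (by omega) c2
  have t3 := hp.child (m + 1) (by omega) hc2
  refine fin_three_four (col (del p 0)) (col (del p 1)) (col (del p m)) (col (del p (m + 1)))
    ?_ ?_ ?_ ?_ ?_ ?_
  · rw [Ne, hT.col_iff t0 t1]
    intro he
    have := run_sep (by omega) he (le_refl (m + 1)) (by omega) 0 1 le_rfl (by omega) (by omega)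
      le_rfl
    have := h.sep' hp.inj (by omega) le_rfl (show 1 ≤ m + 1 by omega) (by omega) (by omega)
    omega
  · rw [Ne, hT.col_iff t0 t2]
    intro he
    rcases run_mono hp.inj (by omega) (by omega) he with hr | hr
    · have := hr 0 m le_rfl (by omega) le_rfl
      omega
    · have := hr 0 1 le_rfl (by omega) (by omega)
      omega
  · rwa [Ne, hT.col_iff t0 t3]
  · rw [Ne, hT.col_iff t1 t2]
    intro he
    rcases run_mono hp.inj (by omega) (by omega) he with hr | hr
    · have := hr 1 m le_rfl (by omega) le_rfl
      omega
    · have := hr 1 2 le_rfl (by omega) (by omega)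
      omega
  · rw [Ne, hT.col_iff t1 t3]
    intro he
    rcases run_mono hp.inj (by omega) le_rfl he with hr | hr
    · have := hr 1 (m + 1) le_rfl (by omega) le_rfl
      have := h.sep' hp.inj (by omega) le_rfl (show 1 ≤ m + 1 by omega) (by omega) (by omega)
      omega
    · have := hr 1 2 le_rfl (by omega) (by omega)
      omega
  · rw [Ne, hT.col_iff t2 t3]
    intro he
    have := run_sep le_rfl he (Nat.zero_le (m + 1)) (by omega) m (m + 1) le_rfl (by omega)
      (by omega) le_rfl
    omega

theorem swap_ends (hm : 4 ≤ m) (hT : Ctx m T col) (hp : Mem m T p) (hq : Mem m T q)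
    (h : Swap m p q 0 (m + 1)) (hc1 : Con m (del p 0)) (hc2 : Con m (del p (m + 1)))
    (he1 : Eqv m (del p 0) (del q 0)) (he2 : Eqv m (del p (m + 1)) (del q (m + 1))) :
    IsLoop m (del p 0) ∨ IsLoop m (del p (m + 1)) := by
  have hlt := h.lt
  have hgt := h.gt
  have hag := h.agree
  have hag' := h.agree' hp.inj hq.inj
  obtain ⟨a0, ha0, d0, hd0, hd0', hcd0⟩ := hp.con.cross (Nat.zero_le m)
  obtain rfl : a0 = 0 := by omega
  have tp1 := hp.child 0 (by omega) hc1
  have tp2 := hp.child (m + 1) le_rfl hc2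
  have hne : ¬ Eqv m (del p 0) (del p (m + 1)) := by
    intro he
    rcases run_mono hp.inj (by omega) le_rfl he with hr | hr
    · have := hr 0 d0 le_rfl (by omega) hd0'
      omega
    · have := hr 0 (m + 1) le_rfl (by omega) le_rfl
      omega
  by_cases hall : ∀ r, 1 ≤ r → r ≤ m →
      Eqv m (del q 0) (del q r) ∨ Eqv m (del q r) (del q (m + 1))
  · exact swap_ends_aux hm hT hp hq h hc1 hc2 he1 he2 hne hall
  exfalso
  push Not at hall
  obtain ⟨r0, hr0, hr0', hr1, hr2⟩ := hall
  have tq0 := hq.child r0 (by omega) (con_del_of_inv hr0 hr0' hgt)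
  -- Some inner deletion of `q` occupies the third class. An indecomposable inner deletion of `p`
  -- cannot agree with it, because the end entries compare differently, and so it repeats an end
  -- deletion.
  have hnon : ∀ r, 1 ≤ r → r ≤ m → Con m (del p r) →
      Eqv m (del p 0) (del p r) ∨ Eqv m (del p r) (del p (m + 1)) := by
    intro r h1 h2 hc
    by_contra hcon
    push Not at hcon
    have tr := hp.child r (by omega) hc
    have : Eqv m (del p r) (del q r0) := by
      refine (hT.col_iff tr tq0).1 ?_
      apply fin_three_third (col (del p 0)) (col (del p (m + 1)))
      · rwa [Ne, hT.col_iff tp1 tp2]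
      · rw [Ne, hT.col_iff tr tp1]; exact fun h => hcon.1 h.symm
      · rw [Ne, hT.col_iff tr tp2]; exact hcon.2
      · rw [Ne, hT.col_iff tq0 tp1]; exact fun h => hr1 (h.trans he1).symm
      · rw [Ne, hT.col_iff tq0 tp2]; exact fun h => hr2 (h.trans he2)
    have := this 0 (by omega) m le_rfl
    rw [del_lt (by omega), del_ge (by omega), del_lt (by omega), del_ge (by omega)] at this
    omega
  have hlow : ∀ r, 1 ≤ r → r ≤ m → p r < p 0 → Con m (del p r) →
      ∀ a b, a < b → b ≤ r → p b < p a := by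
    intro r h1 h2 h3 hc
    have he := (hnon r h1 h2 hc).resolve_right fun he => by
      have := run_sep le_rfl he (Nat.zero_le (m + 1)) (by omega) r (m + 1) le_rfl (by omega)
        (by omega) le_rfl
      omega
    rcases run_mono hp.inj (by omega) (by omega) he with hr | hr
    · have := hr 0 r le_rfl (by omega) le_rfl
      omega
    · exact fun a b hab hb => hr a b (by omega) hab hb
  have hhigh : ∀ r, 1 ≤ r → r ≤ m → p 0 < p r → Con m (del p r) →
      (∀ a b, r ≤ a → a < b → b ≤ m + 1 → p b < p a) := by
    intro r h1 h2 h3 hc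
    have h4 := h.sep' hp.inj (by omega) le_rfl (show r ≤ m + 1 by omega) (by omega) (by omega)
    have he := (hnon r h1 h2 hc).resolve_left fun he => by
      have := run_sep (by omega) he (le_refl (m + 1)) (by omega) 0 r le_rfl (by omega)
        (by omega) le_rfl
      omega
    rcases run_mono hp.inj (by omega) le_rfl he with hr | hr
    · have := hr r (m + 1) le_rfl (by omega) le_rfl
      omega
    · exact hr
  have hhsep : ∀ r, 1 ≤ r → r ≤ m → p 0 < p r → p (m + 1) < p r := fun r h1 h2 h3 =>
    (h.sep' hp.inj (by omega) le_rfl (show r ≤ m + 1 by omega) (by omega) (by omega)).1 h3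
  have hlsep : ∀ r, 1 ≤ r → r ≤ m → p r < p (m + 1) → p r < p 0 := fun r h1 h2 h3 =>
    (h.sep r (by omega) (by omega) (by omega)).2 h3
  have hlcut : ∀ r, 1 ≤ r → r ≤ m → p r < p 0 → ¬ Con m (del p r) →
      ∃ K < r, (∀ a b, a ≤ K → K < b → b ≤ m + 1 → b ≠ r → p a < p b) := by
    intro r h1 h2 h3 hc
    obtain ⟨K, hK, -, -, hcut⟩ := cut_of_not_con hp.inj (by omega) hc
    obtain ⟨i, hi, j, hj, hj', hij⟩ := hp.con.cross hK
    have hKr : K < r := by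
      by_contra hcon
      have := hcut 0 j (by omega) (by omega) hj hj' (by omega)
      by_cases hir : i = r
      · subst hir; omega
      · have := hcut i j hi hir hj hj' (by omega)
        omega
    exact ⟨K, hKr, fun a b ha hb hb' hbr => hcut a b ha (by omega) hb hb' hbr⟩
  have hhcut : ∀ r, 1 ≤ r → r ≤ m → p 0 < p r → ¬ Con m (del p r) →
      ∃ K, r ≤ K ∧ K ≤ m ∧ (∀ a b, a ≤ K → a ≠ r → K < b → b ≤ m + 1 → p a < p b) := by
    intro r h1 h2 h3 hc
    obtain ⟨K, hK, -, -, hcut⟩ := cut_of_not_con hp.inj (by omega) hc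
    obtain ⟨i, hi, j, hj, hj', hij⟩ := hp.con.cross hK
    have := hhsep r h1 h2 h3
    have hKr : r ≤ K := by
      by_contra hcon
      have := hcut i (m + 1) hi (by omega) (by omega) (by omega) (by omega)
      by_cases hjr : j = r
      · subst hjr; omega
      · have := hcut i j hi (by omega) hj hj' hjr
        omega
    exact ⟨K, hKr, hK, fun a b ha har hb hb' => hcut a b ha har hb hb' (by omega)⟩
  -- there is a low cut entry
  have hexl : ∃ r, 1 ≤ r ∧ r ≤ m ∧ p r < p 0 ∧ ¬ Con m (del p r) := by
    by_contra hcon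
    push Not at hcon
    have hd : ∀ r, 1 ≤ r → r ≤ m → p r < p 0 → ∀ a, 1 ≤ a → a ≤ r → p a < p 0 :=
      fun r h1 h2 h3 a ha har => hlow r h1 h2 h3 (hcon r h1 h2 h3) 0 a (by omega) har
    -- Without low cut entries, each low entry ends a decreasing run from position 0, so the low
    -- entries form an initial segment of the inner positions. The gap after this segment, or the
    -- last gap if all inner entries are low, is not crossed by any inversion.
    have hP : ∃ r, 1 ≤ r ∧ ∀ a, r ≤ a → a ≤ m → p 0 < p a := ⟨m + 1, by omega, by omega⟩
    classical
    obtain ⟨hf1, hf2⟩ := Nat.find_spec hP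
    have hmin := fun {x} => Nat.find_min hP (m := x)
    generalize Nat.find hP = r at hf1 hf2 hmin
    have hlr : ∀ a, 1 ≤ a → a < r → a ≤ m → p a < p 0 := by
      intro a ha har ham
      have h5 := hmin (x := r - 1) (by omega)
      push Not at h5
      obtain ⟨c, hc1, hc2, hc3⟩ := h5 (by omega)
      have hc : c = r - 1 := by
        by_contra hne
        have := hf2 c (by omega) hc2
        omega
      have := hp.inj.ne (show c ≤ m + 1 by omega) (Nat.zero_le _) (by omega)
      exact hd c (by omega) hc2 (by omega) a ha (by omega)
    rcases Nat.lt_or_ge m r with hr | hr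
    · obtain ⟨i, hi, j, hj, hj', hij⟩ := hp.con.cross (le_refl m)
      obtain rfl : j = m + 1 := by omega
      rcases Nat.eq_zero_or_pos i with rfl | hi0
      · omega
      · have := hlr i (by omega) (by omega) hi
        omega
    · obtain ⟨i, hi, j, hj, hj', hij⟩ := hp.con.cross (show r - 1 ≤ m by omega)
      have hi' : p i ≤ p 0 := by
        rcases Nat.eq_zero_or_pos i with rfl | hi0
        · exact le_rfl
        · exact (hlr i hi0 (by omega) (by omega)).le
      have hj'' : p 0 < p j := by
        rcases Nat.lt_or_ge m j with h6 | h6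
        · obtain rfl : j = m + 1 := by omega
          exact hlt
        · exact hf2 j (by omega) h6
      omega
  -- there is a high cut entry
  have hexh : ∃ r, 1 ≤ r ∧ r ≤ m ∧ p 0 < p r ∧ ¬ Con m (del p r) := by
    by_contra hcon
    push Not at hcon
    obtain ⟨r, h1, h2, h3, h4⟩ := hexl
    obtain ⟨K, hK, hcut⟩ := hlcut r h1 h2 h3 h4
    rcases Nat.lt_or_ge (K + 1) r with h5 | h5
    · have h6 := hcut 0 (K + 1) (by omega) (by omega) (by omega) (by omega)
      have := hhigh (K + 1) (by omega) (by omega) h6 (hcon _ (by omega) (by omega) h6) r (m + 1)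
        (by omega) (by omega) le_rfl
      omega
    · obtain ⟨i, hi, j, hj, hj', hij⟩ := hp.con.cross h2
      have := hcut 0 j (by omega) (by omega) hj' (by omega)
      by_cases hir : i = r
      · subst hir; omega
      · have := hcut i j (by omega) (by omega) hj' (by omega)
        omega
  obtain ⟨r, h1, h2, h3, h4⟩ := hexl
  obtain ⟨K, hK, hcut⟩ := hlcut r h1 h2 h3 h4
  obtain ⟨r', h1', h2', h3', h4'⟩ := hexh
  obtain ⟨K', hK', hK'm, hcut'⟩ := hhcut r' h1' h2' h3' h4'
  -- The low cut entry `r` forces everything up to `K` to be low and everything beyond it to be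
  -- high, with `r` as the exception; the high cut entry `r'` does the same with `K'`. Between the
  -- two gaps only `r` and `r'` remain, so `r' = K + 1` and `r = K + 2`. The deletions of `q` at 0,
  -- `K + 1`, `K + 2` and `m + 1` are then four different children.
  have hlow1 : ∀ a, 1 ≤ a → a ≤ K → p a < p 0 := fun a ha hak =>
    hlsep a ha (by omega) (hcut a (m + 1) hak (by omega) le_rfl (by omega))
  have hhigh1 : ∀ a, K < a → a ≤ m → a ≠ r → p 0 < p a := fun a ha hak har =>
    hcut 0 a (by omega) (by omega) (by omega) har
  have hlow2 : ∀ a, 1 ≤ a → a ≤ K' → a ≠ r' → p a < p 0 := fun a ha hak har =>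
    hlsep a ha (by omega) (hcut' a (m + 1) hak har (by omega) le_rfl)
  have hhigh2 : ∀ a, K' < a → a ≤ m → p 0 < p a := fun a ha ham =>
    hcut' 0 a (by omega) (by omega) ha (by omega)
  have hrK' : r ≤ K' := by
    by_contra hcon
    have := hhigh2 r (by omega) h2
    omega
  have hr'K : K < r' := by
    by_contra hcon
    have := hlow1 r' h1' (by omega)
    omega
  have hmid : ∀ a, K < a → a ≤ K' → a = r ∨ a = r' := by
    intro a ha ha'
    by_contra hcon
    have := hlow2 a (by omega) ha' (by omega)
    have := hhigh1 a ha (by omega) (by omega)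
    omega
  have hrr' : r ≠ r' := by rintro rfl; omega
  have hm1 := hmid (K + 1) (by omega) (by omega)
  have hm2 := hmid (K + 2) (by omega) (by omega)
  have hm3 : K' ≤ K + 2 := by
    by_contra hcon
    have := hmid (K + 3) (by omega) (by omega)
    omega
  have hrK : r = K + 2 := by
    by_contra hcon
    have hr1 : r = K + 1 := by omega
    subst hr1
    obtain ⟨i, hi, j, hj, hj', hij⟩ := hp.con.cross (show K + 1 ≤ m by omega)
    have := hcut 0 j (by omega) (by omega) hj' (by omega)
    by_cases hir : i = K + 1
    · subst hir; omega
    · have := hcut i j (by omega) (by omega) hj' (by omega)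
      omega
  obtain rfl : r' = K + 1 := by omega
  obtain rfl : K' = K + 2 := by omega
  subst hrK
  have hdl : 1 ≤ K → ∀ a b, a < b → b ≤ K → p b < p a := by
    intro hK1
    have hl := hlow1 K hK1 le_rfl
    refine hlow K hK1 (by omega) hl ?_
    by_contra hc
    obtain ⟨K2, hK2, hcut2⟩ := hlcut K hK1 (by omega) hl hc
    have := hcut2 0 (K + 2) (by omega) (by omega) (by omega) (by omega)
    omega
  have hdh : K + 3 ≤ m → Eqv m (del p (K + 3)) (del p (m + 1)) := by
    intro hK1
    have hl := hhigh2 (K + 3) (by omega) hK1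
    refine (hnon (K + 3) (by omega) hK1 ?_).resolve_left ?_
    · by_contra hc
      obtain ⟨K2, hK2, hK2m, hcut2⟩ := hhcut (K + 3) (by omega) hK1 hl hc
      have := hcut2 (K + 1) (m + 1) (by omega) (by omega) (by omega) (by omega)
      have := hhsep (K + 1) (by omega) (by omega) h3'
      omega
    · intro he
      have := run_sep (by omega) he (le_refl (m + 1)) (by omega) 0 (K + 3) le_rfl (by omega)
        (by omega) le_rfl
      have := hhsep (K + 3) (by omega) hK1 hl
      omega
  have q1 : q 0 < q (K + 1) := (hag 0 (K + 1) (by omega) (by omega) (by omega)).1 h3'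
  have q2 : q (K + 2) < q (m + 1) := (hag (K + 2) (m + 1) (by omega) (by omega) (by omega)).1
    (by omega)
  have t0 := hT.cl tp1 he1
  have t1 := hT.cl tp2 he2
  have t2 := hq.child (K + 1) (by omega) (con_del_of_inv (by omega) (by omega) hgt)
  have t3 := hq.child (K + 2) (by omega) (con_del_of_inv (by omega) (by omega) hgt)
  refine fin_three_four (col (del q 0)) (col (del q (K + 1))) (col (del q (K + 2)))
    (col (del q (m + 1))) ?_ ?_ ?_ ?_ ?_ ?_
  · rw [Ne, hT.col_iff t0 t2]
    intro he
    rcases run_mono hq.inj (by omega) (by omega) he with hr | hr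
    · rcases Nat.eq_zero_or_pos K with rfl | hK0
      · have hK3 : 0 + 3 ≤ m := by omega
        have hs := run_sep le_rfl (hdh hK3) (show 0 + 1 ≤ m + 1 by omega) (by omega) (0 + 3) (m + 1)
          le_rfl (by omega) (by omega) le_rfl
        have h5 := hhigh2 (0 + 3) (by omega) hK3
        have h6 := hhsep (0 + 1) (by omega) (by omega) h3'
        have h7 := hp.inj.ne (show 0 + 1 ≤ m + 1 by omega) (show 0 + 3 ≤ m + 1 by omega) (by omega)
        have h8 := (hag 0 (0 + 3) (by omega) (by omega) (by omega)).1 h5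
        have h9 := (hag' (0 + 1) (0 + 3) (by omega) (by omega) (by omega)).1 (by omega)
        have := run_sep (by omega) he (show 0 + 3 ≤ m + 1 by omega) (by omega) 0 (0 + 1) (by omega)
          (by omega) (by omega) (by omega)
        omega
      · have := hr 0 1 le_rfl (by omega) (by omega)
        have := (hag' 0 1 (by omega) (by omega) (by omega)).1 (hlow1 1 le_rfl hK0)
        omega
    · have := hr 0 (K + 1) le_rfl (by omega) le_rfl
      omega
  · rw [Ne, hT.col_iff t0 t3]
    intro he
    rcases run_mono hq.inj (by omega) (by omega) he with hr | hr
    · have := hr 0 (K + 2) le_rfl (by omega) le_rfl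
      omega
    · have := hr 0 (K + 1) le_rfl (by omega) (by omega)
      omega
  · rw [Ne, hT.col_iff t0 t1]
    exact fun he => hne (he1.trans (he.trans he2.symm))
  · rw [Ne, hT.col_iff t2 t3]
    intro he
    have := run_sep (by omega) he (Nat.zero_le _) (by omega) (K + 1) (K + 2) le_rfl (by omega)
      (by omega) le_rfl
    omega
  · rw [Ne, hT.col_iff t2 t1]
    intro he
    rcases run_mono hq.inj (by omega) (by omega) he with hr | hr
    · have := hr (K + 1) (m + 1) le_rfl (by omega) le_rfl
      omega
    · have := hr (K + 2) (m + 1) (by omega) (by omega) le_rfl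
      omega
  · rw [Ne, hT.col_iff t3 t1]
    intro he
    rcases run_mono hq.inj (by omega) (by omega) he with hr | hr
    · rcases Nat.lt_or_ge m (K + 3) with hK3 | hK3
      · have hK0 : 1 ≤ K := by omega
        have h5 := hcut' (K + 2) (m + 1) (by omega) (by omega) (by omega) (by omega)
        have hcK : Con m (del p K) := by
          by_contra hc
          obtain ⟨K2, hK2, hcut2⟩ := hlcut K hK0 (by omega) (hlow1 K hK0 le_rfl) hc
          have := hcut2 0 (K + 2) (by omega) (by omega) (by omega) (by omega)
          omega
        have he3 := (hnon K hK0 (by omega) hcK).resolve_right fun he => by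
          have := run_sep le_rfl he (Nat.zero_le _) (by omega) K (m + 1) le_rfl (by omega)
            (by omega) le_rfl
          have := hlow1 K hK0 le_rfl
          omega
        have h6 := run_sep (by omega) he3 (show K + 2 ≤ m + 1 by omega) (by omega) 0 K le_rfl
          (by omega) (by omega) le_rfl
        have h7 := (hag' K (K + 2) (by omega) (by omega) (by omega)).1 (h6.1 h3)
        have h8 := (hag K (m + 1) (by omega) (by omega) (by omega)).1
          ((hlow1 K hK0 le_rfl).trans hlt)
        have := run_sep le_rfl he (show K ≤ m + 1 by omega) (by omega) (K + 2) (m + 1) le_rfl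
          (by omega) (by omega) le_rfl
        omega
      · have := hr (K + 3) (m + 1) (by omega) (by omega) le_rfl
        have := (hag' (K + 3) (m + 1) (by omega) le_rfl (by omega)).1
          (hhsep (K + 3) (by omega) hK3 (hhigh2 (K + 3) (by omega) hK3))
        omega
    · have := hr (K + 2) (m + 1) le_rfl (by omega) le_rfl
      omega

end Pattern

/-! ### Members with the same left and the same right child -/

namespace Pattern

variable {m : ℕ} {T : (ℕ → ℤ) → Prop} {col : (ℕ → ℤ) → Fin 3} {p q : ℕ → ℤ}

theorem Swap.rc {s t : ℕ} (h : Swap m p q s t) (hp : Inj (m + 1) p)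
    (hs : s ≤ m + 1) (ht : t ≤ m + 1) :
    Swap m (rc (m + 1) p) (rc (m + 1) q) (m + 1 - t) (m + 1 - s) := by
  refine ⟨?_, ?_, fun i j hij hj hne => ?_, fun k hk hks hkt => ?_⟩
  · rw [rc_le hs, rc_le ht]; have := h.lt; omega
  · rw [rc_le hs, rc_le ht]; have := h.gt; omega
  · have := h.agree (m + 1 - j) (m + 1 - i) (by omega) (by omega) (by omega)
    unfold Pattern.rc
    omega
  · rw [rc_le hs, rc_le ht]
    have := h.sep' hp hs ht (show m + 1 - k ≤ m + 1 by omega) (by omega) (by omega)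
    unfold Pattern.rc
    omega

/-- Reverse complement reduces an exchange with the penultimate entry to one with the second entry,
so that two kinds of exchange suffice. -/
theorem swap_loop (hm : 4 ≤ m) (hT : Ctx m T col) (hp : Mem m T p) (hq : Mem m T q) {s t : ℕ}
    (hs : s ≤ 1) (ht : m ≤ t) (ht' : t ≤ m + 1) (h : Swap m p q s t)
    (h0 : s = 1 → ¬ Con m (del p 0)) (h1 : t = m → ¬ Con m (del p (m + 1)))
    (hc1 : Con m (del p s)) (hc2 : Con m (del p t)) (he1 : Eqv m (del p s) (del q s))
    (he2 : Eqv m (del p t) (del q t)) :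
    IsLoop m (del p s) ∨ IsLoop m (del p t) := by
  rcases Nat.lt_or_ge t (m + 1) with h2 | h2
  · obtain rfl : t = m := by omega
    have h1 := h1 rfl
    rcases Nat.eq_zero_or_pos s with rfl | hs1
    · have hsw := h.rc hp.inj (by omega) (by omega)
      rw [show t + 1 - t = 1 by omega, Nat.sub_zero] at hsw
      have e0 := del_rc (m := t) p (Nat.zero_le (t + 1))
      have e1 := del_rc (m := t) p (show 1 ≤ t + 1 by omega)
      have e2 := del_rc (m := t) p (le_refl (t + 1))
      have e1' := del_rc (m := t) q (show 1 ≤ t + 1 by omega)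
      have e2' := del_rc (m := t) q (le_refl (t + 1))
      rw [Nat.add_sub_cancel] at e1 e1'
      rw [Nat.sub_self] at e2 e2'
      rw [Nat.sub_zero] at e0
      have := swap_one_last hm hT.rc (hp.rc hT) (hq.rc hT) hsw
        (fun hc => h1 (con_rc_iff.1 (e0.con hc))) (e1.symm.con hc2.rc) (e2.symm.con hc1.rc)
        (e1.trans (he2.rc.trans e1'.symm)) (e2.trans (he1.rc.trans e2'.symm))
      rcases this with h3 | h3
      · exact Or.inr (isLoop_rc_iff.1 (h3.eqv e1))
      · exact Or.inl (isLoop_rc_iff.1 (h3.eqv e2))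
    -- Both end entries of `p` are cut entries here. Either the last entry separates the values at 1
    -- and at the penultimate position, which are adjacent, or the two cuts order the last two
    -- entries in opposite ways.
    · exfalso
      obtain rfl : s = 1 := by omega
      obtain ⟨k, hk1, hkm, hcut, -⟩ := cut_first hp.inj hp.con (h0 rfl)
      obtain ⟨l, hl1, hlm, -, hcut', -⟩ := cut_last hp.inj hp.con h1
      have h3 := hcut' t hlm le_rfl
      rcases Nat.lt_or_ge k t with h4 | h4
      · have := hcut 1 (t + 1) le_rfl hk1 (by omega) le_rfl
        have := h.sep (t + 1) le_rfl (by omega) (by omega)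
        omega
      · have := hcut t (t + 1) (by omega) (by omega) (by omega) le_rfl
        omega
  · obtain rfl : t = m + 1 := by omega
    rcases Nat.eq_zero_or_pos s with rfl | hs1
    · exact swap_ends hm hT hp hq h hc1 hc2 he1 he2
    · obtain rfl : s = 1 := by omega
      exact swap_one_last hm hT hp hq h (h0 rfl) hc1 hc2 he1 he2

/-- Every pair of positions other than `s`, `t` survives one of the two deletions, so only this pair
can compare differently. A third entry with value between those at `s` and `t` would fix their order
in both patterns. -/
theorem swap_of_eqv {s t : ℕ} (hp : Inj (m + 1) p) (hq : Inj (m + 1) q) (hst : s < t)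
    (ht : t ≤ m + 1) (he1 : Eqv m (del p s) (del q s)) (he2 : Eqv m (del p t) (del q t))
    (hne : ¬ Eqv (m + 1) p q) : Swap m p q s t ∨ Swap m q p s t := by
  have hag : ∀ i ≤ m + 1, ∀ j ≤ m + 1, i ≠ j → ¬ (i = s ∧ j = t) → ¬ (i = t ∧ j = s) →
      (p i < p j ↔ q i < q j) := by
    intro i hi j hj hij h1 h2
    by_cases h3 : i ≠ s ∧ j ≠ s
    · exact he1.del_same (by omega) hi hj h3.1 h3.2
    · exact he2.del_same ht hi hj (by omega) (by omega)
  have hd : ¬ (p s < p t ↔ q s < q t) := by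
    intro h
    apply hne
    apply Eqv.of_lt hp hq
    intro i j hij hj
    by_cases h1 : i = s ∧ j = t
    · rw [h1.1, h1.2]; exact h
    · exact hag i (by omega) j hj (by omega) h1 (by omega)
  have hpst := hp.ne (show s ≤ m + 1 by omega) ht (by omega)
  have hqst := hq.ne (show s ≤ m + 1 by omega) ht (by omega)
  by_cases hlt : p s < p t
  · left
    refine ⟨hlt, by omega, fun i j hij hj h => hag i (by omega) j hj (by omega) h (by omega),
      fun k hk h1 h2 => ?_⟩
    have e1 := hag k hk s (by omega) h1 (by omega) (by omega)
    have e2 := hag k hk t (by omega) h2 (by omega) (by omega)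
    omega
  · right
    refine ⟨by omega, by omega, fun i j hij hj h =>
      (hag i (by omega) j hj (by omega) h (by omega)).symm, fun k hk h1 h2 => ?_⟩
    have e1 := hag k hk s (by omega) h1 (by omega) (by omega)
    have e2 := hag k hk t (by omega) h2 (by omega) (by omega)
    omega

/-- Adding inversions preserves indecomposability. -/
theorem con_del_of_inversions {r : ℕ} (hr : r ≤ m + 1) (h : Con m (del q r))
    (hpq : ∀ i j, i < j → j ≤ m + 1 → i ≠ r → j ≠ r → q j < q i → p j < p i) :
    Con m (del p r) :=
  con_del_of hr fun k hk h0 h1 => by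
    obtain ⟨i, hi, hir, j, hj, hj', hjr, hlt⟩ := h.of_del hr hk h0 h1
    exact ⟨i, hi, hir, j, hj, hj', hjr, hpq i j (by omega) hj' hir hjr hlt⟩

theorem swap_first_not_con {s t : ℕ} (h : Swap m p q s t) (hp : Inj (m + 1) p)
    (hq : Inj (m + 1) q) {r : ℕ} (hr : r ≤ m + 1)
    (h0 : ¬ Con m (del p r) ∨ ¬ Con m (del q r)) : ¬ Con m (del p r) := by
  rcases h0 with h0 | h0
  · exact h0
  · intro hc
    apply h0
    apply con_del_of_inversions hr hc
    intro i j hij hj _ _ hlt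
    by_cases hne : i = s ∧ j = t
    · have := h.lt
      rw [hne.1, hne.2] at hlt
      omega
    · exact (h.agree' hp hq i j hij hj hne).1 hlt

/-- Patterns with the same left and the same right child agree except possibly between an entry
among the first two and one among the last two. -/
theorem agree_of_parallel
    (hL : Eqv m (L m p) (L m q)) (hR : Eqv m (R m p) (R m q)) {i j : ℕ}
    (hi : i ≤ m + 1) (hj : j ≤ m + 1) (h : ¬ (i ≤ 1 ∧ m ≤ j)) (h' : ¬ (j ≤ 1 ∧ m ≤ i)) :
    (p i < p j ↔ q i < q j) := by
  by_cases h1 : 2 ≤ i ∧ 2 ≤ j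
  · have := hL (i - 1) (by omega) (j - 1) (by omega)
    rwa [L_pos _ (by omega), L_pos _ (by omega), L_pos _ (by omega), L_pos _ (by omega),
      Nat.sub_add_cancel (by omega), Nat.sub_add_cancel (by omega)] at this
  · by_cases h2 : i < m ∧ j < m
    · have := hR i (by omega) j (by omega)
      rwa [R_lt _ h2.1, R_lt _ h2.2, R_lt _ h2.1, R_lt _ h2.2] at this
    · by_cases hij : i = j
      · subst hij; simp
      · have : m ≤ 1 := by omega
        omega

/-- Two deletions with the same effect can be made at a common place at the left end. -/
theorem exists_common_first (hm : 4 ≤ m) (hT : Ctx m T col) (hp : Mem m T p) (hq : Mem m T q)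
    (hL : Eqv m (L m p) (L m q)) (hR : Eqv m (R m p) (R m q)) (hps : sL m p = 0) :
    ∃ s ≤ 1, Con m (del p s) ∧ Con m (del q s) ∧ Eqv m (del p s) (del q s) ∧
      Eqv m (L m p) (del p s) ∧ (s = 1 → ¬ Con m (del q 0)) := by
  have hag := fun i j hi hj h h' => agree_of_parallel hL hR (i := i) (j := j) hi hj h h'
  rcases sL_cases m q with ⟨hqs, hq0⟩ | ⟨hqs, hq0⟩
  · refine ⟨0, by omega, by simpa [L, hps] using con_L hp.inj hp.con, hq0, ?_, ?_, by simp⟩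
    · simpa [L, hps, hqs] using hL
    · simpa [L, hps] using Eqv.refl m _
  obtain ⟨k, hk1, hkm, hcut, htop, j2, hj2, hj2m, hj20⟩ := cut_first hq.inj hq.con hq0
  have hq1 := con_del_one hq.inj hq.con hq0
  have hL0 : ∀ j, 2 ≤ j → j ≤ m + 1 → (p 1 < p j ↔ q 0 < q j) := by
    intro j hj hj'
    have := hL 0 (by omega) (j - 1) (by omega)
    rcases L_zero m p with ⟨h1, h2⟩ | ⟨h1, -⟩
    · rcases L_zero m q with ⟨h3, -⟩ | ⟨h3, h4⟩
      · omega
      · rwa [h2, h4, L_pos _ (by omega), L_pos _ (by omega), Nat.sub_add_cancel (by omega)] at this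
    · omega
  have q10 : q 1 < q 0 := htop 1 le_rfl hk1
  have p10 : p 1 < p 0 := (hag 1 0 (by omega) (by omega) (by omega) (by omega)).2 q10
  -- Here the left child of `p` deletes its entry 0 and that of `q` its entry 1. If the entries 0 of
  -- `p` and of `q` compare alike with all later entries, then deleting 1 from either pattern has
  -- the same effect, and position 1 serves for both.
  by_cases hall : ∀ j, 2 ≤ j → j ≤ m + 1 → (p 0 < p j ↔ q 0 < q j)
  · have he : Eqv m (del p 1) (del q 1) := by
      apply Eqv.of_lt (inj_del hp.inj 1) (inj_del hq.inj 1)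
      intro i j hij hj
      rw [del_ge (by omega : 1 ≤ j), del_ge (by omega : 1 ≤ j)]
      rcases Nat.eq_zero_or_pos i with rfl | hi
      · rw [del_lt (by omega), del_lt (by omega)]
        exact hall _ (by omega) (by omega)
      · rw [del_ge hi, del_ge hi]
        exact hag _ _ (by omega) (by omega) (by omega) (by omega)
    refine ⟨1, le_rfl, he.symm.con hq1, hq1, he, ?_, fun _ => hq0⟩
    refine hL.trans (Eqv.trans ?_ he.symm)
    simpa [L, hqs] using Eqv.refl m _
  exfalso
  push Not at hall
  obtain ⟨j, hj, hjm, hj'⟩ := hall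
  have hL0j := hL0 j hj hjm
  have hpj0 := hp.inj.ne hjm (Nat.zero_le (m + 1)) (by omega)
  have hpj1 := hp.inj.ne hjm (show 1 ≤ m + 1 by omega) (by omega)
  have hqj0 := hq.inj.ne hjm (Nat.zero_le (m + 1)) (by omega)
  have hj1 : p 1 < p j ∧ p j < p 0 ∧ q 0 < q j := by omega
  obtain ⟨hj1, hj0, hqj⟩ := hj1
  have hjm' : m ≤ j := by
    by_contra hcon
    have := hag 0 j (by omega) hjm (by omega) (by omega)
    omega
  have hL0j2 := hL0 j2 (by omega) hj2m
  have hpj21 := hp.inj.ne hj2m (show 1 ≤ m + 1 by omega) (by omega)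
  have hqj2 := hcut 1 j2 le_rfl hk1 hj2 hj2m
  have hj2m' : m ≤ j2 := by
    by_contra hcon
    have := hag 1 j2 (by omega) hj2m (by omega) (by omega)
    omega
  have hR0 := hR 0 (by omega) m le_rfl
  have hR1 := hR 1 (by omega) m le_rfl
  rw [R_lt p (by omega : 0 < m), R_lt q (by omega : 0 < m)] at hR0
  rw [R_lt p (by omega : 1 < m), R_lt q (by omega : 1 < m)] at hR1
  -- By `agree_of_parallel` the witnesses `j` and `j2` must lie at the last two positions. The
  -- equality of the right children decides which is which, and that `p` loses its last entry but
  -- `q` its penultimate one.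
  have hX : j = m ∧ j2 = m + 1 ∧ tR m p = m + 1 ∧ R m p m = p m ∧ tR m q = m ∧
      R m q m = q (m + 1) := by
    rcases lt_or_gt_of_ne (show j ≠ j2 by rintro rfl; omega) with h1 | h1
    · obtain rfl : j = m := by omega
      obtain rfl : j2 = j + 1 := by omega
      rcases R_last j p with ⟨h2, h3⟩ | ⟨h2, h3⟩ <;> rcases R_last j q with ⟨h4, h5⟩ | ⟨h4, h5⟩ <;>
        rw [h3, h5] at hR0 hR1 <;> first | (exfalso; omega) | simp_all
    · obtain rfl : j2 = m := by omega
      obtain rfl : j = j2 + 1 := by omega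
      exfalso
      have ht : tR j2 p = j2 := by
        rcases R_last j2 p with ⟨h2, h3⟩ | ⟨h2, h3⟩ <;>
          rcases R_last j2 q with ⟨h4, h5⟩ | ⟨h4, h5⟩ <;>
          rw [h3, h5] at hR0 hR1 <;> first | (exfalso; omega) | exact h2
      rcases tR_cases j2 p with ⟨h2, h3⟩ | ⟨h2, h3⟩
      · omega
      · obtain ⟨l, hl, hlm, -, hl', -⟩ := cut_last hp.inj hp.con h3
        have := hl' j2 hlm le_rfl
        omega
  obtain ⟨rfl, rfl, htp, hRp, htq, hRq⟩ := hX
  have hRj : ∀ i, i < j → (p i < p j ↔ q i < q (j + 1)) := by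
    intro i hi
    have := hR i (by omega) j le_rfl
    rwa [R_lt p hi, R_lt q hi, hRp, hRq] at this
  have cp0 : Con j (del p 0) := by simpa [L, hps] using con_L hp.inj hp.con
  have cpl : Con j (del p (j + 1)) := by simpa [R, htp] using con_R hp.inj hp.con
  have cqm : Con j (del q j) := by simpa [R, htq] using con_R hq.inj hq.con
  -- All inversions of `q` are inversions of `p`. The deletions at 1 and at `j`, indecomposable for
  -- `q`, are thus indecomposable for `p`, which now has four different children.
  have hinv : ∀ i i', i < i' → i' ≤ j + 1 → q i' < q i → p i' < p i := by
    intro i i' hii hi' hlt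
    by_cases h1 : i ≤ 1 ∧ j ≤ i'
    · rcases (show i = 0 ∨ i = 1 by omega) with rfl | rfl <;>
        rcases (show i' = j ∨ i' = j + 1 by omega) with rfl | rfl <;> omega
    · exact (hag _ _ (by omega) (by omega) (by omega) (by omega)).2 hlt
  have cp1 := con_del_of_inversions (by omega) hq1 fun i i' h1 h2 _ _ => hinv i i' h1 h2
  have cpm := con_del_of_inversions (by omega) cqm fun i i' h1 h2 _ _ => hinv i i' h1 h2
  have t0 := hp.child _ (by omega) cp0
  have t1 := hp.child _ (by omega) cp1
  have t2 := hp.child _ (by omega) cpm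
  have t3 := hp.child _ (by omega) cpl
  refine fin_three_four (col (del p 0)) (col (del p 1)) (col (del p j)) (col (del p (j + 1)))
    ?_ ?_ ?_ ?_ ?_ ?_
  · rw [Ne, hT.col_iff t0 t1]
    intro he
    have := run_sep (by omega) he (show j ≤ j + 1 by omega) (by omega) 0 1 le_rfl (by omega)
      (by omega) le_rfl
    have := hp.inj.ne (Nat.zero_le (j + 1)) (show j ≤ j + 1 by omega) (by omega)
    omega
  · rw [Ne, hT.col_iff t0 t2]
    intro he
    rcases run_mono hp.inj (by omega) (by omega) he with hr | hr
    · have := hr 0 j le_rfl (by omega) (by omega); omega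
    · have := hr 1 j (by omega) (by omega) (by omega); omega
  · rw [Ne, hT.col_iff t0 t3]
    intro he
    rcases run_mono hp.inj (by omega) (by omega) he with hr | hr
    · have := hr 0 j le_rfl (by omega) (by omega); omega
    · have := hr 1 j (by omega) (by omega) (by omega); omega
  · rw [Ne, hT.col_iff t1 t2]
    intro he
    rcases run_mono hp.inj (by omega) (by omega) he with hr | hr
    · have h1 := hr 1 2 le_rfl (by omega) (by omega)
      have h2 := hr 2 j (by omega) (by omega) le_rfl
      have h3 := (hL0 2 le_rfl (by omega)).1 h1
      have h4 := (hRj 2 (by omega)).1 h2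
      omega
    · have := hr 1 j (by omega) (by omega) (by omega); omega
  · rw [Ne, hT.col_iff t1 t3]
    intro he
    rcases run_mono hp.inj (by omega) (by omega) he with hr | hr
    · have := hr 1 (j + 1) le_rfl (by omega) (by omega); omega
    · have := hr 1 j (by omega) (by omega) (by omega); omega
  · rw [Ne, hT.col_iff t2 t3]
    intro he
    have := run_sep le_rfl he (show 1 ≤ j + 1 by omega) (by omega) j (j + 1) le_rfl
      (by omega) (by omega) le_rfl
    omega

theorem exists_common_left (hm : 4 ≤ m) (hT : Ctx m T col) (hp : Mem m T p) (hq : Mem m T q)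
    (hL : Eqv m (L m p) (L m q)) (hR : Eqv m (R m p) (R m q)) :
    ∃ s ≤ 1, Con m (del p s) ∧ Con m (del q s) ∧ Eqv m (del p s) (del q s) ∧
      Eqv m (L m p) (del p s) ∧ (s = 1 → ¬ Con m (del p 0) ∨ ¬ Con m (del q 0)) := by
  rcases sL_cases m p with ⟨h1, -⟩ | ⟨h1, h1'⟩
  · obtain ⟨s, h⟩ := exists_common_first hm hT hp hq hL hR h1
    exact ⟨s, h.1, h.2.1, h.2.2.1, h.2.2.2.1, h.2.2.2.2.1, fun hs => Or.inr (h.2.2.2.2.2 hs)⟩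
  · rcases sL_cases m q with ⟨h2, -⟩ | ⟨h2, h2'⟩
    · obtain ⟨s, h3, h4, h5, h6, h7, h8⟩ :=
        exists_common_first hm hT hq hp hL.symm hR.symm h2
      exact ⟨s, h3, h5, h4, h6.symm, hL.trans (h7.trans h6), fun hs => Or.inl (h8 hs)⟩
    · refine ⟨1, le_rfl, con_del_one hp.inj hp.con h1', con_del_one hq.inj hq.con h2', ?_, ?_,
        fun _ => Or.inl h1'⟩
      · simpa [L, h1, h2] using hL
      · simpa [L, h1] using Eqv.refl m _

/-- Distinct members with the same left and right children have a loop pattern as a child. -/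
theorem parallel (hm : 4 ≤ m) (hT : Ctx m T col) (hp : Mem m T p) (hq : Mem m T q)
    (hne : ¬ Eqv (m + 1) p q) (hL : Eqv m (L m p) (L m q)) (hR : Eqv m (R m p) (R m q)) :
    IsLoop m (L m p) ∨ IsLoop m (R m p) := by
  obtain ⟨s, hs, cps, cqs, hes, hLs, hs0⟩ := exists_common_left hm hT hp hq hL hR
  obtain ⟨t', ht, cpt, cqt, het, hRt, ht0⟩ := exists_common_left hm hT.rc (hp.rc hT) (hq.rc hT)
    ((L_rc p).trans (hR.rc.trans (L_rc q).symm)) ((R_rc p).trans (hL.rc.trans (R_rc q).symm))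
  have ep := del_rc p (show t' ≤ m + 1 by omega)
  have eq := del_rc q (show t' ≤ m + 1 by omega)
  have ep0 := del_rc p (Nat.zero_le (m + 1))
  have eq0 := del_rc q (Nat.zero_le (m + 1))
  have cpt := con_rc_iff.1 (ep.con cpt)
  have cqt := con_rc_iff.1 (eq.con cqt)
  have het := eqv_rc_iff.1 (ep.symm.trans (het.trans eq))
  have hRt := eqv_rc_iff.1 ((L_rc p).symm.trans (hRt.trans ep))
  have ht0 : t' = 1 → ¬ Con m (del p (m + 1)) ∨ ¬ Con m (del q (m + 1)) := fun h =>
    (ht0 h).imp (fun h hc => h (ep0.symm.con hc.rc)) (fun h hc => h (eq0.symm.con hc.rc))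
  rcases swap_of_eqv hp.inj hq.inj (show s < m + 1 - t' by omega) (by omega) hes het hne with
    hsw | hsw
  · exact (swap_loop hm hT hp hq hs (by omega) (by omega) hsw
      (fun h => swap_first_not_con hsw hp.inj hq.inj (by omega) (hs0 h))
      (fun h => swap_first_not_con hsw hp.inj hq.inj (by omega) (ht0 (by omega)))
      cps cpt hes het).imp (·.eqv hLs.symm) (·.eqv hRt.symm)
  · exact (swap_loop hm hT hq hp hs (by omega) (by omega) hsw
      (fun h => swap_first_not_con hsw hq.inj hp.inj (by omega) (hs0 h).symm)
      (fun h => swap_first_not_con hsw hq.inj hp.inj (by omega) (ht0 (by omega)).symm)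
      cqs cqt hes.symm het.symm).imp (·.eqv (hes.symm.trans hLs.symm))
        (·.eqv (het.symm.trans hRt.symm))

end Pattern

/-! ### Opposite arcs with monotone core -/

namespace Pattern

variable {m : ℕ} {T : (ℕ → ℤ) → Prop} {col : (ℕ → ℤ) → Fin 3} {p q : ℕ → ℤ}

theorem exists_last_true {P : ℕ → Prop} {a b : ℕ} (ha : P a) (hb : ¬ P b) (hab : a ≤ b) :
    ∃ c, a ≤ c ∧ c < b ∧ P c ∧ ¬ P (c + 1) := by
  by_contra h
  push Not at h
  have : ∀ c, a ≤ c → c ≤ b → P c := by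
    intro c hac
    induction c, hac using Nat.le_induction with
    | base => exact fun _ => ha
    | succ c hc ih => exact fun hcb => h c hc (by omega) (ih (by omega))
  exact hb (this b hab le_rfl)

theorem not_con_of_first (hm : 1 ≤ m) (h : ∀ j, 1 ≤ j → j ≤ m → p 0 < p j) : ¬ Con m p := by
  intro hc
  obtain ⟨i, hi, j, hj, hj', hlt⟩ := hc 1 (by omega) hm
  obtain rfl : i = 0 := by omega
  have := h j hj hj'
  omega

theorem not_con_of_last (hm : 1 ≤ m) (h : ∀ j, j < m → p j < p m) : ¬ Con m p := by
  intro hc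
  obtain ⟨i, hi, j, hj, hj', hlt⟩ := hc m (by omega) le_rfl
  obtain rfl : j = m := by omega
  have := h i hi
  omega

theorem con_of_inv (h : p m < p 0) : Con m p := fun _ hk hk' => ⟨0, hk, m, hk', le_rfl, h⟩

/-- The left child moves the entries from position 2 on down by one place, while the right child
leaves those before `m` in place. Equality of the two transports comparisons by one position. -/
theorem arc_shift (h : Eqv m (L m p) (R m q)) {i j : ℕ} (hi : 1 ≤ i) (hi' : i < m) (hj : 1 ≤ j)
    (hj' : j < m) : (p (i + 1) < p (j + 1) ↔ q i < q j) := by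
  have := h i (by omega) j (by omega)
  rwa [L_pos _ hi, L_pos _ hj, R_lt _ hi', R_lt _ hj'] at this

/-- The ends of an indecomposable pattern with increasing core, in the generic case. -/
theorem inc_core (hm : 3 ≤ m) (hp : Inj (m + 1) p) (hc : Con (m + 1) p)
    (hinc : ∀ a b, 1 ≤ a → a < b → b ≤ m → p a < p b) :
    IsLoop m (L m p) ∨ IsLoop m (R m p) ∨ (sL m p = 1 ∧ tR m p = m ∧ p 1 < p (m + 1) ∧
      p (m + 1) < p m) := by
  have hy1 := hp.ne (le_refl (m + 1)) (show 1 ≤ m + 1 by omega) (by omega)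
  have hxm := hp.ne (Nat.zero_le (m + 1)) (show m ≤ m + 1 by omega) (by omega)
  have hx1 := hp.ne (Nat.zero_le (m + 1)) (show 1 ≤ m + 1 by omega) (by omega)
  by_cases hy : p (m + 1) < p 1
  · left; right; left
    rcases sL_cases m p with ⟨hs, -⟩ | ⟨hs, h0⟩
    · unfold L
      rw [hs]
      refine ⟨fun a b hab hb => ?_, fun a ha => ?_⟩
      · rw [del_ge (by omega), del_ge (by omega)]
        exact hinc _ _ (by omega) (by omega) (by omega)
      · rw [del_ge (by omega), del_ge (by omega)]
        rcases Nat.eq_zero_or_pos a with rfl | ha0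
        · rwa [Nat.zero_add]
        · have := hinc 1 (a + 1) (by omega) (by omega) (by omega)
          omega
    · obtain ⟨k, hk1, hkm, hcut, -⟩ := cut_first hp hc h0
      have := hcut 1 (m + 1) le_rfl hk1 (by omega) le_rfl
      omega
  by_cases hx : p m < p 0
  · right; left; right; right
    rcases tR_cases m p with ⟨hs, -⟩ | ⟨hs, h0⟩
    · unfold R
      rw [hs]
      refine ⟨fun a b ha hab hb => ?_, fun a ha ha' => ?_⟩
      · rw [del_lt (by omega), del_lt (by omega)]
        exact hinc _ _ (by omega) (by omega) (by omega)
      · rw [del_lt (by omega), del_lt (by omega)]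
        rcases Nat.lt_or_ge a m with ha0 | ha0
        · have := hinc a m (by omega) (by omega) (by omega)
          omega
        · obtain rfl : a = m := by omega
          exact hx
    · obtain ⟨k, hk1, hkm, hcut, -⟩ := cut_last hp hc h0
      have := hcut 0 m (by omega) hkm le_rfl
      omega
  right; right
  have h1x : p 1 < p 0 := by
    obtain ⟨i, hi, j, hj, hj', hij⟩ := hc.cross (Nat.zero_le m)
    obtain rfl : i = 0 := by omega
    rcases Nat.lt_or_ge m j with h1 | h1
    · obtain rfl : j = m + 1 := by omega
      omega
    · rcases Nat.lt_or_ge 1 j with h2 | h2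
      · have := hinc 1 j le_rfl h2 h1
        omega
      · obtain rfl : j = 1 := by omega
        exact hij
  have hyx : p (m + 1) < p 0 := by
    by_contra hcon
    obtain ⟨c, hc1, hcm, hcx, hcx'⟩ := exists_last_true (P := fun i => p i < p 0) h1x hx
      (show 1 ≤ m by omega)
    obtain ⟨i, hi, j, hj, hj', hij⟩ := hc.cross (show c ≤ m by omega)
    have hi' : p i ≤ p 0 := by
      rcases Nat.eq_zero_or_pos i with rfl | hi0
      · exact le_rfl
      · rcases Nat.lt_or_ge i c with h1 | h1
        · have := hinc i c hi0 h1 (by omega)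
          omega
        · obtain rfl : i = c := by omega
          omega
    rcases Nat.lt_or_ge m j with h1 | h1
    · obtain rfl : j = m + 1 := by omega
      omega
    · rcases Nat.lt_or_ge (c + 1) j with h2 | h2
      · have := hinc (c + 1) j (by omega) h2 h1
        omega
      · obtain rfl : j = c + 1 := by omega
        omega
  refine ⟨?_, ?_, by omega, by omega⟩
  · rcases sL_cases m p with ⟨hs, h0⟩ | ⟨hs, h0⟩
    · refine absurd h0 (not_con_of_first (by omega) fun j hj hj' => ?_)
      rw [del_ge le_rfl, del_ge (by omega), Nat.zero_add]
      rcases Nat.lt_or_ge j m with h1 | h1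
      · exact hinc _ _ (by omega) (by omega) (by omega)
      · obtain rfl : j = m := by omega
        omega
    · exact hs
  · rcases tR_cases m p with ⟨hs, h0⟩ | ⟨hs, h0⟩
    · refine absurd h0 (not_con_of_last (by omega) fun j hj => ?_)
      rw [del_lt (by omega), del_lt (by omega)]
      rcases Nat.eq_zero_or_pos j with rfl | hi0
      · omega
      · exact hinc _ _ (by omega) (by omega) (by omega)
    · exact hs

/-- The ends of an indecomposable pattern with decreasing core, in the generic case. -/
theorem dec_core (hm : 3 ≤ m) (hp : Inj (m + 1) p) (hc : Con (m + 1) p)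
    (hdec : ∀ a b, 1 ≤ a → a < b → b ≤ m → p b < p a) :
    IsLoop m (L m p) ∨ IsLoop m (R m p) ∨ (sL m p = 0 ∧ tR m p = m + 1) := by
  have hy1 := hp.ne (le_refl (m + 1)) (show 1 ≤ m + 1 by omega) (by omega)
  have hxm := hp.ne (Nat.zero_le (m + 1)) (show m ≤ m + 1 by omega) (by omega)
  by_cases hy : p 1 < p (m + 1)
  · right; left; left
    obtain ⟨i, hi, j, hj, hj', hij⟩ := hc.cross (le_refl m)
    obtain rfl : j = m + 1 := by omega
    have hi0 : i = 0 := by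
      by_contra hne
      rcases Nat.lt_or_ge 1 i with h2 | h2
      · have := hdec 1 i le_rfl h2 hi
        omega
      · obtain rfl : i = 1 := by omega
        omega
    subst hi0
    have hd : IsD m (del p (m + 1)) := by
      intro a b hab hb
      rw [del_lt (by omega), del_lt (by omega)]
      rcases Nat.eq_zero_or_pos a with rfl | ha
      · rcases Nat.lt_or_ge 1 b with h2 | h2
        · have := hdec 1 b le_rfl h2 hb
          omega
        · obtain rfl : b = 1 := by omega
          omega
      · exact hdec _ _ ha hab hb
    have hcon := con_of_inv (hd 0 m (by omega) le_rfl)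
    unfold R tR
    rwa [if_pos hcon]
  by_cases hx : p 0 < p m
  · left; left
    obtain ⟨i, hi, j, hj, hj', hij⟩ := hc.cross (Nat.zero_le m)
    obtain rfl : i = 0 := by omega
    have hj0 : j = m + 1 := by
      by_contra hne
      rcases Nat.lt_or_ge j m with h2 | h2
      · have := hdec j m hj h2 le_rfl
        omega
      · obtain rfl : j = m := by omega
        omega
    subst hj0
    have hd : IsD m (del p 0) := by
      intro a b hab hb
      rw [del_ge (by omega), del_ge (by omega)]
      rcases Nat.lt_or_ge b m with ha | ha
      · exact hdec _ _ (by omega) (by omega) (by omega)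
      · obtain rfl : b = m := by omega
        rcases Nat.lt_or_ge (a + 1) b with h2 | h2
        · have := hdec (a + 1) b (by omega) h2 hb
          omega
        · obtain rfl : b = a + 1 := by omega
          omega
    have hcon := con_of_inv (hd 0 m (by omega) le_rfl)
    unfold L sL
    rwa [if_pos hcon]
  right; right
  constructor
  · rcases sL_cases m p with ⟨hs, -⟩ | ⟨-, h0⟩
    · exact hs
    · refine absurd (con_of_inv ?_) h0
      rw [del_ge (by omega), del_ge (by omega), Nat.zero_add]
      omega
  · rcases tR_cases m p with ⟨hs, -⟩ | ⟨-, h0⟩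
    · exact hs
    · refine absurd (con_of_inv ?_) h0
      rw [del_lt (by omega), del_lt (by omega)]
      omega

/-- Members with opposite pairs of left and right children and a monotone triple at the left end
of the core have a loop pattern as a child. -/
theorem antiparallel (hm : 3 ≤ m) (hp : Inj (m + 1) p) (hq : Inj (m + 1) q)
    (hpc : Con (m + 1) p) (hqc : Con (m + 1) q) (hLR : Eqv m (L m p) (R m q))
    (hRL : Eqv m (L m q) (R m p)) (h12 : p 1 < p 2 ↔ p 2 < p 3) :
    IsLoop m (L m p) ∨ IsLoop m (R m p) := by
  -- Passing back and forth between `p` and `q` moves a comparison by two places, and `h12` joins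
  -- the two residue classes: all inner steps of both patterns have the same direction.
  have hstep : ∀ i, 1 ≤ i → i < m → (p i < p (i + 1) ↔ p 1 < p 2) ∧ (q i < q (i + 1) ↔ p 1 < p 2) := by
    intro i hi
    induction i, hi using Nat.le_induction with
    | base =>
      intro _
      have := arc_shift hLR (i := 1) (j := 2) le_rfl (by omega) (by omega) (by omega)
      exact ⟨Iff.rfl, this.symm.trans h12.symm⟩
    | succ i hi ih =>
      intro him
      obtain ⟨h1, h2⟩ := ih (by omega)
      exact ⟨(arc_shift hLR hi (by omega) (by omega) him).trans h2,
        (arc_shift hRL hi (by omega) (by omega) him).trans h1⟩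
  by_cases hd : p 1 < p 2
  · have hpi := mono_of_step (p := p) (i := 1) (j := m) fun a ha ham => (hstep a ha ham).1.2 hd
    have hqi := mono_of_step (p := q) (i := 1) (j := m) fun a ha ham => (hstep a ha ham).2.2 hd
    rcases inc_core hm hp hpc hpi with h | h | ⟨hps, hpt, hp1, hpm⟩
    · exact Or.inl h
    · exact Or.inr h
    rcases inc_core hm hq hqc hqi with h | h | ⟨hqs, hqt, hq1, hqm⟩
    · exact Or.inr (h.eqv hRL)
    · exact Or.inl (h.eqv hLR.symm)
    exfalso
    have e1 : ∀ p : ℕ → ℤ, tR m p = m → R m p m = p (m + 1) := fun p h => by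
      rcases R_last m p with h' | h'
      · omega
      · exact h'.2
    -- Both right children end with the last entry. Comparing it with one core entry after another,
    -- alternately in `p` and `q`, shows that it lies above the whole core, contrary to `hpm`.
    have key : ∀ i, 1 ≤ i → i ≤ m → p i < p (m + 1) ∧ q i < q (m + 1) := by
      intro i hi
      induction i, hi using Nat.le_induction with
      | base => exact fun _ => ⟨hp1, hq1⟩
      | succ i hi ih =>
        intro him
        obtain ⟨h1, h2⟩ := ih (by omega)
        have h3 := hLR i (by omega) m le_rfl
        have h4 := hRL i (by omega) m le_rfl
        rw [L_pos _ hi, L_pos _ (by omega), R_lt q (by omega : i < m), e1 q hqt] at h3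
        rw [L_pos _ hi, L_pos _ (by omega), R_lt p (by omega : i < m), e1 p hpt] at h4
        exact ⟨h3.2 h2, h4.2 h1⟩
    have := (key m (by omega) le_rfl).1
    omega
  · have hpi := anti_of_step (p := p) (i := 1) (j := m) fun a ha ham => by
      have := (hstep a ha ham).1
      have := hp.ne (show a ≤ m + 1 by omega) (show a + 1 ≤ m + 1 by omega) (by omega)
      omega
    have hqi := anti_of_step (p := q) (i := 1) (j := m) fun a ha ham => by
      have := (hstep a ha ham).2
      have := hq.ne (show a ≤ m + 1 by omega) (show a + 1 ≤ m + 1 by omega) (by omega)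
      omega
    rcases dec_core hm hp hpc hpi with h | h | ⟨hps, hpt⟩
    · exact Or.inl h
    · exact Or.inr h
    rcases dec_core hm hq hqc hqi with h | h | ⟨hqs, hqt⟩
    · exact Or.inr (h.eqv hRL)
    · exact Or.inl (h.eqv hLR.symm)
    left
    refine IsLoop.eqv (Or.inl ?_) hLR.symm
    unfold R
    rw [hqt]
    have h01 := hLR 1 (by omega) 0 (by omega)
    rw [L_pos _ le_rfl, R_lt q (by omega : 1 < m), R_lt q (by omega : 0 < m)] at h01
    have hL0 : L m p 0 = p 1 := by
      rcases L_zero m p with h | h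
      · exact h.2
      · omega
    rw [hL0] at h01
    have h12' := hpi 1 2 le_rfl (by omega) (by omega)
    have h10 := h01.1 h12'
    intro a b hab hb
    rw [del_lt (by omega), del_lt (by omega)]
    rcases Nat.eq_zero_or_pos a with rfl | ha
    · rcases Nat.lt_or_ge 1 b with h2 | h2
      · have := hqi 1 b le_rfl h2 hb
        omega
      · obtain rfl : b = 1 := by omega
        omega
    · exact hqi _ _ ha hab hb

end Pattern

/-! ### Triangles and double opposite pairs in the absence of loop patterns -/

namespace Pattern

variable {m : ℕ} {T : (ℕ → ℤ) → Prop} {col : (ℕ → ℤ) → Fin 3} {p q p' q' : ℕ → ℤ}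

/-- Loop patterns have loop children. Hence without loop children there are no loop arcs, which is
`Mem.not_eqv`. -/
theorem IsLoop.L (hm : 2 ≤ m) (h : IsLoop (m + 1) p) :
    IsLoop m (L m p) := by
  unfold Pattern.L
  have hs := sL_le m p
  rcases h with h | h | h
  · left
    intro a b hab hb
    unfold del
    split_ifs <;> exact h _ _ (by omega) (by omega)
  · right; left
    refine ⟨fun a b hab hb => ?_, fun a ha => ?_⟩
    · unfold del
      split_ifs <;> exact h.1 _ _ (by omega) (by omega)
    · rw [del_ge (by omega)]
      unfold del
      split_ifs <;> exact h.2 _ (by omega)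
  · right; right
    have hs1 : sL m p = 1 := by
      rcases sL_cases m p with ⟨-, h'⟩ | ⟨h', -⟩
      · refine absurd h' (not_con_of_first (by omega) fun j hj hj' => ?_)
        rw [del_ge (by omega), del_ge (by omega)]
        exact h.1 _ _ (by omega) (by omega) (by omega)
      · exact h'
    rw [hs1]
    refine ⟨fun a b ha hab hb => ?_, fun a ha ha' => ?_⟩
    · rw [del_ge (by omega), del_ge (by omega)]
      exact h.1 _ _ (by omega) (by omega) (by omega)
    · rw [del_ge (by omega), del_lt (by omega)]
      exact h.2 _ (by omega) (by omega)

theorem Mem.not_eqv (hm : 2 ≤ m) (hp : Mem m T p) (h : ¬ IsLoop m (L m p)) :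
    ¬ Eqv m (L m p) (R m p) :=
  fun he => h ((loop_of_L_R (by omega) hp.inj hp.con he).L hm)

theorem left_agree (h : Eqv m (L m p) (L m q)) {i j : ℕ} (hi : 2 ≤ i) (hi' : i ≤ m + 1)
    (hj : 2 ≤ j) (hj' : j ≤ m + 1) : (p i < p j ↔ q i < q j) := by
  have := h (i - 1) (by omega) (j - 1) (by omega)
  rwa [L_pos _ (by omega), L_pos _ (by omega), L_pos _ (by omega), L_pos _ (by omega),
    Nat.sub_add_cancel (by omega), Nat.sub_add_cancel (by omega)] at this

theorem right_agree (h : Eqv m (R m p) (R m q)) {i j : ℕ} (hi : i < m) (hj : j < m) :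
    (p i < p j ↔ q i < q j) := by
  have := h i (by omega) j (by omega)
  rwa [R_lt p hi, R_lt p hj, R_lt q hi, R_lt q hj] at this

/-- A triangle of arcs over an antiparallel pair forces a monotone triple. -/
theorem triangle (hm : 6 ≤ m) {r s : ℕ → ℤ} (hLR : Eqv m (L m p) (R m q))
    (hRL : Eqv m (L m q) (R m p))
    (h : (Eqv m (L m r) (L m p) ∧ Eqv m (L m s) (R m r) ∧ Eqv m (R m s) (R m p)) ∨
      (Eqv m (L m r) (L m p) ∧ Eqv m (R m r) (R m s) ∧ Eqv m (L m s) (L m q)) ∨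
      (Eqv m (R m r) (R m q) ∧ Eqv m (L m r) (L m s) ∧ Eqv m (R m s) (R m p)) ∨
      (Eqv m (R m r) (R m q) ∧ Eqv m (L m r) (R m s) ∧ Eqv m (L m s) (L m q))) :
    p 1 < p 2 ↔ p 2 < p 3 := by
  -- The three edges of a triangle give an odd total shift, while the opposite pair gives period
  -- two. Combined, neighbouring steps must agree.
  have a1 := arc_shift hLR (i := 1) (j := 2) (by omega) (by omega) (by omega) (by omega)
  have a2 := arc_shift hLR (i := 2) (j := 3) (by omega) (by omega) (by omega) (by omega)
  have b1 := arc_shift hRL (i := 1) (j := 2) (by omega) (by omega) (by omega) (by omega)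
  have b2 := arc_shift hRL (i := 2) (j := 3) (by omega) (by omega) (by omega) (by omega)
  norm_num at a1 a2 b1 b2
  rcases h with ⟨h1, h2, h3⟩ | ⟨h1, h2, h3⟩ | ⟨h1, h2, h3⟩ | ⟨h1, h2, h3⟩
  · have c1 := left_agree h1 (i := 2) (j := 3) (by omega) (by omega) (by omega) (by omega)
    have c2 := arc_shift h2 (i := 2) (j := 3) (by omega) (by omega) (by omega) (by omega)
    have c3 := right_agree h3 (i := 3) (j := 4) (by omega) (by omega)
    norm_num at c2
    exact (b1.symm.trans a2.symm).trans (c1.symm.trans (c2.symm.trans c3)).symm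
  · have c1 := left_agree h1 (i := 2) (j := 3) (by omega) (by omega) (by omega) (by omega)
    have c2 := right_agree h2 (i := 2) (j := 3) (by omega) (by omega)
    have c3 := left_agree h3 (i := 2) (j := 3) (by omega) (by omega) (by omega) (by omega)
    tauto
  · have c1 := right_agree h1 (i := 2) (j := 3) (by omega) (by omega)
    have c2 := left_agree h2 (i := 2) (j := 3) (by omega) (by omega) (by omega) (by omega)
    have c3 := right_agree h3 (i := 2) (j := 3) (by omega) (by omega)
    tauto
  · have c1 := right_agree h1 (i := 3) (j := 4) (by omega) (by omega)
    have c2 := arc_shift h2 (i := 2) (j := 3) (by omega) (by omega) (by omega) (by omega)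
    have c3 := left_agree h3 (i := 2) (j := 3) (by omega) (by omega) (by omega) (by omega)
    norm_num at c2
    tauto

/-- The descents of an antiparallel pair alternate unless the first ones agree. -/
theorem alternating (hLR : Eqv m (L m p) (R m q)) (hRL : Eqv m (L m q) (R m p))
    (hp : ¬ (p 1 < p 2 ↔ p 2 < p 3)) (hq : ¬ (q 1 < q 2 ↔ q 2 < q 3)) :
    ∀ i, 1 ≤ i → i + 1 < m → ¬ (p i < p (i + 1) ↔ p (i + 1) < p (i + 2)) ∧
      ¬ (q i < q (i + 1) ↔ q (i + 1) < q (i + 2)) := by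
  intro i hi
  induction i, hi using Nat.le_induction with
  | base => exact fun _ => ⟨hp, hq⟩
  | succ i hi ih =>
    intro him
    obtain ⟨h1, h2⟩ := ih (by omega)
    have a1 := arc_shift hLR (i := i) (j := i + 1) (by omega) (by omega) (by omega) (by omega)
    have a2 := arc_shift hLR (i := i + 1) (j := i + 2) (by omega) (by omega) (by omega) (by omega)
    have b1 := arc_shift hRL (i := i) (j := i + 1) (by omega) (by omega) (by omega) (by omega)
    have b2 := arc_shift hRL (i := i + 1) (j := i + 2) (by omega) (by omega) (by omega) (by omega)
    exact ⟨fun h => h2 (a1.symm.trans (h.trans a2)), fun h => h1 (b1.symm.trans (h.trans b2))⟩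

/-- If `r` is a cut entry and `p` does not have an extremum at `r` among `r - 2`, `r`, `r + 2`,
then the entries up to `r - 2` lie below the entries from `r + 2` on. -/
theorem below_of_cut (hp : Inj (m + 1) p) (hc : Con (m + 1) p) {r : ℕ} (hr : 2 ≤ r)
    (hrm : r + 2 ≤ m + 1) (hcut : ¬ Con m (del p r)) (hsh : p (r - 2) < p r ↔ p r < p (r + 2))
    {i j : ℕ} (hi : i + 2 ≤ r) (hj : r + 2 ≤ j) (hjm : j ≤ m + 1) : p i < p j := by
  obtain ⟨K, hK, -, -, h⟩ := cut_of_not_con hp (by omega) hcut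
  obtain ⟨a, ha, b, hb, hb', hab⟩ := hc.cross hK
  have hne1 := hp.ne (show r ≤ m + 1 by omega) (show r - 2 ≤ m + 1 by omega) (by omega)
  have hne2 := hp.ne (show r ≤ m + 1 by omega) (show r + 2 ≤ m + 1 by omega) (by omega)
  have har : a = r ∨ b = r := by
    by_contra hne
    have := h a b ha (by omega) hb hb' (by omega)
    omega
  have h1 : r ≤ K + 2 := by
    by_contra hcon
    obtain rfl : b = r := by omega
    have := h a (b - 2) ha (by omega) (by omega) (by omega) (by omega)
    have := h a (b + 2) ha (by omega) (by omega) (by omega) (by omega)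
    omega
  have h2 : K < r + 2 := by
    by_contra hcon
    obtain rfl : a = r := by omega
    have := h (a - 2) b (by omega) (by omega) hb hb' (by omega)
    have := h (a + 2) b (by omega) (by omega) hb hb' (by omega)
    omega
  exact h i j (by omega) (by omega) (by omega) hjm (by omega)

/-- Two patterns that agree away from the first entry have the same kind of last entry, provided
that inner entries are cut entries. -/
theorem con_last_of_agree (hm : 6 ≤ m) (hp : Inj (m + 1) p) (hc : Con (m + 1) p)
    (hcut : ∀ r, 3 ≤ r → r + 2 ≤ m → ¬ Con m (del p r))
    (hbp : ∀ i j, i ≤ 2 → m ≤ j → j ≤ m + 1 → p i < p j)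
    (hbq : ∀ i j, i ≤ 1 → m ≤ j + 1 → j ≤ m + 1 → q i < q j)
    (hag : ∀ i j, 1 ≤ i → i < j → j ≤ m + 1 → (p j < p i ↔ q j < q i))
    (hq : Con m (del q (m + 1))) : Con m (del p (m + 1)) := by
  by_contra hcon
  obtain ⟨k, hk1, hkm, h1, h2, i, hi, h3⟩ := cut_last hp hc hcon
  have hi3 : 3 ≤ i := by
    by_contra hlt
    have := hbp i (m + 1) (by omega) (by omega) le_rfl
    omega
  have hk : k + 2 ≤ m := by
    obtain ⟨a, ha, -, b, hb, hb', hbm, hab⟩ := hq.of_del le_rfl (show k - 1 ≤ m by omega) (by omega)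
      (by omega)
    rcases Nat.eq_zero_or_pos a with rfl | ha0
    · by_contra hlt
      have := hbq 0 b (by omega) (by omega) hb'
      omega
    · have := h1 a b (by omega) (by omega) (by omega)
      have := (hag a b ha0 (by omega) hb').2 hab
      omega
  refine hcut k (by omega) hk (con_del_of (by omega) fun g hg _ _ => ?_)
  rcases Nat.lt_or_ge g i with hgi | hgi
  · obtain ⟨a, ha, b, hb, hb', hab⟩ := hc.cross hg
    refine ⟨a, ha, by omega, b, hb, hb', ?_, hab⟩
    rintro rfl
    have := h1 a b (by omega) le_rfl hkm
    omega
  · exact ⟨i, hgi, by omega, m + 1, by omega, le_rfl, by omega, h3⟩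

theorem Ctx.eqv_of_three (hT : Ctx m T col) {x y z w : ℕ → ℤ} (hx : T x) (hy : T y) (hz : T z)
    (hw : T w) (hxy : ¬ Eqv m x y) (hxz : ¬ Eqv m x z) (hyz : ¬ Eqv m y z) :
    Eqv m w x ∨ Eqv m w y ∨ Eqv m w z := by
  by_contra h
  push Not at h
  obtain ⟨h1, h2, h3⟩ := h
  rw [← hT.col_iff (by assumption) (by assumption)] at hxy hxz hyz h1 h2 h3
  exact fin_three_four _ _ _ _ hxy hxz (Ne.symm h1) hyz (Ne.symm h2) (Ne.symm h3)

/-- There are no two antiparallel pairs sharing a class in the absence of loop patterns. -/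
theorem double_antiparallel (hm : 6 ≤ m) (hT : Ctx m T col) (hloop : ∀ x, T x → ¬ IsLoop m x)
    (hp : Mem m T p) (hq : Mem m T q) (hp' : Mem m T p') (hq' : Mem m T q')
    (ha : Eqv m (L m p) (R m q)) (hb : Eqv m (L m q) (R m p)) (hb2 : Eqv m (L m q) (L m p'))
    (hb3 : Eqv m (L m p') (R m q')) (hc : Eqv m (L m q') (R m p'))
    (hne : ¬ Eqv m (L m p) (L m q')) : False := by
  have hab := hp.not_eqv (by omega) (hloop _ hp.T_L)
  have hbc := hp'.not_eqv (by omega) (hloop _ hp'.T_L)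
  have nm : ∀ {p q : ℕ → ℤ}, Mem m T p → Mem m T q → Eqv m (L m p) (R m q) →
      Eqv m (L m q) (R m p) → ¬ (p 1 < p 2 ↔ p 2 < p 3) := fun hp hq h1 h2 h => by
    rcases antiparallel (by omega) hp.inj hq.inj hp.con hq.con h1 h2 h with h | h
    · exact hloop _ hp.T_L h
    · exact hloop _ hp.T_R h
  have alt := alternating ha hb (nm hp hq ha hb) (nm hq hp hb ha)
  have alt' := alternating hb3 hc (nm hp' hq' hb3 hc) (nm hq' hp' hc hb3)
  -- every child is one of three
  have hcl : ∀ {x : ℕ → ℤ}, Mem m T x → ∀ r ≤ m + 1, Con m (del x r) →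
      Eqv m (del x r) (L m p) ∨ Eqv m (del x r) (L m q) ∨ Eqv m (del x r) (L m q') := by
    intro x hx r hr hcx
    apply hT.eqv_of_three hp.T_L hq.T_L hq'.T_L (hx.child r hr hcx)
    · exact fun h => hab (h.trans hb)
    · exact hne
    · exact fun h => hbc (hb2.symm.trans (h.trans hc))
  -- An inner deletion keeps the first steps in place, like a right child, and moves the last steps
  -- by one, like a left child. In alternating patterns it therefore disagrees with a left child at
  -- the beginning, or with a right child at the end.
  have bitsL : ∀ {x y : ℕ → ℤ} {r : ℕ}, 3 ≤ r → r + 2 ≤ m → Eqv m (del x r) (L m y) →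
      (x 1 < x 2 ↔ y 2 < y 3) ∧ (x (m - 1) < x m ↔ y (m - 1) < y m) := by
    intro x y r hr hrm he
    have h1 := he 1 (by omega) 2 (by omega)
    have h2 := he (m - 2) (by omega) (m - 1) (by omega)
    rw [del_lt (by omega), del_lt (by omega), L_pos _ (by omega), L_pos _ (by omega)] at h1
    rw [del_ge (by omega), del_ge (by omega), L_pos _ (by omega), L_pos _ (by omega),
      show m - 2 + 1 = m - 1 by omega, show m - 1 + 1 = m by omega] at h2
    exact ⟨h1, h2⟩
  have bitsR : ∀ {x y : ℕ → ℤ} {r : ℕ}, 3 ≤ r → r + 2 ≤ m → Eqv m (del x r) (R m y) →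
      (x 1 < x 2 ↔ y 1 < y 2) ∧ (x (m - 1) < x m ↔ y (m - 2) < y (m - 1)) := by
    intro x y r hr hrm he
    have h1 := he 1 (by omega) 2 (by omega)
    have h2 := he (m - 2) (by omega) (m - 1) (by omega)
    rw [del_lt (by omega), del_lt (by omega), R_lt _ (by omega), R_lt _ (by omega)] at h1
    rw [del_ge (by omega), del_ge (by omega), R_lt y (by omega : m - 2 < m),
      R_lt y (by omega : m - 1 < m), show m - 2 + 1 = m - 1 by omega,
      show m - 1 + 1 = m by omega] at h2
    exact ⟨h1, h2⟩
  have alt1 := alt 1 le_rfl (by omega)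
  have alt1' := alt' 1 le_rfl (by omega)
  have altm := alt (m - 2) (by omega) (by omega)
  have altm' := alt' (m - 2) (by omega) (by omega)
  rw [show m - 2 + 1 = m - 1 by omega, show m - 2 + 2 = m by omega] at altm altm'
  norm_num at alt1 alt1'
  have lq1 := left_agree hb2 (i := 2) (j := 3) le_rfl (by omega) (by omega) (by omega)
  have lqm := left_agree hb2 (i := m - 1) (j := m) (by omega) (by omega) (by omega) (by omega)
  have lqm' := left_agree hb2 (i := m - 2) (j := m - 1) (by omega) (by omega) (by omega) (by omega)
  have sh1 := arc_shift ha (i := 1) (j := 2) le_rfl (by omega) (by omega) (by omega)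
  have sh2 := arc_shift hb (i := 1) (j := 2) le_rfl (by omega) (by omega) (by omega)
  have hRR : Eqv m (R m p) (R m q') := hb.symm.trans (hb2.trans hb3)
  have rp1 := right_agree hRR (i := 1) (j := 2) (by omega) (by omega)
  have rp2 := right_agree hRR (i := 2) (j := 3) (by omega) (by omega)
  norm_num at sh1 sh2
  -- For each of the four members, all three possible classes of an inner deletion contradict the
  -- alternation at one end or the other. So the inner entries are cut entries.
  have cutp : ∀ r, 3 ≤ r → r + 2 ≤ m → ¬ Con m (del p r) := by
    intro r hr hrm hcon
    rcases hcl hp r (by omega) hcon with h | h | h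
    · exact alt1.1 (bitsL hr hrm h).1
    · exact altm.1 (bitsR hr hrm (h.trans hb)).2.symm
    · exact alt1'.1 ((bitsR hr hrm (h.trans hc)).1.symm.trans (sh2.symm.trans lq1))
  have cutq : ∀ r, 3 ≤ r → r + 2 ≤ m → ¬ Con m (del q r) := by
    intro r hr hrm hcon
    rcases hcl hq r (by omega) hcon with h | h | h
    · exact altm.2 (bitsR hr hrm (h.trans ha)).2.symm
    · exact alt1.2 (bitsL hr hrm h).1
    · exact altm.2 (lqm'.trans (bitsR hr hrm (h.trans hc)).2.symm)
  have cutp' : ∀ r, 3 ≤ r → r + 2 ≤ m → ¬ Con m (del p' r) := by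
    intro r hr hrm hcon
    rcases hcl hp' r (by omega) hcon with h | h | h
    · exact altm'.1 (lqm'.symm.trans (bitsR hr hrm (h.trans ha)).2.symm)
    · exact alt1'.1 (bitsL hr hrm (h.trans hb2)).1
    · exact altm'.1 (bitsR hr hrm (h.trans hc)).2.symm
  have cutq' : ∀ r, 3 ≤ r → r + 2 ≤ m → ¬ Con m (del q' r) := by
    intro r hr hrm hcon
    rcases hcl hq' r (by omega) hcon with h | h | h
    · exact alt1'.2 ((bitsL hr hrm h).1.trans rp2)
    · exact altm'.2 (bitsR hr hrm (h.trans (hb2.trans hb3))).2.symm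
    · exact alt1'.2 (bitsL hr hrm h).1
  -- Going through both arcs moves the pair `r - 2`, `r` to `r`, `r + 2`. This is the hypothesis
  -- under which `below_of_cut` applies; in particular the entries near the left end lie below those
  -- near the right end.
  have shift : ∀ {p q : ℕ → ℤ}, Eqv m (L m p) (R m q) → Eqv m (L m q) (R m p) → ∀ r, 3 ≤ r →
      r + 2 ≤ m → (p (r - 2) < p r ↔ p r < p (r + 2)) := by
    intro p q h1 h2 r hr hrm
    have e1 := arc_shift h1 (i := r - 1) (j := r + 1) (by omega) (by omega) (by omega) (by omega)
    have e2 := arc_shift h2 (i := r - 2) (j := r) (by omega) (by omega) (by omega) (by omega)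
    rw [show r - 1 + 1 = r by omega] at e1
    rw [show r - 2 + 1 = r - 1 by omega] at e2
    exact (e1.trans e2).symm
  have below : ∀ {p q : ℕ → ℤ}, Mem m T p → Eqv m (L m p) (R m q) → Eqv m (L m q) (R m p) →
      (∀ r, 3 ≤ r → r + 2 ≤ m → ¬ Con m (del p r)) → 
      (∀ i j, i ≤ 2 → m ≤ j → j ≤ m + 1 → p i < p j) ∧
      (∀ i j, i ≤ 1 → m ≤ j + 1 → j ≤ m + 1 → p i < p j) := by
    intro p q hp h1 h2 h3
    refine ⟨fun i j hi hj hj' => ?_, fun i j hi hj hj' => ?_⟩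
    · exact below_of_cut hp.inj hp.con (r := 4) (by omega) (by omega) (h3 4 (by omega) (by omega))
        (shift h1 h2 4 (by omega) (by omega)) (by omega) (by omega) hj'
    · exact below_of_cut hp.inj hp.con (r := 3) (by omega) (by omega) (h3 3 (by omega) (by omega))
        (shift h1 h2 3 (by omega) (by omega)) (by omega) (by omega) hj'
  obtain ⟨bp, bp2⟩ := below hp ha hb cutp
  obtain ⟨bq, bq2⟩ := below hq hb ha cutq
  obtain ⟨bp', bp2'⟩ := below hp' hb3 hc cutp'
  obtain ⟨bq', bq2'⟩ := below hq' hc hb3 cutq'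
  -- Comparisons of `p` and `q'` are transported through the arcs to the common child of `q` and
  -- `p'`. Pairs too far apart for this are ordered by `below`.
  have agpq : ∀ i j, i < j → j ≤ m → (p i < p j ↔ q' i < q' j) := by
    intro i j hij hj
    rcases Nat.lt_or_ge j m with h1 | h1
    · exact right_agree hRR (by omega) h1
    · rcases Nat.lt_or_ge i 3 with h2 | h2
      · have := bp i j (by omega) h1 (by omega)
        have := bq' i j (by omega) h1 (by omega)
        omega
      · have e1 := arc_shift ha (i := i - 1) (j := j - 1) (by omega) (by omega) (by omega) (by omega)
        have e2 := left_agree hb2 (i := i - 1) (j := j - 1) (by omega) (by omega) (by omega)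
          (by omega)
        have e3 := arc_shift hc (i := i - 1) (j := j - 1) (by omega) (by omega) (by omega) (by omega)
        rw [Nat.sub_add_cancel (by omega), Nat.sub_add_cancel (by omega)] at e1 e3
        exact e1.trans (e2.trans e3.symm)
  have agqp : ∀ i j, 1 ≤ i → i < j → j ≤ m + 1 → (q i < q j ↔ p' i < p' j) := by
    intro i j hi hij hj
    rcases Nat.lt_or_ge i 2 with h1 | h1
    · rcases Nat.lt_or_ge (j + 1) m with h2 | h2
      · have e1 := arc_shift ha (i := i) (j := j) (by omega) (by omega) (by omega) (by omega)
        have e2 := right_agree hRR (i := i + 1) (j := j + 1) (by omega) (by omega)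
        have e3 := arc_shift hc (i := i) (j := j) (by omega) (by omega) (by omega) (by omega)
        exact e1.symm.trans (e2.trans e3)
      · have := bq2 i j (by omega) h2 hj
        have := bp2' i j (by omega) h2 hj
        omega
    · exact left_agree hb2 h1 (by omega) (by omega) hj
  have agqp' : ∀ i j, 1 ≤ i → i < j → j ≤ m + 1 → (q j < q i ↔ p' j < p' i) := by
    intro i j hi hij hj
    have h1 := agqp i j hi hij hj
    have h2 := hq.inj.ne hj (show i ≤ m + 1 by omega) (by omega)
    have h3 := hp'.inj.ne hj (show i ≤ m + 1 by omega) (by omega)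
    omega
  -- The right children of `q` and `p'` must be formed by deleting at the same place before their
  -- last entries can be compared.
  have hlast : Con m (del q (m + 1)) ↔ Con m (del p' (m + 1)) :=
    ⟨con_last_of_agree hm hp'.inj hp'.con cutp' bp' bq2 fun i j h1 h2 h3 => (agqp' i j h1 h2 h3).symm,
      con_last_of_agree hm hq.inj hq.con cutq bq bp2' agqp'⟩
  have hRm : ∀ i, 1 ≤ i → i < m → (q i < R m q m ↔ p' i < R m p' m) := by
    intro i hi him
    rcases R_last m q with ⟨h1, h2⟩ | ⟨h1, h2⟩ <;> rcases R_last m p' with ⟨h3, h4⟩ | ⟨h3, h4⟩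
    · rw [h2, h4]; exact agqp i m hi him (by omega)
    · rcases tR_cases m q with ⟨-, h5⟩ | ⟨h5, -⟩ <;> rcases tR_cases m p' with ⟨h6, -⟩ | ⟨-, h6⟩ <;>
        first | omega | exact absurd (hlast.1 h5) h6
    · rcases tR_cases m q with ⟨h5, -⟩ | ⟨-, h5⟩ <;> rcases tR_cases m p' with ⟨-, h6⟩ | ⟨h6, -⟩ <;>
        first | omega | exact absurd (hlast.2 h6) h5
    · rw [h2, h4]; exact agqp i (m + 1) hi (by omega) le_rfl
  have hpq : Eqv (m + 1) p q' := by
    apply Eqv.of_lt hp.inj hq'.inj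
    intro i j hij hj
    rcases Nat.lt_or_ge m j with h1 | h1
    · obtain rfl : j = m + 1 := by omega
      rcases Nat.lt_or_ge i 2 with h2 | h2
      · have := bp i (m + 1) (by omega) (by omega) (by omega)
        have := bq' i (m + 1) (by omega) (by omega) (by omega)
        omega
      · have e1 := ha (i - 1) (by omega) m le_rfl
        have e2 := hc (i - 1) (by omega) m le_rfl
        rw [L_pos _ (by omega), L_pos _ (by omega), R_lt _ (by omega),
          Nat.sub_add_cancel (by omega)] at e1 e2
        exact e1.trans ((hRm _ (by omega) (by omega)).trans e2.symm)
    · exact agpq i j hij h1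
  -- Equivalent patterns have equivalent left children, whereas `p` and `q'` start at different
  -- vertices.
  apply hne
  have hs : sL m p = sL m q' := by
    have h0 := eqv_del hpq 0
    unfold sL
    split_ifs with h1 h2 h2
    · rfl
    · exact absurd (h0.con h1) h2
    · exact absurd (h0.symm.con h2) h1
    · rfl
  unfold L
  rw [hs]
  exact eqv_del hpq _

end Pattern

/-! ### Four arcs on three vertices without loop patterns -/

namespace Pattern

variable {m : ℕ} {T : (ℕ → ℤ) → Prop} {col : (ℕ → ℤ) → Fin 3} {p q r s : ℕ → ℤ}

set_option synthInstance.maxSize 2000 in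
set_option synthInstance.maxHeartbeats 200000 in
/-- Among four distinct arcs on three points, two are opposite. -/
theorem exists_opposite : ∀ a b : Fin 3, a ≠ b → ∀ c d : Fin 3, c ≠ d → ¬ (a = c ∧ b = d) →
    ∀ e f : Fin 3, e ≠ f → ¬ (a = e ∧ b = f) → ¬ (c = e ∧ d = f) →
    ∀ g h : Fin 3, g ≠ h → ¬ (a = g ∧ b = h) → ¬ (c = g ∧ d = h) → ¬ (e = g ∧ f = h) →
    (a = d ∧ c = b) ∨ (a = f ∧ e = b) ∨ (a = h ∧ g = b) ∨ (c = f ∧ e = d) ∨ (c = h ∧ g = d) ∨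
      (e = h ∧ g = f) := by
  decide

set_option synthInstance.maxSize 2000 in
set_option synthInstance.maxHeartbeats 200000 in
/-- The position of two further arcs relative to a pair of opposite arcs on three points. -/
theorem opposite_cases : ∀ a b : Fin 3, a ≠ b → 
    ∀ e f : Fin 3, e ≠ f → ¬ (a = e ∧ b = f) → ¬ (b = e ∧ a = f) →
    ∀ g h : Fin 3, g ≠ h → ¬ (a = g ∧ b = h) → ¬ (b = g ∧ a = h) → ¬ (e = g ∧ f = h) →
    ((e = a ∧ g = f ∧ h = b) ∨ (e = a ∧ f = h ∧ g = b) ∨ (f = a ∧ e = g ∧ h = b) ∨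
      (f = a ∧ e = h ∧ g = b)) ∨
    ((g = a ∧ e = h ∧ f = b) ∨ (g = a ∧ h = f ∧ e = b) ∨ (h = a ∧ g = e ∧ f = b) ∨
      (h = a ∧ g = f ∧ e = b)) ∨
    ((b = e ∧ e = h ∧ g = f ∧ a ≠ g) ∨ (b = g ∧ g = f ∧ e = h ∧ a ≠ e)) ∨
    ((a = e ∧ e = h ∧ g = f ∧ b ≠ g) ∨ (a = g ∧ g = f ∧ e = h ∧ b ≠ e)) := by
  decide

/-- The two arcs besides an opposite pair on three vertices either complete a triangle with it or
form a second opposite pair through one of its ends. These are the configurations refuted by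
`triangle` and `double_antiparallel`. -/
theorem no_loop_opposite (hm : 6 ≤ m) (hT : Ctx m T col) (hloop : ∀ x, T x → ¬ IsLoop m x)
    (hp : Mem m T p) (hq : Mem m T q) (hr : Mem m T r) (hs : Mem m T s)
    (hrp : ¬ Eqv (m + 1) p r) (hsp : ¬ Eqv (m + 1) p s) (hrq : ¬ Eqv (m + 1) q r)
    (hsq : ¬ Eqv (m + 1) q s) (hrs : ¬ Eqv (m + 1) r s)
    (h1 : Eqv m (L m p) (R m q)) (h2 : Eqv m (L m q) (R m p)) : False := by
  have par : ∀ {p q : ℕ → ℤ}, Mem m T p → Mem m T q → ¬ Eqv (m + 1) p q →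
      ¬ (col (L m p) = col (L m q) ∧ col (R m p) = col (R m q)) := by
    rintro p q hp hq hne ⟨h1, h2⟩
    rcases parallel (by omega) hT hp hq hne ((hT.col_iff hp.T_L hq.T_L).1 h1)
      ((hT.col_iff hp.T_R hq.T_R).1 h2) with h | h
    · exact hloop _ hp.T_L h
    · exact hloop _ hp.T_R h
  have nc : ∀ {p : ℕ → ℤ}, Mem m T p → col (L m p) ≠ col (R m p) := fun hp h =>
    hp.not_eqv (by omega) (hloop _ hp.T_L) ((hT.col_iff hp.T_L hp.T_R).1 h)
  have nm : ¬ (p 1 < p 2 ↔ p 2 < p 3) := fun h => by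
    rcases antiparallel (by omega) hp.inj hq.inj hp.con hq.con h1 h2 h with h | h
    · exact hloop _ hp.T_L h
    · exact hloop _ hp.T_R h
  have c1 := (hT.col_iff hp.T_L hq.T_R).2 h1
  have c2 := (hT.col_iff hq.T_L hp.T_R).2 h2
  have p1 := par hp hr hrp
  have p2 := par hp hs hsp
  have p3 := par hq hr hrq
  have p4 := par hq hs hsq
  rw [c2, ← c1] at p3 p4
  have E : ∀ {x y : ℕ → ℤ}, T x → T y → col x = col y → Eqv m x y := fun hx hy h =>
    (hT.col_iff hx hy).1 h
  have N : ∀ {x y : ℕ → ℤ}, T x → T y → col x ≠ col y → ¬ Eqv m x y := fun hx hy h h' =>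
    h ((hT.col_iff hx hy).2 h')
  rcases opposite_cases _ _ (nc hp) _ _ (nc hr) p1 p3 _ _ (nc hs) p2 p4 (par hr hs hrs) with
    h | h | h | h
  · apply nm
    apply triangle (r := r) (s := s) hm h1 h2
    refine h.imp ?_ (Or.imp ?_ (Or.imp ?_ ?_)) <;> rintro ⟨h3, h4, h5⟩ <;>
      refine ⟨E ?_ ?_ (by omega), E ?_ ?_ (by omega),
        E ?_ ?_ (by omega)⟩ <;> first | exact hp.T_L | exact hq.T_L | exact hr.T_L | exact hs.T_L | exact hp.T_R | exact hq.T_R | exact hr.T_R | exact hs.T_R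
  · apply nm
    apply triangle (r := s) (s := r) hm h1 h2
    refine h.imp ?_ (Or.imp ?_ (Or.imp ?_ ?_)) <;> rintro ⟨h3, h4, h5⟩ <;>
      refine ⟨E ?_ ?_ (by omega), E ?_ ?_ (by omega),
        E ?_ ?_ (by omega)⟩ <;> first | exact hp.T_L | exact hq.T_L | exact hr.T_L | exact hs.T_L | exact hp.T_R | exact hq.T_R | exact hr.T_R | exact hs.T_R
  · rcases h with ⟨h3, h4, h5, h6⟩ | ⟨h3, h4, h5, h6⟩
    · exact double_antiparallel hm hT hloop hp hq hr hs h1 h2 (E hq.T_L hr.T_L (by omega))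
        (E hr.T_L hs.T_R h4) (E hs.T_L hr.T_R h5) (N hp.T_L hs.T_L h6)
    · exact double_antiparallel hm hT hloop hp hq hs hr h1 h2 (E hq.T_L hs.T_L (by omega))
        (E hs.T_L hr.T_R h4) (E hr.T_L hs.T_R h5) (N hp.T_L hr.T_L h6)
  · rcases h with ⟨h3, h4, h5, h6⟩ | ⟨h3, h4, h5, h6⟩
    · exact double_antiparallel hm hT hloop hq hp hr hs h2 h1 (E hp.T_L hr.T_L (by omega))
        (E hr.T_L hs.T_R h4) (E hs.T_L hr.T_R h5) (N hq.T_L hs.T_L (by omega))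
    · exact double_antiparallel hm hT hloop hq hp hs hr h2 h1 (E hp.T_L hs.T_L (by omega))
        (E hs.T_L hr.T_R h4) (E hr.T_L hs.T_R h5) (N hq.T_L hr.T_L (by omega))

/-- There are at most three members if no loop pattern occurs among the children. -/
theorem no_loop_case (hm : 6 ≤ m) (hT : Ctx m T col) (hloop : ∀ x, T x → ¬ IsLoop m x)
    (hp : Mem m T p) (hq : Mem m T q) (hr : Mem m T r) (hs : Mem m T s)
    (hpq : ¬ Eqv (m + 1) p q) (hpr : ¬ Eqv (m + 1) p r) (hps : ¬ Eqv (m + 1) p s)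
    (hqr : ¬ Eqv (m + 1) q r) (hqs : ¬ Eqv (m + 1) q s) (hrs : ¬ Eqv (m + 1) r s) : False := by
  have par : ∀ {p q : ℕ → ℤ}, Mem m T p → Mem m T q → ¬ Eqv (m + 1) p q →
      ¬ (col (L m p) = col (L m q) ∧ col (R m p) = col (R m q)) := by
    rintro p q hp hq hne ⟨h1, h2⟩
    rcases parallel (by omega) hT hp hq hne ((hT.col_iff hp.T_L hq.T_L).1 h1)
      ((hT.col_iff hp.T_R hq.T_R).1 h2) with h | h
    · exact hloop _ hp.T_L h
    · exact hloop _ hp.T_R h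
  have nc : ∀ {p : ℕ → ℤ}, Mem m T p → col (L m p) ≠ col (R m p) := fun hp h =>
    hp.not_eqv (by omega) (hloop _ hp.T_L) ((hT.col_iff hp.T_L hp.T_R).1 h)
  have E : ∀ {p q : ℕ → ℤ}, Mem m T p → Mem m T q → col (L m p) = col (R m q) →
      Eqv m (L m p) (R m q) := fun hx hy h => (hT.col_iff hx.T_L hy.T_R).1 h
  rcases exists_opposite _ _ (nc hp) _ _ (nc hq) (par hp hq hpq) _ _ (nc hr) (par hp hr hpr)
    (par hq hr hqr) _ _ (nc hs) (par hp hs hps) (par hq hs hqs) (par hr hs hrs) with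
    ⟨h1, h2⟩ | ⟨h1, h2⟩ | ⟨h1, h2⟩ | ⟨h1, h2⟩ | ⟨h1, h2⟩ | ⟨h1, h2⟩
  · exact no_loop_opposite hm hT hloop hp hq hr hs hpr hps hqr hqs hrs (E hp hq h1) (E hq hp h2)
  · exact no_loop_opposite hm hT hloop hp hr hq hs hpq hps (mt Eqv.symm hqr) hrs hqs (E hp hr h1)
      (E hr hp h2)
  · exact no_loop_opposite hm hT hloop hp hs hq hr hpq hpr (mt Eqv.symm hqs) (mt Eqv.symm hrs) hqr
      (E hp hs h1) (E hs hp h2)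
  · exact no_loop_opposite hm hT hloop hq hr hp hs (mt Eqv.symm hpq) hqs (mt Eqv.symm hpr) hrs hps
      (E hq hr h1) (E hr hq h2)
  · exact no_loop_opposite hm hT hloop hq hs hp hr (mt Eqv.symm hpq) hqr (mt Eqv.symm hps)
      (mt Eqv.symm hrs) hpr (E hq hs h1) (E hs hq h2)
  · exact no_loop_opposite hm hT hloop hr hs hp hq (mt Eqv.symm hpr) (mt Eqv.symm hqr)
      (mt Eqv.symm hps) (mt Eqv.symm hqs) hpq (E hr hs h1) (E hs hr h2)

end Pattern

/-! ### Kinds of loop patterns and the bonds they force in their parents -/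

namespace Pattern

variable {m : ℕ} {T : (ℕ → ℤ) → Prop} {col : (ℕ → ℤ) → Fin 3} {p q r s x y : ℕ → ℤ}

theorem IsD.unique (hp : IsD m p) (hq : IsD m q) : Eqv m p q := by
  intro i hi j hj
  rcases lt_trichotomy i j with h | rfl | h
  · have := hp i j h hj; have := hq i j h hj; omega
  · simp
  · have := hp j i h hi; have := hq j i h hi; omega

theorem IsS.unique (hp : IsS m p) (hq : IsS m q) : Eqv m p q := by
  have key : ∀ i j, i < j → j ≤ m → (p i < p j ↔ q i < q j) ∧ (p j < p i ↔ q j < q i) := by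
    intro i j hij hj
    rcases Nat.lt_or_ge j m with h | h
    · have := hp.1 i j hij h; have := hq.1 i j hij h; omega
    · obtain rfl : j = m := by omega
      have := hp.2 i hij; have := hq.2 i hij; omega
  intro i hi j hj
  rcases lt_trichotomy i j with h | rfl | h
  · exact (key i j h hj).1
  · simp
  · exact (key j i h hi).2

theorem IsS'.unique (hp : IsS' m p) (hq : IsS' m q) : Eqv m p q :=
  eqv_rc_iff.1 (hp.rc.unique hq.rc)

/-- The three kinds of loop patterns. -/
def Kind (c : Fin 3) (m : ℕ) (p : ℕ → ℤ) : Prop :=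
  (c = 0 ∧ IsD m p) ∨ (c = 1 ∧ IsS m p) ∨ (c = 2 ∧ IsS' m p)

theorem isLoop_iff_kind : IsLoop m p ↔ ∃ c, Kind c m p := by
  constructor
  · rintro (h | h | h)
    · exact ⟨0, Or.inl ⟨rfl, h⟩⟩
    · exact ⟨1, Or.inr (Or.inl ⟨rfl, h⟩)⟩
    · exact ⟨2, Or.inr (Or.inr ⟨rfl, h⟩)⟩
  · rintro ⟨c, ⟨-, h⟩ | ⟨-, h⟩ | ⟨-, h⟩⟩
    · exact Or.inl h
    · exact Or.inr (Or.inl h)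
    · exact Or.inr (Or.inr h)

theorem Kind.unique {c : Fin 3} (hp : Kind c m p) (hq : Kind c m q) : Eqv m p q := by
  rcases hp with ⟨h, hp⟩ | ⟨h, hp⟩ | ⟨h, hp⟩ <;> rcases hq with ⟨h', hq⟩ | ⟨h', hq⟩ | ⟨h', hq⟩ <;>
    first | exact hp.unique hq | omega

theorem Kind.isLoop {c : Fin 3} (hp : Kind c m p) : IsLoop m p := isLoop_iff_kind.2 ⟨c, hp⟩

/-- Indecomposable deletions of a loop pattern are of the same kind. -/
theorem Kind.del {c : Fin 3} (hm : 1 ≤ m) (hp : Kind c (m + 1) p) {r : ℕ} (hr : r ≤ m + 1)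
    (hc : Con m (del p r)) : Kind c m (del p r) := by
  rcases hp with ⟨h, hp⟩ | ⟨h, hp⟩ | ⟨h, hp⟩
  · refine Or.inl ⟨h, fun a b hab hb => ?_⟩
    unfold Pattern.del
    split_ifs <;> exact hp _ _ (by omega) (by omega)
  · have hrm : r < m + 1 := by
      by_contra hcon
      obtain rfl : r = m + 1 := by omega
      refine not_con_of_first hm (fun j hj hj' => ?_) hc
      rw [del_lt (by omega), del_lt (by omega)]
      exact hp.1 _ _ (by omega) (by omega)
    refine Or.inr (Or.inl ⟨h, fun a b hab hb => ?_, fun a ha => ?_⟩)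
    · unfold Pattern.del
      split_ifs <;> exact hp.1 _ _ (by omega) (by omega)
    · rw [del_ge (by omega)]
      unfold Pattern.del
      split_ifs <;> exact hp.2 _ (by omega)
  · have hr0 : 0 < r := by
      by_contra hcon
      obtain rfl : r = 0 := by omega
      refine not_con_of_first hm (fun j hj hj' => ?_) hc
      rw [del_ge (by omega), del_ge (by omega)]
      exact hp.1 _ _ (by omega) (by omega) (by omega)
    refine Or.inr (Or.inr ⟨h, fun a b ha hab hb => ?_, fun a ha ha' => ?_⟩)
    · unfold Pattern.del
      split_ifs <;> exact hp.1 _ _ (by omega) (by omega) (by omega)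
    · rw [del_lt hr0]
      unfold Pattern.del
      split_ifs <;> exact hp.2 _ (by omega) (by omega)

theorem exists_kind (c : Fin 3) (m : ℕ) : ∃ p, Kind c (m + 1) p ∧ Inj (m + 1) p ∧ Con (m + 1) p := by
  have hS : ∃ p, IsS (m + 1) p ∧ Inj (m + 1) p ∧ Con (m + 1) p := by
    refine ⟨fun i => if i < m + 1 then i else -1, ⟨fun a b hab hb => ?_, fun a ha => ?_⟩, ?_, ?_⟩
    · simp only [show a < m + 1 by omega, hb, if_true]; omega
    · simp only [ha, if_true, lt_irrefl, if_false]; omega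
    · intro i hi j hj h
      dsimp only at h
      split_ifs at h <;> omega
    · apply con_of_inv
      simp
  have hc : c = 0 ∨ c = 1 ∨ c = 2 := by omega
  rcases hc with rfl | rfl | rfl
  · refine ⟨fun i => -i, Or.inl ⟨rfl, fun a b hab hb => ?_⟩, fun i hi j hj h => ?_, ?_⟩
    · simp only; omega
    · simp only at h; omega
    · apply con_of_inv
      omega
  · obtain ⟨p, h1, h2, h3⟩ := hS
    exact ⟨p, Or.inr (Or.inl ⟨rfl, h1⟩), h2, h3⟩
  · obtain ⟨p, h1, h2, h3⟩ := hS
    exact ⟨rc (m + 1) p, Or.inr (Or.inr ⟨rfl, h1.rc⟩), h2.rc, h3.rc⟩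

/-- If a loop pattern is available as a child, then the longer loop pattern is a member. -/
theorem exists_mem_kind {c : Fin 3} (hm : 1 ≤ m) (hT : Ctx m T col) (hx : T x) (hk : Kind c m x) :
    ∃ p, Kind c (m + 1) p ∧ Mem m T p ∧ ∀ r ≤ m + 1, Con m (del p r) → Eqv m (del p r) x := by
  obtain ⟨p, h1, h2, h3⟩ := exists_kind c m
  have h4 : ∀ r ≤ m + 1, Con m (del p r) → Eqv m (del p r) x := fun r hr hc =>
    (h1.del hm hr hc).unique hk
  exact ⟨p, h1, ⟨h2, h3, fun r hr hc => hT.cl hx (h4 r hr hc).symm⟩, h4⟩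

theorem IsLoop.dir (h : IsLoop m p) (hm : 4 ≤ m) {j : ℕ} (hj : 1 ≤ j) (hjm : j + 2 ≤ m) :
    (p j < p (j + 1) ↔ p 2 < p 3) := by
  rcases h with h | h | h
  · have := h j (j + 1) (by omega) (by omega)
    have := h 2 3 (by omega) (by omega)
    omega
  · have := h.1 j (j + 1) (by omega) (by omega)
    have := h.1 2 3 (by omega) (by omega)
    omega
  · have := h.1 j (j + 1) (by omega) (by omega) (by omega)
    have := h.1 2 3 (by omega) (by omega) (by omega)
    omega

theorem IsLoop.bond (h : IsLoop m p) {b : ℕ} (hb : 1 ≤ b) (hbm : b + 2 ≤ m) : Bond m p b := by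
  intro k hk h1 h2
  rcases h with h | h | h
  · rcases Nat.lt_or_ge k b with h3 | h3
    · have := h k b h3 (by omega); have := h k (b + 1) (by omega) (by omega); omega
    · have := h b k (by omega) hk; have := h (b + 1) k (by omega) hk; omega
  · rcases Nat.lt_or_ge k b with h3 | h3
    · have := h.1 k b h3 (by omega); have := h.1 k (b + 1) (by omega) (by omega); omega
    · rcases Nat.lt_or_ge k m with h4 | h4
      · have := h.1 b k (by omega) h4; have := h.1 (b + 1) k (by omega) h4; omega
      · obtain rfl : k = m := by omega
        have := h.2 b (by omega); have := h.2 (b + 1) (by omega); omega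
  · rcases Nat.eq_zero_or_pos k with rfl | h3
    · have := h.2 b (by omega) (by omega); have := h.2 (b + 1) (by omega) (by omega); omega
    · rcases Nat.lt_or_ge k b with h3 | h3
      · have := h.1 k b (by omega) h3 (by omega)
        have := h.1 k (b + 1) (by omega) (by omega) (by omega); omega
      · have := h.1 b k (by omega) (by omega) hk
        have := h.1 (b + 1) k (by omega) (by omega) hk; omega

/-- The index in `del p r` of the position `k ≠ r` of `p`. -/
theorem exists_del_eq {r k : ℕ} (p : ℕ → ℤ) (hk : k ≤ m + 1) (hr : r ≤ m + 1) (hkr : k ≠ r) :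
    ∃ i ≤ m, del p r i = p k ∧ (i = k ∧ k < r ∨ i + 1 = k ∧ r < k) := by
  rcases lt_or_gt_of_ne hkr with h | h
  · exact ⟨k, by omega, del_lt h, Or.inl ⟨rfl, h⟩⟩
  · refine ⟨k - 1, by omega, ?_, Or.inr ⟨by omega, h⟩⟩
    rw [del_ge (by omega), Nat.sub_add_cancel (by omega)]

theorem left_dir (hm : 4 ≤ m) (h : IsLoop m (L m p)) {j : ℕ} (hj : 2 ≤ j) (hjm : j + 1 ≤ m) :
    (p j < p (j + 1) ↔ L m p 2 < L m p 3) := by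
  have := h.dir hm (j := j - 1) (by omega) (by omega)
  rwa [L_pos _ (by omega), L_pos _ (by omega), Nat.sub_add_cancel (by omega)] at this

theorem right_dir (hm : 4 ≤ m) (h : IsLoop m (R m p)) {j : ℕ} (hj : 1 ≤ j) (hjm : j + 2 ≤ m) :
    (p j < p (j + 1) ↔ R m p 2 < R m p 3) := by
  have := h.dir hm (j := j) (by omega) (by omega)
  rwa [R_lt p (by omega : j < m), R_lt p (by omega : j + 1 < m)] at this

/-- In a pattern whose left child is a loop pattern only the deleted entry may break bonds. -/
theorem left_bond (h : IsLoop m (L m p)) {b : ℕ} (hb : 2 ≤ b) (hbm : b + 1 ≤ m) {k : ℕ}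
    (hk : k ≤ m + 1) (h1 : k ≠ b) (h2 : k ≠ b + 1) (hks : k ≠ sL m p) :
    (p k < p b ↔ p k < p (b + 1)) := by
  have hs := sL_le m p
  obtain ⟨i, hi, he, hi'⟩ := exists_del_eq p hk (show sL m p ≤ m + 1 by omega) hks
  have := h.bond (b := b - 1) (by omega) (by omega) i hi (by omega) (by omega)
  rw [L_pos p (show 1 ≤ b - 1 by omega), L_pos p (show 1 ≤ b - 1 + 1 by omega),
    Nat.sub_add_cancel (by omega)] at this
  change del p (sL m p) i < _ ↔ del p (sL m p) i < _ at this
  rwa [he] at this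

/-- Only the entry removed for the left child can break a bond of the monotone core, and a single
value fits between at most one pair of neighbours in a monotone sequence. -/
theorem left_near (hm : 4 ≤ m) (hp : Inj (m + 1) p) (h : IsLoop m (L m p)) {b b' : ℕ} (hb : 2 ≤ b) (hbb : b < b')
    (hbm : b' + 1 ≤ m) : Bond (m + 1) p b ∨ Bond (m + 1) p b' := by
  by_contra hcon
  unfold Bond at hcon
  push Not at hcon
  obtain ⟨⟨k, hk, h1, h2, h3⟩, k', hk', h1', h2', h3'⟩ := hcon
  have e1 : k = sL m p := by
    by_contra hne
    have := left_bond h hb (by omega) hk h1 h2 hne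
    omega
  have e2 : k' = sL m p := by
    by_contra hne
    have := left_bond h (by omega) hbm hk' h1' h2' hne
    omega
  obtain rfl : k = k' := by omega
  have d1 := left_dir hm h hb (show b + 1 ≤ m by omega)
  have d2 := left_dir hm h (show 2 ≤ b' by omega) hbm
  by_cases hd : L m p 2 < L m p 3
  · have mono := mono_of_step (p := p) (i := b) (j := b') fun a ha ham =>
      (left_dir hm h (by omega) (by omega)).2 hd
    rcases Nat.lt_or_ge (b + 1) b' with h4 | h4
    · have := mono (b + 1) b' (by omega) h4 le_rfl
      omega
    · obtain rfl : b' = b + 1 := by omega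
      omega
  · have mono := anti_of_step (p := p) (i := b) (j := b') fun a ha ham => by
      have := (left_dir hm h (j := a) (by omega) (by omega)).not.2 hd
      have := hp.ne (show a ≤ m + 1 by omega) (show a + 1 ≤ m + 1 by omega) (by omega)
      omega
    rcases Nat.lt_or_ge (b + 1) b' with h4 | h4
    · have := mono (b + 1) b' (by omega) h4 le_rfl
      omega
    · obtain rfl : b' = b + 1 := by omega
      omega

end Pattern

/-! ### Two or three loop patterns among the children -/

namespace Pattern

variable {m : ℕ} {T : (ℕ → ℤ) → Prop} {col : (ℕ → ℤ) → Fin 3} {p q r s x y : ℕ → ℤ} {u : Prop}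

theorem Bond.of_rc (hp : Inj (m + 1) p) {b : ℕ} (hb : b ≤ m) (h : Bond (m + 1) (rc (m + 1) p) b) :
    Bond (m + 1) p (m - b) := by
  intro k hk h1 h2
  have := h (m + 1 - k) (by omega) (by omega) (by omega)
  have n1 := hp.ne hk (show m - b ≤ m + 1 by omega) h1
  have n2 := hp.ne hk (show m - b + 1 ≤ m + 1 by omega) h2
  unfold rc at this
  rw [show m + 1 - (m + 1 - k) = k by omega, show m + 1 - b = m - b + 1 by omega,
    show m + 1 - (b + 1) = m - b by omega] at this
  omega

theorem right_near (hm : 4 ≤ m) (hp : Inj (m + 1) p) (h : IsLoop m (R m p)) {b b' : ℕ}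
    (hb : 1 ≤ b) (hbb : b < b') (hbm : b' + 2 ≤ m) : Bond (m + 1) p b ∨ Bond (m + 1) p b' := by
  have h1 : IsLoop m (L m (rc (m + 1) p)) := h.rc.eqv (L_rc p).symm
  have h2 := left_near hm hp.rc h1 (b := m - b') (b' := m - b) (by omega) (by omega) (by omega)
  rcases h2 with h2 | h2 <;> replace h2 := h2.of_rc hp (by omega)
  · right; rwa [show m - (m - b') = b' by omega] at h2
  · left; rwa [show m - (m - b) = b by omega] at h2

/-- A pattern with a monotone core in which at most one of the inner bonds is broken. -/
structure Adj (m : ℕ) (p : ℕ → ℤ) (u : Prop) : Prop where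
  dir : ∀ j, 2 ≤ j → j + 2 ≤ m → (p j < p (j + 1) ↔ u)
  near : ∀ b b', 2 ≤ b → b < b' → b' + 2 ≤ m → Bond (m + 1) p b ∨ Bond (m + 1) p b'

theorem adj_left (hm : 4 ≤ m) (hp : Inj (m + 1) p) (h : IsLoop m (L m p)) :
    Adj m p (L m p 2 < L m p 3) :=
  ⟨fun _ h1 h2 => left_dir hm h h1 (by omega),
    fun _ _ h1 h2 h3 => left_near hm hp h h1 h2 (by omega)⟩

theorem adj_right (hm : 4 ≤ m) (hp : Inj (m + 1) p) (h : IsLoop m (R m p)) :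
    Adj m p (R m p 2 < R m p 3) :=
  ⟨fun _ h1 h2 => right_dir hm h (by omega) h2,
    fun _ _ h1 h2 h3 => right_near hm hp h (by omega) h2 h3⟩

theorem Adj.congr {v : Prop} (h : Adj m p u) (huv : u ↔ v) : Adj m p v :=
  ⟨fun j h1 h2 => (h.dir j h1 h2).trans huv, h.near⟩

theorem Adj.L_dir (hm : 6 ≤ m) (h : Adj m p u) : (L m p 2 < L m p 3 ↔ u) := by
  rw [L_pos _ (by omega), L_pos _ (by omega)]
  exact h.dir 3 (by omega) (by omega)

theorem Adj.R_dir (hm : 6 ≤ m) (h : Adj m p u) : (R m p 2 < R m p 3 ↔ u) := by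
  rw [R_lt p (by omega), R_lt p (by omega)]
  exact h.dir 2 (by omega) (by omega)

theorem Adj.del_dir (hm : 6 ≤ m) (h : Adj m p u) {b : ℕ} (hb : 2 ≤ b) (hbm : b + 2 ≤ m)
    (hbd : Bond (m + 1) p b) : (del p b 2 < del p b 3 ↔ u) := by
  rcases Nat.lt_or_ge 3 b with h1 | h1
  · rw [del_lt (by omega), del_lt h1]
    exact h.dir 2 le_rfl (by omega)
  · rw [del_ge h1]
    rcases Nat.lt_or_ge 2 b with h2 | h2
    · obtain rfl : b = 3 := by omega
      rw [del_lt (by omega), ← hbd 2 (by omega) (by omega) (by omega)]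
      exact h.dir 2 le_rfl (by omega)
    · rw [del_ge h2]
      exact h.dir 3 (by omega) (by omega)

/-- A loop pattern satisfies the hypotheses of a pattern with a loop child and breaks no bond. -/
theorem loop_adj (hm : 6 ≤ m) (h : IsLoop (m + 1) p) :
    Adj m p (p 2 < p 3) ∧ ∀ b, 1 ≤ b → b + 1 ≤ m → Bond (m + 1) p b :=
  ⟨⟨fun j h1 h2 => h.dir (by omega) (by omega) (by omega),
    fun b b' h1 h2 h3 => Or.inl (h.bond (by omega) (by omega))⟩,
    fun _ h1 h2 => h.bond h1 (by omega)⟩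

/-- Each of the two patterns misses at most one of the bonds at 2, 3 and 4, which are all inner
because `m ≥ 6`. -/
theorem exists_common_bond (hm : 6 ≤ m) {v : Prop} (hp : Adj m p u) (hq : Adj m q v) :
    ∃ b, 2 ≤ b ∧ b + 2 ≤ m ∧ Bond (m + 1) p b ∧ Bond (m + 1) q b := by
  by_contra hcon
  push Not at hcon
  have h2 := hcon 2 le_rfl (by omega)
  have h3 := hcon 3 (by omega) (by omega)
  have h4 := hcon 4 (by omega) (by omega)
  have p23 := hp.near 2 3 le_rfl (by omega) (by omega)
  have p24 := hp.near 2 4 le_rfl (by omega) (by omega)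
  have p34 := hp.near 3 4 (by omega) (by omega) (by omega)
  have q23 := hq.near 2 3 le_rfl (by omega) (by omega)
  have q24 := hq.near 2 4 le_rfl (by omega) (by omega)
  have q34 := hq.near 3 4 (by omega) (by omega) (by omega)
  tauto

theorem Mem.T_bond (hp : Mem m T p) {b : ℕ} (hb : b ≤ m) (hm : 0 < m) (h : Bond (m + 1) p b) :
    T (del p b) := hp.child b (by omega) (h.con hp.inj hp.con hb hm)

/-- Three members with a common bond account for all children. -/
theorem three_bonds (hT : Ctx m T col) (hm : 0 < m) (hp : Mem m T p) (hq : Mem m T q)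
    (hr : Mem m T r) (hpq : ¬ Eqv (m + 1) p q) (hpr : ¬ Eqv (m + 1) p r)
    (hqr : ¬ Eqv (m + 1) q r) {b : ℕ} (hb : b ≤ m) (bp : Bond (m + 1) p b) (bq : Bond (m + 1) q b)
    (br : Bond (m + 1) r b) (dp : p b < p (b + 1) ↔ u) (dq : q b < q (b + 1) ↔ u)
    (dr : r b < r (b + 1) ↔ u) {w : ℕ → ℤ} (hw : T w) :
    Eqv m w (del p b) ∨ Eqv m w (del q b) ∨ Eqv m w (del r b) := by
  refine hT.eqv_of_three (hp.T_bond hb hm bp) (hq.T_bond hb hm bq) (hr.T_bond hb hm br) hw ?_ ?_ ?_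
  · exact fun h => hpq (bp.eqv hp.inj hq.inj hb bq (dp.trans dq.symm) h)
  · exact fun h => hpr (bp.eqv hp.inj hr.inj hb br (dp.trans dr.symm) h)
  · exact fun h => hqr (bq.eqv hq.inj hr.inj hb br (dq.trans dr.symm) h)

/-- Deleting at a common bond of common direction is injective on patterns, so four members would
have four different children. -/
theorem four_bonds (hT : Ctx m T col) (hm : 0 < m) (hp : Mem m T p) (hq : Mem m T q)
    (hr : Mem m T r) (hs : Mem m T s) (hpq : ¬ Eqv (m + 1) p q) (hpr : ¬ Eqv (m + 1) p r)
    (hps : ¬ Eqv (m + 1) p s) (hqr : ¬ Eqv (m + 1) q r) (hqs : ¬ Eqv (m + 1) q s)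
    (hrs : ¬ Eqv (m + 1) r s) {b : ℕ} (hb : b ≤ m) (bp : Bond (m + 1) p b) (bq : Bond (m + 1) q b)
    (br : Bond (m + 1) r b) (bs : Bond (m + 1) s b) (dp : p b < p (b + 1) ↔ u)
    (dq : q b < q (b + 1) ↔ u) (dr : r b < r (b + 1) ↔ u) (ds : s b < s (b + 1) ↔ u) : False := by
  rcases three_bonds hT hm hp hq hr hpq hpr hqr hb bp bq br dp dq dr (hs.T_bond hb hm bs) with
    h | h | h
  · exact hps (bp.eqv hp.inj hs.inj hb bs (dp.trans ds.symm) h.symm)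
  · exact hqs (bq.eqv hq.inj hs.inj hb bs (dq.trans ds.symm) h.symm)
  · exact hrs (br.eqv hr.inj hs.inj hb bs (dr.trans ds.symm) h.symm)

/-- Three members of the same direction exclude a child of the other direction. -/
theorem three_adj (hT : Ctx m T col) (hm : 6 ≤ m) (hp : Mem m T p) (hq : Mem m T q)
    (hr : Mem m T r) (hpq : ¬ Eqv (m + 1) p q) (hpr : ¬ Eqv (m + 1) p r)
    (hqr : ¬ Eqv (m + 1) q r) {b : ℕ} (hb : 2 ≤ b) (hbm : b + 2 ≤ m) (bp : Bond (m + 1) p b)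
    (bq : Bond (m + 1) q b) (br : Bond (m + 1) r b) (ap : Adj m p u) (aq : Adj m q u)
    (ar : Adj m r u) {w : ℕ → ℤ} (hw : T w) : (w 2 < w 3 ↔ u) := by
  rcases three_bonds hT (by omega) hp hq hr hpq hpr hqr (by omega) bp bq br (ap.dir b hb hbm)
    (aq.dir b hb hbm) (ar.dir b hb hbm) hw with h | h | h
  · exact (h 2 (by omega) 3 (by omega)).trans (ap.del_dir hm hb hbm bp)
  · exact (h 2 (by omega) 3 (by omega)).trans (aq.del_dir hm hb hbm bq)
  · exact (h 2 (by omega) 3 (by omega)).trans (ar.del_dir hm hb hbm br)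

/-- The loop member above a loop pattern that occurs as a child. -/
theorem exists_loop_mem (hT : Ctx m T col) (hm : 6 ≤ m) (hx : T x) (hl : IsLoop m x) :
    ∃ p, Mem m T p ∧ IsLoop (m + 1) p ∧ Adj m p (x 2 < x 3) ∧
      (∀ b, 1 ≤ b → b + 1 ≤ m → Bond (m + 1) p b) ∧
      ∀ r ≤ m + 1, Con m (del p r) → Eqv m (del p r) x := by
  obtain ⟨c, hc⟩ := isLoop_iff_kind.1 hl
  obtain ⟨p, h1, h2, h3⟩ := exists_mem_kind (by omega) hT hx hc
  obtain ⟨h4, h5⟩ := loop_adj hm h1.isLoop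
  refine ⟨p, h2, h1.isLoop, h4.congr ?_, h5, h3⟩
  have hb := h5 4 (by omega) (by omega)
  have h6 := h3 4 (by omega) (hb.con h2.inj h2.con (by omega) (by omega)) 2 (by omega) 3 (by omega)
  rwa [del_lt (by omega), del_lt (by omega)] at h6

theorem loop_mem_ne (hm : 6 ≤ m) (hp : Inj (m + 1) p) (hpc : Con (m + 1) p)
    (h : ∀ r ≤ m + 1, Con m (del p r) → Eqv m (del p r) x)
    (hy : ∀ r ≤ m + 1, Con m (del q r) → Eqv m (del q r) y) (hb : Bond (m + 1) p 2)
    (hxy : ¬ Eqv m x y) : ¬ Eqv (m + 1) p q := by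
  intro he
  have hc := hb.con hp hpc (by omega) (by omega)
  have h1 := h 2 (by omega) hc
  have h2 := eqv_del he 2
  exact hxy (h1.symm.trans (h2.trans (hy 2 (by omega) (h2.con hc))))

theorem not_eqv_loop (hp : IsLoop (m + 1) p) (hq : ¬ IsLoop (m + 1) q) : ¬ Eqv (m + 1) p q :=
  fun h => hq (hp.eqv h)

/-- A member that is not a loop pattern has two different children, one of which is a given loop
pattern if two loop patterns occur. -/
theorem Mem.adj_of_two (hT : Ctx m T col) (hm : 6 ≤ m) (hx : T x) (hy : T y) (lx : IsLoop m x)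
    (ly : IsLoop m y) (hxy : ¬ Eqv m x y) (hp : Mem m T p) (hl : ¬ IsLoop (m + 1) p) :
    ∃ u : Prop, Adj m p u := by
  have hne : ¬ Eqv m (L m p) (R m p) := fun he =>
    hl (loop_of_L_R (by omega) hp.inj hp.con he)
  by_cases h1 : IsLoop m (L m p)
  · exact ⟨_, adj_left (by omega) hp.inj h1⟩
  · rcases hT.eqv_of_three hx hy hp.T_L hp.T_R hxy (fun h => h1 (lx.eqv h)) (fun h => h1 (ly.eqv h))
      with h | h | h
    · exact ⟨_, adj_right (by omega) hp.inj (lx.eqv h.symm)⟩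
    · exact ⟨_, adj_right (by omega) hp.inj (ly.eqv h.symm)⟩
    · exact absurd h.symm hne

/-- Compare the directions of the cores of `p` and `q` with those of `x` and `y`, adjoining the
longer loop patterns `f` and `g`. If all agree, `f`, `g`, `p`, `q` contradict `four_bonds`. If
exactly one of `x`, `y` has the direction of `p` and `q`, three members of this direction fill all
classes and leave no room for the other loop pattern. If neither has it, both children of `p` fall
into the third class. If `p` and `q` have different directions, their four children are distinct. -/
theorem two_loops_case (hT : Ctx m T col) (hm : 6 ≤ m) (hx : T x) (hy : T y) (lx : IsLoop m x)
    (ly : IsLoop m y) (hxy : ¬ Eqv m x y) (hp : Mem m T p) (hq : Mem m T q)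
    (np : ¬ IsLoop (m + 1) p) (nq : ¬ IsLoop (m + 1) q) (hpq : ¬ Eqv (m + 1) p q) : False := by
  obtain ⟨u, ap⟩ := hp.adj_of_two hT hm hx hy lx ly hxy np
  obtain ⟨v, aq⟩ := hq.adj_of_two hT hm hx hy lx ly hxy nq
  obtain ⟨b, hb, hbm, bp, bq⟩ := exists_common_bond hm ap aq
  obtain ⟨f, mf, lf, af, bf, cf⟩ := exists_loop_mem hT hm hx lx
  obtain ⟨g, mg, lg, ag, bg, cg⟩ := exists_loop_mem hT hm hy ly
  have hpn : ¬ Eqv m (L m p) (R m p) := fun he => np (loop_of_L_R (by omega) hp.inj hp.con he)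
  have hqn : ¬ Eqv m (L m q) (R m q) := fun he => nq (loop_of_L_R (by omega) hq.inj hq.con he)
  have hfg := loop_mem_ne hm mf.inj mf.con cf cg (bf 2 (by omega) (by omega)) hxy
  have D : ∀ {a b : ℕ → ℤ}, Eqv m a b → (a 2 < a 3 ↔ b 2 < b 3) := fun h =>
    h 2 (by omega) 3 (by omega)
  by_cases huv : u ↔ v
  · replace aq := aq.congr huv.symm
    by_cases hxu : x 2 < x 3 ↔ u
    · replace af := af.congr hxu
      by_cases hyu : y 2 < y 3 ↔ u
      · replace ag := ag.congr hyu
        exact four_bonds hT (by omega) mf mg hp hq hfg (not_eqv_loop lf np) (not_eqv_loop lf nq)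
          (not_eqv_loop lg np) (not_eqv_loop lg nq) hpq (b := b) (by omega)
          (bf b (by omega) (by omega)) (bg b (by omega) (by omega)) bp bq (af.dir b hb hbm)
          (ag.dir b hb hbm) (ap.dir b hb hbm) (aq.dir b hb hbm)
      · exact hyu (three_adj hT hm mf hp hq (not_eqv_loop lf np) (not_eqv_loop lf nq) hpq hb hbm
          (bf b (by omega) (by omega)) bp bq af ap aq hy)
    · by_cases hyu : y 2 < y 3 ↔ u
      · replace ag := ag.congr hyu
        exact hxu (three_adj hT hm mg hp hq (not_eqv_loop lg np) (not_eqv_loop lg nq) hpq hb hbm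
          (bg b (by omega) (by omega)) bp bq ag ap aq hx)
      · rcases hT.eqv_of_three hx hy hp.T_L hp.T_R hxy
          (fun h => hxu ((D h).trans (ap.L_dir hm))) (fun h => hyu ((D h).trans (ap.L_dir hm)))
          with h | h | h
        · exact hxu ((D h.symm).trans (ap.R_dir hm))
        · exact hyu ((D h.symm).trans (ap.R_dir hm))
        · exact hpn h.symm
  · rcases hT.eqv_of_three hp.T_L hp.T_R hq.T_L hq.T_R hpn
      (fun h => huv ((ap.L_dir hm).symm.trans ((D h).trans (aq.L_dir hm))))
      (fun h => huv ((ap.R_dir hm).symm.trans ((D h).trans (aq.L_dir hm)))) with h | h | h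
    · exact huv ((ap.L_dir hm).symm.trans ((D h.symm).trans (aq.R_dir hm)))
    · exact huv ((ap.R_dir hm).symm.trans ((D h.symm).trans (aq.R_dir hm)))
    · exact hqn h.symm

/-- If all three loop patterns occur as children then every member is a loop pattern. -/
theorem three_loops_case (hT : Ctx m T col) (hm : 6 ≤ m) (hx : T x) (hy : T y) {z : ℕ → ℤ}
    (hz : T z) (kx : IsD m x) (ky : IsS m y) (kz : IsS' m z) (hp : Mem m T p)
    (np : ¬ IsLoop (m + 1) p) : False := by
  have dx := kx 2 3 (by omega) (by omega)
  have dy := ky.1 2 3 (by omega) (by omega)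
  have dz := kz.1 2 3 (by omega) (by omega) (by omega)
  have hxy : ¬ Eqv m x y := fun h => by have := h 2 (by omega) 3 (by omega); omega
  have hxz : ¬ Eqv m x z := fun h => by have := h 2 (by omega) 3 (by omega); omega
  have hyz : ¬ Eqv m y z := fun h => by
    have := h 0 (by omega) 1 (by omega)
    have := ky.1 0 1 (by omega) (by omega)
    have := kz.2 1 (by omega) (by omega)
    omega
  obtain ⟨u, ap⟩ := hp.adj_of_two hT hm hx hy (Or.inl kx) (Or.inr (Or.inl ky)) hxy np
  have loop : ∀ w, T w → IsLoop m w := fun w hw => by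
    rcases hT.eqv_of_three hx hy hz hw hxy hxz hyz with h | h | h
    · exact Or.inl (kx.eqv h.symm)
    · exact Or.inr (Or.inl (ky.eqv h.symm))
    · exact Or.inr (Or.inr (kz.eqv h.symm))
  obtain ⟨f, mf, lf, af, bf, cf⟩ := exists_loop_mem hT hm hp.T_L (loop _ hp.T_L)
  obtain ⟨g, mg, lg, ag, bg, cg⟩ := exists_loop_mem hT hm hp.T_R (loop _ hp.T_R)
  have hpn : ¬ Eqv m (L m p) (R m p) := fun he => np (loop_of_L_R (by omega) hp.inj hp.con he)
  have hfg := loop_mem_ne hm mf.inj mf.con cf cg (bf 2 (by omega) (by omega)) hpn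
  obtain ⟨b, hb, hbm, bp, -⟩ := exists_common_bond hm ap ap
  -- The loop patterns above `L m p` and `R m p` share a bond and its direction with `p`, so every
  -- child has this direction. But the decreasing and the increasing kinds differ in direction.
  have key : ∀ w, T w → (w 2 < w 3 ↔ u) := fun w hw =>
    three_adj hT hm mf mg hp hfg (not_eqv_loop lf np) (not_eqv_loop lg np) hb hbm
      (bf b (by omega) (by omega)) (bg b (by omega) (by omega)) bp (af.congr (ap.L_dir hm))
      (ag.congr (ap.R_dir hm)) ap hw
  have := (key x hx).trans (key y hy).symm
  omega

end Pattern

/-! ### Shapes of patterns with a loop child -/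

namespace Pattern

variable {m : ℕ} {T : (ℕ → ℤ) → Prop} {col : (ℕ → ℤ) → Fin 3} {p q r s x y : ℕ → ℤ} {u : Prop}

theorem right_bond (h : IsLoop m (R m p)) {b : ℕ} (hb : 1 ≤ b) (hbm : b + 2 ≤ m) {k : ℕ}
    (hk : k ≤ m + 1) (h1 : k ≠ b) (h2 : k ≠ b + 1) (hks : k ≠ tR m p) :
    (p k < p b ↔ p k < p (b + 1)) := by
  have hm : m ≤ tR m p := by rcases tR_cases m p with h | h <;> omega
  obtain ⟨i, hi, he, hi'⟩ := exists_del_eq p hk (tR_le m p) hks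
  have := h.bond (b := b) (by omega) (by omega) i hi (by omega) (by omega)
  rw [R_lt p (show b < m by omega), R_lt p (show b + 1 < m by omega)] at this
  change del p (tR m p) i < _ ↔ del p (tR m p) i < _ at this
  rwa [he] at this

/-- The shape of a pattern, not a loop pattern, whose left child is increasing up to a final
minimum. -/
theorem left_shape_S (hp : Inj (m + 1) p) (hc : Con (m + 1) p) (hm : 2 ≤ m)
    (hn : ¬ IsLoop (m + 1) p) (h : IsS m (L m p)) :
    p 1 < p 0 ∧
    ((∀ a b, 1 ≤ a → a < b → b ≤ m → p a < p b) ∧ (∀ a, 1 ≤ a → a ≤ m → p (m + 1) < p a) ∨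
    (p 1 < p (m + 1) ∧ p (m + 1) < p 0 ∧ p 0 < p 2 ∧ ∀ a b, 2 ≤ a → a < b → b ≤ m → p a < p b)) := by
  have hpos : ∀ i, 1 ≤ i → L m p i = p (i + 1) := fun i hi => L_pos p hi
  rcases sL_cases m p with ⟨hs, -⟩ | ⟨hs, h0⟩
  · have hall : ∀ i, L m p i = p (i + 1) := fun i => by
      unfold L; rw [hs]; exact del_ge (by omega)
    have hinc : ∀ a b, 1 ≤ a → a < b → b ≤ m → p a < p b := fun a b ha hab hb => by
      have := h.1 (a - 1) (b - 1) (by omega) (by omega)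
      rwa [hall, hall, Nat.sub_add_cancel (by omega), Nat.sub_add_cancel (by omega)] at this
    have hlow : ∀ a, 1 ≤ a → a ≤ m → p (m + 1) < p a := fun a ha hab => by
      have := h.2 (a - 1) (by omega)
      rwa [hall, hall, Nat.sub_add_cancel (by omega)] at this
    refine ⟨?_, Or.inl ⟨hinc, hlow⟩⟩
    by_contra hcon
    have h01 : p 0 < p 1 := by
      have := hp.ne (Nat.zero_le (m + 1)) (show 1 ≤ m + 1 by omega) (by omega)
      omega
    have h0a : ∀ a, 1 ≤ a → a ≤ m → p 0 < p a := fun a ha ha' => by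
      rcases Nat.lt_or_ge 1 a with h1 | h1
      · have := hinc 1 a le_rfl h1 ha'; omega
      · obtain rfl : a = 1 := by omega
        exact h01
    apply hn
    right; left
    refine ⟨fun a b hab hb => ?_, fun a ha => ?_⟩
    · rcases Nat.eq_zero_or_pos a with rfl | ha
      · exact h0a b (by omega) (by omega)
      · exact hinc a b ha hab (by omega)
    · rcases Nat.eq_zero_or_pos a with rfl | ha0
      · obtain ⟨i, hi, j, hj, hj', hij⟩ := hc.cross (Nat.zero_le m)
        obtain rfl : i = 0 := by omega
        rcases Nat.lt_or_ge m j with h1 | h1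
        · obtain rfl : j = m + 1 := by omega
          exact hij
        · have := h0a j hj h1; omega
      · exact hlow a ha0 (by omega)
  · have hL0 : L m p 0 = p 0 := by
      rcases L_zero m p with h' | h'
      · omega
      · exact h'.2
    obtain ⟨k, hk1, hkm, hcut, htop, -⟩ := cut_first hp hc h0
    have h1 := h.2 0 (by omega)
    have h2 := h.2 1 (by omega)
    have h3 := h.1 0 1 (by omega) (by omega)
    rw [hL0] at h1 h3
    rw [hpos m (by omega)] at h1 h2
    rw [hpos 1 le_rfl] at h2 h3
    simp only [Nat.reduceAdd] at h2 h3
    have hk : k = 1 := by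
      by_contra hne
      have := hcut 2 (m + 1) (by omega) (by omega) (by omega) le_rfl
      omega
    subst hk
    refine ⟨htop 1 le_rfl le_rfl, Or.inr ⟨hcut 1 (m + 1) le_rfl le_rfl (by omega) le_rfl, h1, h3,
      fun a b ha hab hb => ?_⟩⟩
    have := h.1 (a - 1) (b - 1) (by omega) (by omega)
    rwa [hpos _ (by omega), hpos _ (by omega), Nat.sub_add_cancel (by omega),
      Nat.sub_add_cancel (by omega)] at this

/-- If the first entry was removed, it must start with an ascent, since otherwise `p` is decreasing.
If the second entry was removed, the block cut off by the first entry consists of position 1 alone,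
because the remaining entries decrease. -/
theorem left_shape_D (hp : Inj (m + 1) p) (hc : Con (m + 1) p) (hm : 2 ≤ m)
    (hn : ¬ IsLoop (m + 1) p) (h : IsD m (L m p)) :
    (p 0 < p 1 ∧ ∀ a b, 1 ≤ a → a < b → b ≤ m + 1 → p b < p a) ∨
    (p 2 < p 0 ∧ p 1 < p (m + 1) ∧ ∀ a b, 2 ≤ a → a < b → b ≤ m + 1 → p b < p a) := by
  have hpos : ∀ i, 1 ≤ i → L m p i = p (i + 1) := fun i hi => L_pos p hi
  rcases sL_cases m p with ⟨hs, -⟩ | ⟨hs, h0⟩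
  · left
    have hall : ∀ i, L m p i = p (i + 1) := fun i => by
      unfold L; rw [hs]; exact del_ge (by omega)
    have hdec : ∀ a b, 1 ≤ a → a < b → b ≤ m + 1 → p b < p a := fun a b ha hab hb => by
      have := h (a - 1) (b - 1) (by omega) (by omega)
      rwa [hall, hall, Nat.sub_add_cancel (by omega), Nat.sub_add_cancel (by omega)] at this
    refine ⟨?_, hdec⟩
    by_contra hcon
    have h01 : p 1 < p 0 := by
      have := hp.ne (Nat.zero_le (m + 1)) (show 1 ≤ m + 1 by omega) (by omega)
      omega
    apply hn
    left
    intro a b hab hb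
    rcases Nat.eq_zero_or_pos a with rfl | ha
    · rcases Nat.lt_or_ge 1 b with h1 | h1
      · have := hdec 1 b le_rfl h1 hb; omega
      · obtain rfl : b = 1 := by omega
        exact h01
    · exact hdec a b ha hab hb
  · right
    have hL0 : L m p 0 = p 0 := by
      rcases L_zero m p with h' | h'
      · omega
      · exact h'.2
    obtain ⟨k, hk1, hkm, hcut, htop, -⟩ := cut_first hp hc h0
    have h1 := h 0 1 (by omega) (by omega)
    have h2 := h 1 m (by omega) le_rfl
    rw [hL0, hpos 1 le_rfl] at h1
    rw [hpos m (by omega), hpos 1 le_rfl] at h2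
    simp only [Nat.reduceAdd] at h1 h2
    have hk : k = 1 := by
      by_contra hne
      have := hcut 2 (m + 1) (by omega) (by omega) (by omega) le_rfl
      omega
    subst hk
    refine ⟨h1, hcut 1 (m + 1) le_rfl le_rfl (by omega) le_rfl, fun a b ha hab hb => ?_⟩
    have := h (a - 1) (b - 1) (by omega) (by omega)
    rwa [hpos _ (by omega), hpos _ (by omega), Nat.sub_add_cancel (by omega),
      Nat.sub_add_cancel (by omega)] at this

theorem right_shape_S (hp : Inj (m + 1) p) (hm : 2 ≤ m) (hn : ¬ IsLoop (m + 1) p)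
    (h : IsS m (R m p)) : p m < p (m - 1) ∧ ∀ a b, a < b → b < m → p a < p b := by
  have hinc : ∀ a b, a < b → b < m → p a < p b := fun a b hab hb => by
    have := h.1 a b hab hb
    rwa [R_lt p (by omega : a < m), R_lt p hb] at this
  refine ⟨?_, hinc⟩
  by_contra hcon
  have hmm : p (m - 1) < p m := by
    have := hp.ne (show m - 1 ≤ m + 1 by omega) (show m ≤ m + 1 by omega) (by omega)
    omega
  rcases R_last m p with ⟨ht, h1⟩ | ⟨ht, h1⟩
  · have := h.2 (m - 1) (by omega)
    rw [h1, R_lt p (by omega : m - 1 < m)] at this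
    omega
  · have hlow : ∀ a, a < m → p (m + 1) < p a := fun a ha => by
      have := h.2 a ha
      rwa [h1, R_lt p ha] at this
    apply hn
    right; left
    refine ⟨fun a b hab hb => ?_, fun a ha => ?_⟩
    · rcases Nat.lt_or_ge b m with h2 | h2
      · exact hinc a b hab h2
      · obtain rfl : b = m := by omega
        rcases Nat.lt_or_ge a (b - 1) with h3 | h3
        · have := hinc a (b - 1) h3 (by omega); omega
        · obtain rfl : a = b - 1 := by omega
          exact hmm
    · rcases Nat.lt_or_ge a m with h2 | h2
      · exact hlow a h2
      · obtain rfl : a = m := by omega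
        have := hlow (a - 1) (by omega)
        omega

theorem right_shape_D (hp : Inj (m + 1) p) (hc : Con (m + 1) p) (hm : 2 ≤ m)
    (hn : ¬ IsLoop (m + 1) p) (h : IsD m (R m p)) :
    (p m < p (m + 1) ∧ ∀ a b, a < b → b ≤ m → p b < p a) ∨
    (p (m + 1) < p (m - 1) ∧ p 0 < p m ∧ ∀ a b, a < b → b < m → p b < p a) := by
  have h1 := left_shape_D hp.rc hc.rc hm (fun h => hn (isLoop_rc_iff.1 h)) (h.rc.eqv (L_rc p).symm)
  unfold rc at h1
  rw [show m + 1 - 0 = m + 1 by omega, show m + 1 - 1 = m by omega, show m + 1 - 2 = m - 1 by omega,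
    show m + 1 - (m + 1) = 0 by omega] at h1
  rcases h1 with ⟨h1, h2⟩ | ⟨h1, h2, h3⟩
  · refine Or.inl ⟨by omega, fun a b hab hb => ?_⟩
    have := h2 (m + 1 - b) (m + 1 - a) (by omega) (by omega) (by omega)
    rw [show m + 1 - (m + 1 - b) = b by omega, show m + 1 - (m + 1 - a) = a by omega] at this
    omega
  · refine Or.inr ⟨by omega, by omega, fun a b hab hb => ?_⟩
    have := h3 (m + 1 - b) (m + 1 - a) (by omega) (by omega) (by omega)
    rw [show m + 1 - (m + 1 - b) = b by omega, show m + 1 - (m + 1 - a) = a by omega] at this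
    omega

/-- A member without loop children is incompatible with a member having a left and one having a
right loop child, when its own children sit on the opposite sides. -/
theorem left_right_core (hm : 6 ≤ m) {TL TR : (ℕ → ℤ) → Prop}
    {X Y : ℕ → ℤ} (eTL : ∀ {v w}, Eqv m v w → TL v → TL w) (eTR : ∀ {v w}, Eqv m v w → TR v → TR w)
    (locL : ∀ {v w : ℕ → ℤ}, v 0 = w 0 → v 1 = w 1 → v 2 = w 2 → TL v → TL w)
    (locR : ∀ {v w : ℕ → ℤ}, v (m - 2) = w (m - 2) → v (m - 1) = w (m - 1) → v m = w m → TR v → TR w)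
    (hp : Mem m T p) (hq : Mem m T q) (hr : Mem m T r) (lp : IsLoop m (L m p))
    (lq : IsLoop m (R m q)) (hcl : ∀ w, T w → Eqv m w x ∨ Eqv m w X ∨ Eqv m w Y)
    (nLx : ¬ TL x) (nRx : ¬ TR x) (nLY : ¬ TL Y) (nRX : ¬ TR X)
    (tp : ∀ a, 2 ≤ a → a ≤ m + 1 → TL (del p a)) (tq : ∀ a, a + 2 ≤ m → TR (del q a))
    (hL : Eqv m (L m r) Y) (hR : Eqv m (R m r) X) : False := by
  -- `TL` is a feature of the left end that only the class `X` has, and `TR` one of the right end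
  -- that only `Y` has. The aim is a child of `r` with both features.
  have clX : ∀ w, T w → TL w → Eqv m w X := fun w hw ht => by
    rcases hcl w hw with h | h | h
    · exact absurd (eTL h ht) nLx
    · exact h
    · exact absurd (eTL h ht) nLY
  have clY : ∀ w, T w → TR w → Eqv m w Y := fun w hw ht => by
    rcases hcl w hw with h | h | h
    · exact absurd (eTR h ht) nRx
    · exact absurd (eTR h ht) nRX
    · exact h
  have htp : m ≤ tR m p := by rcases tR_cases m p with h | h <;> omega
  have htr : m ≤ tR m r := by rcases tR_cases m r with h | h <;> omega
  have hsp := sL_le m p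
  have hsq := sL_le m q
  have hRp := clX _ hp.T_R (tp _ (by omega) (tR_le m p))
  have hLq := clY _ hq.T_L (tq _ (by omega))
  -- If the removed entry separated positions 3 and 4, the bond at 2 would be intact. Its deletion
  -- has the feature `TL`, like the right child, so the two deletions agree; but then no outer entry
  -- separates 3 from 4.
  have bp : Bond (m + 1) p 3 := by
    by_contra hb
    have hb2 := (left_near (by omega) hp.inj lp (b := 2) (b' := 3) le_rfl (by omega)
      (by omega)).resolve_right hb
    unfold Bond at hb
    push Not at hb
    obtain ⟨k, hk, h1, h2, h3⟩ := hb
    have hk' : k = sL m p := by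
      by_contra hne
      have := left_bond lp (b := 3) (by omega) (by omega) hk h1 h2 hne
      omega
    simp only [Nat.reduceAdd] at h3
    have he : Eqv m (del p 2) (R m p) :=
      (clX _ (hp.T_bond (by omega) (by omega) hb2) (tp 2 le_rfl (by omega))).trans hRp.symm
    have := run_sep (tR_le m p) he hk (by omega) 3 4 (by omega) (by omega) (by omega) (by omega)
    omega
  have bq : Bond (m + 1) q 3 := by
    by_contra hb
    have hb2 := (right_near (by omega) hq.inj lq (b := 3) (b' := 4) (by omega) (by omega)
      (by omega)).resolve_left hb
    unfold Bond at hb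
    push Not at hb
    obtain ⟨k, hk, h1, h2, h3⟩ := hb
    have hk' : k = tR m q := by
      by_contra hne
      have := right_bond lq (b := 3) (by omega) (by omega) hk h1 h2 hne
      omega
    simp only [Nat.reduceAdd] at h3
    have htq : m ≤ tR m q := by rcases tR_cases m q with h | h <;> omega
    have he : Eqv m (L m q) (del q 4) :=
      hLq.trans (clY _ (hq.T_bond (by omega) (by omega) hb2) (tq 4 (by omega))).symm
    have := run_sep (by omega) he hk (by omega) 3 4 (by omega) (by omega) (by omega) (by omega)
    omega
  -- The left child of `r` agrees with that of `q` and its right child with that of `p`. Each entry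
  -- of `r` other than 3 and 4 is seen by one of the two.
  have br : Bond (m + 1) r 3 := by
    intro k hk h1 h2
    by_cases hkt : k = tR m r
    · have e := hL.trans hLq.symm
      have e1 := e (k - 1) (by omega) 2 (by omega)
      have e2 := e (k - 1) (by omega) 3 (by omega)
      rw [L_pos _ (by omega), L_pos _ (by omega), L_pos _ (by omega), L_pos _ (by omega),
        Nat.sub_add_cancel (by omega)] at e1 e2
      exact e1.trans ((bq k hk h1 h2).trans e2.symm)
    · have e := hR.trans hRp.symm
      obtain ⟨i, hi, he, hi'⟩ := exists_del_eq r hk (tR_le m r) hkt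
      change R m r i = _ at he
      have e1 := e i hi 3 (by omega)
      have e2 := e i hi 4 (by omega)
      rw [R_lt r (by omega : 3 < _), R_lt p (by omega : 3 < _), he] at e1
      rw [R_lt r (by omega : 4 < _), R_lt p (by omega : 4 < _), he] at e2
      refine e1.trans (Iff.trans ?_ e2.symm)
      rcases Nat.lt_or_ge i m with him | him
      · rw [R_lt p him]
        exact bp _ (by omega) (by omega) (by omega)
      · rw [show i = m by omega]
        rcases R_last m p with ⟨-, h⟩ | ⟨-, h⟩ <;> rw [h] <;>
          exact bp _ (by omega) (by omega) (by omega)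
  have tL : TL (del r 3) := by
    refine locL ?_ ?_ ?_ (eTL hR.symm (eTL hRp (tp _ (by omega) (tR_le m p))))
    · rw [R_lt r (by omega : 0 < m), del_lt (by omega)]
    · rw [R_lt r (by omega : 1 < m), del_lt (by omega)]
    · rw [R_lt r (by omega : 2 < m), del_lt (by omega)]
  have tR : TR (del r 3) := by
    refine locR ?_ ?_ ?_ (eTR hL.symm (eTR hLq (tq _ (by omega))))
    all_goals rw [L_pos _ (by omega), del_ge (by omega)]
  have hT3 := hr.T_bond (by omega) (by omega) br
  exact nLY (eTL (clY _ hT3 tR) tL)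

end Pattern

/-! ### One loop pattern among the children: preparations -/

namespace Pattern

variable {m : ℕ} {T : (ℕ → ℤ) → Prop} {col : (ℕ → ℤ) → Fin 3} {p q r s x y : ℕ → ℤ} {u : Prop}

/-- The shape of a member whose left child is increasing up to a final minimum. -/
def LeftS (m : ℕ) (p : ℕ → ℤ) : Prop :=
  p 1 < p 0 ∧
    ((∀ a b, 1 ≤ a → a < b → b < m → p a < p b) ∧ (∀ a, 1 ≤ a → a < m → p m < p a) ∨
    (p 1 < p m ∧ p m < p 0 ∧ p 0 < p 2 ∧ ∀ a b, 2 ≤ a → a < b → b < m → p a < p b))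

/-- The shape of a member whose right child is increasing up to a final minimum. -/
def RightS (m : ℕ) (p : ℕ → ℤ) : Prop :=
  p (m - 1) < p (m - 2) ∧ ∀ a b, a < b → b + 1 < m → p a < p b

/-- The shape of a member whose left child is decreasing. -/
def LeftD (m : ℕ) (p : ℕ → ℤ) : Prop :=
  (p 0 < p 1 ∧ ∀ a b, 1 ≤ a → a < b → b ≤ m → p b < p a) ∨
    (p 2 < p 0 ∧ p 1 < p m ∧ ∀ a b, 2 ≤ a → a < b → b ≤ m → p b < p a)

/-- The shape of a member whose right child is decreasing. -/
def RightD (m : ℕ) (p : ℕ → ℤ) : Prop :=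
  (p (m - 1) < p m ∧ ∀ a b, a < b → b < m → p b < p a) ∨
    (p m < p (m - 2) ∧ p 0 < p (m - 1) ∧ ∀ a b, a < b → b + 1 < m → p b < p a)

theorem Mem.leftS (hp : Mem m T p) (hm : 2 ≤ m) (hn : ¬ IsLoop (m + 1) p) (h : IsS m (L m p)) :
    LeftS (m + 1) p := by
  obtain ⟨h1, h2⟩ := left_shape_S hp.inj hp.con hm hn h
  exact ⟨h1, h2.imp (fun h => ⟨fun a b h1 h2 h3 => h.1 a b h1 h2 (by omega),
    fun a h1 h2 => h.2 a h1 (by omega)⟩)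
    fun h => ⟨h.1, h.2.1, h.2.2.1, fun a b h1 h2 h3 => h.2.2.2 a b h1 h2 (by omega)⟩⟩

theorem Mem.rightS (hp : Mem m T p) (hm : 2 ≤ m) (hn : ¬ IsLoop (m + 1) p) (h : IsS m (R m p)) :
    RightS (m + 1) p := by
  obtain ⟨h1, h2⟩ := right_shape_S hp.inj hm hn h
  exact ⟨h1, fun a b h1 h3 => h2 a b h1 (by omega)⟩

theorem Mem.rightD (hp : Mem m T p) (hm : 2 ≤ m) (hn : ¬ IsLoop (m + 1) p) (h : IsD m (R m p)) :
    RightD (m + 1) p :=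
  (right_shape_D hp.inj hp.con hm hn h).imp
    (fun h => ⟨h.1, fun a b h1 h2 => h.2 a b h1 (by omega)⟩)
    fun h => ⟨h.1, h.2.1, fun a b h1 h2 => h.2.2 a b h1 (by omega)⟩

theorem LeftS.eqv (hm : 2 ≤ m) (h : LeftS m p) (he : Eqv m p q) : LeftS m q :=
  ⟨(he 1 (by omega) 0 (by omega)).1 h.1, h.2.imp
    (fun h => ⟨fun a b h1 h2 h3 => (he a (by omega) b (by omega)).1 (h.1 a b h1 h2 h3),
      fun a h1 h2 => (he m (by omega) a (by omega)).1 (h.2 a h1 h2)⟩)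
    fun h => ⟨(he 1 (by omega) m (by omega)).1 h.1, (he m (by omega) 0 (by omega)).1 h.2.1,
      (he 0 (by omega) 2 (by omega)).1 h.2.2.1,
      fun a b h1 h2 h3 => (he a (by omega) b (by omega)).1 (h.2.2.2 a b h1 h2 h3)⟩⟩

theorem RightS.eqv (h : RightS m p) (he : Eqv m p q) : RightS m q :=
  ⟨(he _ (by omega) _ (by omega)).1 h.1,
    fun a b h1 h2 => (he a (by omega) b (by omega)).1 (h.2 a b h1 h2)⟩

theorem LeftD.eqv (hm : 2 ≤ m) (h : LeftD m p) (he : Eqv m p q) : LeftD m q :=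
  h.imp (fun h => ⟨(he 0 (by omega) 1 (by omega)).1 h.1,
    fun a b h1 h2 h3 => (he b (by omega) a (by omega)).1 (h.2 a b h1 h2 h3)⟩)
    fun h => ⟨(he 2 (by omega) 0 (by omega)).1 h.1, (he 1 (by omega) m (by omega)).1 h.2.1,
      fun a b h1 h2 h3 => (he b (by omega) a (by omega)).1 (h.2.2 a b h1 h2 h3)⟩

/-- The shapes survive inner deletions. By `adj_pair_children`, two members of one shape then pass
it on to all children other than the loop pattern. -/
theorem LeftS.del (h : LeftS (m + 1) p) {b : ℕ} (hb : 2 ≤ b) (hbm : b < m) :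
    LeftS m (del p b) := by
  refine ⟨by rw [del_lt (by omega), del_lt (by omega)]; exact h.1, h.2.imp (fun h => ⟨?_, ?_⟩)
    fun h => ⟨?_, ?_, ?_, ?_⟩⟩
  · intro i j h1 h2 h3
    unfold Pattern.del
    split_ifs <;> exact h.1 _ _ (by omega) (by omega) (by omega)
  · intro i h1 h2
    rw [del_ge (by omega)]
    unfold Pattern.del
    split_ifs <;> exact h.2 _ (by omega) (by omega)
  · rw [del_lt (by omega), del_ge (by omega)]; exact h.1
  · rw [del_ge (by omega : b ≤ m), del_lt (by omega : 0 < b)]; exact h.2.1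
  · rw [del_lt (by omega)]
    unfold Pattern.del
    split_ifs
    · exact h.2.2.1
    · exact h.2.2.1.trans (h.2.2.2 2 3 le_rfl (by omega) (by omega))
  · intro i j h1 h2 h3
    unfold Pattern.del
    split_ifs <;> exact h.2.2.2 _ _ (by omega) (by omega) (by omega)

theorem RightS.del (h : RightS (m + 1) p) {b : ℕ} (hbm : b + 2 ≤ m) :
    RightS m (del p b) := by
  refine ⟨?_, fun i j h1 h2 => ?_⟩
  · rw [del_ge (by omega), del_ge (by omega), show m - 1 + 1 = m by omega,
      show m - 2 + 1 = m - 1 by omega]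
    exact h.1
  · unfold Pattern.del
    split_ifs <;> exact h.2 _ _ (by omega) (by omega)

theorem LeftD.del (h : LeftD (m + 1) p) {b : ℕ} (hb : 2 ≤ b) (hbm : b < m) :
    LeftD m (del p b) := by
  refine h.imp (fun h => ⟨?_, ?_⟩) fun h => ⟨?_, ?_, ?_⟩
  · rw [del_lt (by omega), del_lt (by omega)]; exact h.1
  · intro i j h1 h2 h3
    unfold Pattern.del
    split_ifs <;> exact h.2 _ _ (by omega) (by omega) (by omega)
  · rw [del_lt (by omega : 0 < b)]
    unfold Pattern.del
    split_ifs
    · exact h.1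
    · exact (h.2.2 2 3 le_rfl (by omega) (by omega)).trans h.1
  · rw [del_lt (by omega), del_ge (by omega)]; exact h.2.1
  · intro i j h1 h2 h3
    unfold Pattern.del
    split_ifs <;> exact h.2.2 _ _ (by omega) (by omega) (by omega)

theorem RightD.dec (h : RightD (m + 1) p) {i j : ℕ} (hij : i < j) (hj : j < m) : p j < p i := by
  rcases h with h | h
  · exact h.2 i j hij (by omega)
  · exact h.2.2 i j hij (by omega)

/-- Each predicate fails at most once among four places, so three predicates leave a place where all
hold. -/
theorem three_near {P Q S : ℕ → Prop} (c : ℕ) 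
    (hP : ∀ b b', c ≤ b → b < b' → b' ≤ c + 3 → P b ∨ P b')
    (hQ : ∀ b b', c ≤ b → b < b' → b' ≤ c + 3 → Q b ∨ Q b')
    (hS : ∀ b b', c ≤ b → b < b' → b' ≤ c + 3 → S b ∨ S b') :
    ∃ b, c ≤ b ∧ b ≤ c + 3 ∧ P b ∧ Q b ∧ S b := by
  by_contra hcon
  push Not at hcon
  have key : ∀ {P Q S : ℕ → Prop}, (∀ b b', c ≤ b → b < b' → b' ≤ c + 3 → P b ∨ P b') →
      ∀ b b', c ≤ b → b ≤ c + 3 → c ≤ b' → b' ≤ c + 3 → ¬ P b → ¬ P b' → b = b' := by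
    intro P _ _ h b b' h1 h2 h3 h4 h5 h6
    by_contra hne
    rcases lt_or_gt_of_ne hne with h7 | h7
    · have := h b b' h1 h7 h4; tauto
    · have := h b' b h3 h7 h2; tauto
  have each : ∀ b, c ≤ b → b ≤ c + 3 → ¬ P b ∨ ¬ Q b ∨ ¬ S b := fun b h1 h2 => by
    have := hcon b h1 h2; tauto
  rcases each c le_rfl (by omega) with h0 | h0 | h0 <;>
  rcases each (c + 1) (by omega) (by omega) with h1 | h1 | h1 <;>
  rcases each (c + 2) (by omega) (by omega) with h2 | h2 | h2 <;>
  rcases each (c + 3) (by omega) (by omega) with h3 | h3 | h3 <;>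
  first
    | (have := key (Q := P) (S := P) ‹_› _ _ (by omega) (by omega) (by omega) (by omega) h0 h1; omega)
    | (have := key (Q := P) (S := P) ‹_› _ _ (by omega) (by omega) (by omega) (by omega) h0 h2; omega)
    | (have := key (Q := P) (S := P) ‹_› _ _ (by omega) (by omega) (by omega) (by omega) h0 h3; omega)
    | (have := key (Q := P) (S := P) ‹_› _ _ (by omega) (by omega) (by omega) (by omega) h1 h2; omega)
    | (have := key (Q := P) (S := P) ‹_› _ _ (by omega) (by omega) (by omega) (by omega) h1 h3; omega)
    | (have := key (Q := P) (S := P) ‹_› _ _ (by omega) (by omega) (by omega) (by omega) h2 h3; omega)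

/-- The three patterns and the adjoined longer loop pattern share a bond, found among the positions
2 to 5, and its direction. -/
theorem three_left (hT : Ctx m T col) (hm : 6 ≤ m) (hx : T x) (lx : IsLoop m x)
    (hp : Mem m T p) (hq : Mem m T q) (hr : Mem m T r) (np : ¬ IsLoop (m + 1) p)
    (nq : ¬ IsLoop (m + 1) q) (nr : ¬ IsLoop (m + 1) r) (hpq : ¬ Eqv (m + 1) p q)
    (hpr : ¬ Eqv (m + 1) p r) (hqr : ¬ Eqv (m + 1) q r) (ep : Eqv m (L m p) x)
    (eq : Eqv m (L m q) x) (er : Eqv m (L m r) x) : False := by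
  obtain ⟨f, mf, lf, af, bf, cf⟩ := exists_loop_mem hT hm hx lx
  have nr' : ∀ {p}, Mem m T p → Eqv m (L m p) x → ∀ b b', 2 ≤ b → b < b' → b' ≤ 2 + 3 →
      Bond (m + 1) p b ∨ Bond (m + 1) p b' := fun hp h b b' h1 h2 h3 =>
    left_near (by omega) hp.inj (lx.eqv h.symm) h1 h2 (by omega)
  obtain ⟨b, hb, hbm, bp, bq, br⟩ := three_near 2 (nr' hp ep) (nr' hq eq) (nr' hr er)
  have dr : ∀ {p}, Eqv m (L m p) x → (p b < p (b + 1) ↔ x 2 < x 3) := fun h =>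
    (left_dir (by omega) (lx.eqv h.symm) hb (by omega)).trans (h 2 (by omega) 3 (by omega))
  refine four_bonds hT (by omega) mf hp hq hr (not_eqv_loop lf np) (not_eqv_loop lf nq)
    (not_eqv_loop lf nr) hpq hpr hqr (by omega) (bf b (by omega) (by omega)) bp bq br ?_ (dr ep)
    (dr eq) (dr er)
  exact (lf.dir (by omega) (by omega) (by omega)).trans (af.dir 2 le_rfl (by omega))

theorem three_right (hT : Ctx m T col) (hm : 6 ≤ m) (hx : T x) (lx : IsLoop m x)
    (hp : Mem m T p) (hq : Mem m T q) (hr : Mem m T r) (np : ¬ IsLoop (m + 1) p)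
    (nq : ¬ IsLoop (m + 1) q) (nr : ¬ IsLoop (m + 1) r) (hpq : ¬ Eqv (m + 1) p q)
    (hpr : ¬ Eqv (m + 1) p r) (hqr : ¬ Eqv (m + 1) q r) (ep : Eqv m (R m p) x)
    (eq : Eqv m (R m q) x) (er : Eqv m (R m r) x) : False := by
  refine three_left (x := rc m x) hT.rc hm (hT.cl hx (rc_rc m x).symm) lx.rc (hp.rc hT) (hq.rc hT)
    (hr.rc hT) (mt isLoop_rc_iff.1 np) (mt isLoop_rc_iff.1 nq) (mt isLoop_rc_iff.1 nr)
    (mt eqv_rc_iff.1 hpq) (mt eqv_rc_iff.1 hpr) (mt eqv_rc_iff.1 hqr) ((L_rc p).trans ep.rc)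
    ((L_rc q).trans eq.rc) ((L_rc r).trans er.rc)

/-- Two members with a loop child account for all children. -/
theorem adj_pair_children (hT : Ctx m T col) (hm : 6 ≤ m) (hx : T x) (lx : IsLoop m x)
    (hp : Mem m T p) (hq : Mem m T q) (np : ¬ IsLoop (m + 1) p) (nq : ¬ IsLoop (m + 1) q)
    (hpq : ¬ Eqv (m + 1) p q) (ap : Adj m p (x 2 < x 3)) (aq : Adj m q (x 2 < x 3)) :
    ∃ b, 2 ≤ b ∧ b + 2 ≤ m ∧ ∀ w, T w → Eqv m w x ∨ Eqv m w (del p b) ∨ Eqv m w (del q b) := by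
  obtain ⟨f, mf, lf, af, bf, cf⟩ := exists_loop_mem hT hm hx lx
  obtain ⟨b, hb, hbm, bp, bq⟩ := exists_common_bond hm ap aq
  have bf' := bf b (by omega) (by omega)
  refine ⟨b, hb, hbm, fun w hw => ?_⟩
  rcases three_bonds hT (by omega) mf hp hq (not_eqv_loop lf np) (not_eqv_loop lf nq) hpq
    (by omega) bf' bp bq (af.dir b hb hbm) (ap.dir b hb hbm) (aq.dir b hb hbm) hw with h | h
  · exact Or.inl (h.trans (cf b (by omega) (bf'.con mf.inj mf.con (by omega) (by omega))))
  · exact Or.inr h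

theorem adj_of_left (hm : 6 ≤ m) (lx : IsLoop m x) (hp : Mem m T p) (h : Eqv m (L m p) x) :
    Adj m p (x 2 < x 3) :=
  (adj_left (by omega) hp.inj (lx.eqv h.symm)).congr (h 2 (by omega) 3 (by omega))

theorem adj_of_right (hm : 6 ≤ m) (lx : IsLoop m x) (hp : Mem m T p) (h : Eqv m (R m p) x) :
    Adj m p (x 2 < x 3) :=
  (adj_right (by omega) hp.inj (lx.eqv h.symm)).congr (h 2 (by omega) 3 (by omega))

/-- Two members without loop children are antiparallel. -/
theorem nonadj_pair (hT : Ctx m T col) (hm : 6 ≤ m) (hx : T x)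
    (hone : ∀ w, T w → IsLoop m w → Eqv m w x)
    (hp : Mem m T p) (hq : Mem m T q) (np : ¬ IsLoop (m + 1) p) (nq : ¬ IsLoop (m + 1) q)
    (hpq : ¬ Eqv (m + 1) p q) (p1 : ¬ Eqv m (L m p) x) (p2 : ¬ Eqv m (R m p) x)
    (q1 : ¬ Eqv m (L m q) x) (q2 : ¬ Eqv m (R m q) x) :
    Eqv m (L m p) (R m q) ∧ Eqv m (L m q) (R m p) := by
  have hpn : ¬ Eqv m (L m p) (R m p) := fun he => np (loop_of_L_R (by omega) hp.inj hp.con he)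
  have hqn : ¬ Eqv m (L m q) (R m q) := fun he => nq (loop_of_L_R (by omega) hq.inj hq.con he)
  have cl := fun w hw => hT.eqv_of_three (w := w) hx hp.T_L hp.T_R hw (mt Eqv.symm p1)
    (mt Eqv.symm p2) hpn
  have h1 := (cl _ hq.T_L).resolve_left q1
  have h2 := (cl _ hq.T_R).resolve_left q2
  rcases h1 with h1 | h1 <;> rcases h2 with h2 | h2
  · exact absurd (h1.trans h2.symm) hqn
  · rcases parallel (by omega) hT hp hq hpq h1.symm h2.symm with h | h
    · exact absurd (hone _ hp.T_L h) p1
    · exact absurd (hone _ hp.T_R h) p2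
  · exact ⟨h2.symm, h1⟩
  · exact absurd (h1.trans h2.symm) hqn

/-- The two members without loop child form an opposite pair, so both alternate. The third member
has a monotone core, yet one of its children is a child of the pair. -/
theorem adj_nonadj_nonadj (hT : Ctx m T col) (hm : 6 ≤ m) (hx : T x) 
    (hone : ∀ w, T w → IsLoop m w → Eqv m w x)
    (hr : Mem m T r) (hp : Mem m T p) (hq : Mem m T q) (np : ¬ IsLoop (m + 1) p)
    (nq : ¬ IsLoop (m + 1) q)
    (hpq : ¬ Eqv (m + 1) p q) (p1 : ¬ Eqv m (L m p) x) (p2 : ¬ Eqv m (R m p) x)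
    (q1 : ¬ Eqv m (L m q) x) (q2 : ¬ Eqv m (R m q) x) (ar : Adj m r u)
    (hr' : ¬ Eqv m (L m r) x ∨ ¬ Eqv m (R m r) x) : False := by
  obtain ⟨h1, h2⟩ := nonadj_pair hT hm hx hone hp hq np nq hpq p1 p2 q1 q2
  have hpn : ¬ Eqv m (L m p) (R m p) := fun he => np (loop_of_L_R (by omega) hp.inj hp.con he)
  have cl := fun w hw => hT.eqv_of_three (w := w) hx hp.T_L hp.T_R hw (mt Eqv.symm p1)
    (mt Eqv.symm p2) hpn
  have nm1 : ¬ (p 1 < p 2 ↔ p 2 < p 3) := fun h => by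
    rcases antiparallel (by omega) hp.inj hq.inj hp.con hq.con h1 h2 h with h | h
    · exact p1 (hone _ hp.T_L h)
    · exact p2 (hone _ hp.T_R h)
  have nm2 : ¬ (q 1 < q 2 ↔ q 2 < q 3) := fun h => by
    rcases antiparallel (by omega) hq.inj hp.inj hq.con hp.con h2 h1 h with h | h
    · exact q1 (hone _ hq.T_L h)
    · exact q2 (hone _ hq.T_R h)
  obtain ⟨a1, a2⟩ := alternating h1 h2 nm1 nm2 2 (by omega) (by omega)
  have r1 := ar.dir 2 le_rfl (by omega)
  have r2 := ar.dir 3 (by omega) (by omega)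
  have fin : ∀ {s : ℕ → ℤ}, ¬ (s 2 < s 3 ↔ s 3 < s 4) → (r 2 < r 3 ↔ s 2 < s 3) →
      (r 3 < r 4 ↔ s 3 < s 4) → False := fun h h3 h4 =>
    h (h3.symm.trans (r1.trans (r2.symm.trans h4)))
  rcases hr' with h | h
  · rcases (cl _ hr.T_L).resolve_left h with h | h
    · exact fin a1 (left_agree h le_rfl (by omega) (by omega) (by omega))
        (left_agree h (by omega) (by omega) (by omega) (by omega))
    · have h := h.trans h2.symm
      exact fin a2 (left_agree h le_rfl (by omega) (by omega) (by omega))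
        (left_agree h (by omega) (by omega) (by omega) (by omega))
  · rcases (cl _ hr.T_R).resolve_left h with h | h
    · have h := h.trans h1
      exact fin a2 (right_agree h (by omega) (by omega)) (right_agree h (by omega) (by omega))
    · exact fin a1 (right_agree h (by omega) (by omega)) (right_agree h (by omega) (by omega))

end Pattern

/-! ### One loop pattern among the children: no three further members -/

namespace Pattern

variable {m : ℕ} {T : (ℕ → ℤ) → Prop} {col : (ℕ → ℤ) → Fin 3} {p q r s x y : ℕ → ℤ} {u : Prop}

/-- Three distinct members that are not loop patterns. -/
structure Triple (m : ℕ) (T : (ℕ → ℤ) → Prop) (p q r : ℕ → ℤ) : Prop where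
  hp : Mem m T p
  hq : Mem m T q
  hr : Mem m T r
  np : ¬ IsLoop (m + 1) p
  nq : ¬ IsLoop (m + 1) q
  nr : ¬ IsLoop (m + 1) r
  pq : ¬ Eqv (m + 1) p q
  pr : ¬ Eqv (m + 1) p r
  qr : ¬ Eqv (m + 1) q r

theorem Triple.swap (h : Triple m T p q r) : Triple m T q p r :=
  ⟨h.hq, h.hp, h.hr, h.nq, h.np, h.nr, mt Eqv.symm h.pq, h.qr, h.pr⟩

theorem Triple.swap' (h : Triple m T p q r) : Triple m T p r q :=
  ⟨h.hp, h.hr, h.hq, h.np, h.nr, h.nq, h.pr, h.pq, mt Eqv.symm h.qr⟩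

theorem Triple.rc (hT : Ctx m T col) (h : Triple m T p q r) :
    Triple m (fun x => T (rc m x)) (rc (m + 1) p) (rc (m + 1) q) (rc (m + 1) r) :=
  ⟨h.hp.rc hT, h.hq.rc hT, h.hr.rc hT, mt isLoop_rc_iff.1 h.np, mt isLoop_rc_iff.1 h.nq,
    mt isLoop_rc_iff.1 h.nr, mt eqv_rc_iff.1 h.pq, mt eqv_rc_iff.1 h.pr, mt eqv_rc_iff.1 h.qr⟩

/-- All children except `x` inherit the shape `LeftS`. The two children of `r` then make
incompatible demands on its first entries and on its cut. -/
theorem left_left_S (hT : Ctx m T col) (hm : 6 ≤ m) (hx : T x) (kx : IsS m x)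
    (h : Triple m T p q r) (ep : Eqv m (L m p) x) (eq : Eqv m (L m q) x) : False := by
  have lx : IsLoop m x := Or.inr (Or.inl kx)
  obtain ⟨b, hb, hbm, hcl⟩ := adj_pair_children hT hm hx lx h.hp h.hq h.np h.nq h.pq
    (adj_of_left hm lx h.hp ep) (adj_of_left hm lx h.hq eq)
  have cl : ∀ w, T w → ¬ Eqv m w x → LeftS m w := fun w hw hn => by
    rcases (hcl w hw).resolve_left hn with hh | hh
    · exact ((h.hp.leftS (by omega) h.np (kx.eqv ep.symm)).del hb (by omega)).eqv (by omega) hh.symm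
    · exact ((h.hq.leftS (by omega) h.nq (kx.eqv eq.symm)).del hb (by omega)).eqv (by omega) hh.symm
  by_cases er : Eqv m (L m r) x
  · exact three_left hT hm hx lx h.hp h.hq h.hr h.np h.nq h.nr h.pq h.pr h.qr ep eq er
  obtain ⟨l1, l2⟩ := cl _ h.hr.T_L er
  rw [L_pos r le_rfl] at l1
  simp only [Nat.reduceAdd] at l1
  have l0 := L_zero m r
  by_cases er' : Eqv m (R m r) x
  · have k := kx.eqv er'.symm
    have k1 := k.1 1 2 (by omega) (by omega)
    have k2 := k.1 0 2 (by omega) (by omega)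
    rw [R_lt r (by omega : 1 < m), R_lt r (by omega : 2 < m)] at k1
    rw [R_lt r (by omega : 0 < m), R_lt r (by omega : 2 < m)] at k2
    omega
  obtain ⟨r1, r2⟩ := cl _ h.hr.T_R er'
  rw [R_lt r (by omega : 0 < m), R_lt r (by omega : 1 < m)] at r1
  rcases r2 with ⟨r2, r3⟩ | ⟨r2, r3, r4, r5⟩
  · have r2 := r2 1 2 le_rfl (by omega) (by omega)
    rw [R_lt r (by omega : 1 < m), R_lt r (by omega : 2 < m)] at r2
    have r3 := r3 1 le_rfl (by omega)
    rw [R_lt r (by omega : 1 < m)] at r3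
    rcases sL_cases m r with ⟨s0, -⟩ | ⟨s1, hc⟩
    · omega
    · obtain ⟨k, hk, hkm, hcut, htop, -⟩ := cut_first h.hr.inj h.hr.con hc
      have hkm' : k = m := by
        by_contra hne
        have c1 := hcut 1 m le_rfl hk (by omega) (by omega)
        have c2 := hcut 1 (m + 1) le_rfl hk (by omega) (by omega)
        rcases R_last m r with ⟨-, e⟩ | ⟨-, e⟩ <;> omega
      subst hkm'
      have c2 := hcut 2 (k + 1) (by omega) (by omega) (by omega) le_rfl
      have c3 := htop 3 (by omega) (by omega)
      rcases l2 with ⟨-, l2⟩ | ⟨-, -, l2, -⟩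
      · have := l2 1 le_rfl (by omega)
        rw [L_pos r (by omega : 1 ≤ k), L_pos r le_rfl] at this
        simp only [Nat.reduceAdd] at this
        omega
      · rw [L_pos r (by omega : 1 ≤ 2)] at l2
        simp only [Nat.reduceAdd] at l2
        omega
  · rw [R_lt r (by omega : 0 < m), R_lt r (by omega : 2 < m)] at r4
    omega

/-- The right child of `r` demands a descent from `m - 2` to `m - 1`, while the left child demands
an ascent there. -/
theorem right_right_S (hT : Ctx m T col) (hm : 6 ≤ m) (hx : T x) (kx : IsS m x)
    (h : Triple m T p q r) (ep : Eqv m (R m p) x) (eq : Eqv m (R m q) x) : False := by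
  have lx : IsLoop m x := Or.inr (Or.inl kx)
  obtain ⟨b, hb, hbm, hcl⟩ := adj_pair_children hT hm hx lx h.hp h.hq h.np h.nq h.pq
    (adj_of_right hm lx h.hp ep) (adj_of_right hm lx h.hq eq)
  have cl : ∀ w, T w → ¬ Eqv m w x → RightS m w := fun w hw hn => by
    rcases (hcl w hw).resolve_left hn with hh | hh
    · exact ((h.hp.rightS (by omega) h.np (kx.eqv ep.symm)).del hbm).eqv hh.symm
    · exact ((h.hq.rightS (by omega) h.nq (kx.eqv eq.symm)).del hbm).eqv hh.symm
  by_cases er : Eqv m (R m r) x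
  · exact three_right hT hm hx lx h.hp h.hq h.hr h.np h.nq h.nr h.pq h.pr h.qr ep eq er
  have r1 := (cl _ h.hr.T_R er).1
  rw [R_lt r (by omega : m - 1 < m), R_lt r (by omega : m - 2 < m)] at r1
  have l1 : L m r (m - 3) < L m r (m - 2) := by
    by_cases er' : Eqv m (L m r) x
    · exact (kx.eqv er'.symm).1 _ _ (by omega) (by omega)
    · exact (cl _ h.hr.T_L er').2 _ _ (by omega) (by omega)
  rw [L_pos r (by omega), L_pos r (by omega), show m - 3 + 1 = m - 2 by omega,
    show m - 2 + 1 = m - 1 by omega] at l1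
  omega

theorem left_left_D (hT : Ctx m T col) (hm : 6 ≤ m) (hx : T x) (kx : IsD m x)
    (h : Triple m T p q r) (ep : Eqv m (L m p) x) (eq : Eqv m (L m q) x) : False := by
  have lx : IsLoop m x := Or.inl kx
  obtain ⟨b, hb, hbm, hcl⟩ := adj_pair_children hT hm hx lx h.hp h.hq h.np h.nq h.pq
    (adj_of_left hm lx h.hp ep) (adj_of_left hm lx h.hq eq)
  have cl : ∀ w, T w → ¬ Eqv m w x → LeftD m w := fun w hw hn => by
    rcases (hcl w hw).resolve_left hn with hh | hh
    · exact (LeftD.del (left_shape_D h.hp.inj h.hp.con (by omega) h.np (kx.eqv ep.symm)) hb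
        (by omega)).eqv (by omega) hh.symm
    · exact (LeftD.del (left_shape_D h.hq.inj h.hq.con (by omega) h.nq (kx.eqv eq.symm)) hb
        (by omega)).eqv (by omega) hh.symm
  by_cases er : Eqv m (L m r) x
  · exact three_left hT hm hx lx h.hp h.hq h.hr h.np h.nq h.nr h.pq h.pr h.qr ep eq er
  have hL := cl _ h.hr.T_L er
  have l0 := L_zero m r
  have e1 : L m r 1 = r 2 := L_pos r le_rfl
  have e2 : L m r 2 = r 3 := L_pos r (by omega)
  have em : L m r m = r (m + 1) := L_pos r (by omega)
  have f0 : R m r 0 = r 0 := R_lt r (by omega)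
  have f1 : R m r 1 = r 1 := R_lt r (by omega)
  have f2 : R m r 2 = r 2 := R_lt r (by omega)
  have f3 : R m r 3 = r 3 := R_lt r (by omega)
  by_cases er' : Eqv m (R m r) x
  · have k := kx.eqv er'.symm
    have k0 := k 0 2 (by omega) (by omega)
    have k1 := k 1 2 (by omega) (by omega)
    have k2 := k 2 3 (by omega) (by omega)
    rcases hL with ⟨hL, -⟩ | ⟨-, hL, hL'⟩
    · omega
    · have := hL' 2 m le_rfl (by omega) le_rfl
      omega
  have hR := cl _ h.hr.T_R er'
  rcases hR with ⟨g1, g2⟩ | ⟨g1, g2, g3⟩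
  · have g12 := g2 1 2 (by omega) (by omega) (by omega)
    have g23 := g2 2 3 (by omega) (by omega) (by omega)
    rcases sL_cases m r with ⟨s0, -⟩ | ⟨s1, hc⟩
    · rcases hL with ⟨hL, -⟩ | ⟨-, hL, hL'⟩
      · omega
      · have := hL' 2 m le_rfl (by omega) le_rfl
        omega
    · obtain ⟨k, hk, -, -, htop, -⟩ := cut_first h.hr.inj h.hr.con hc
      have := htop 1 le_rfl hk
      omega
  · have g23 := g3 2 3 (by omega) (by omega) (by omega)
    rcases hL with ⟨hL, hL'⟩ | ⟨-, hL, hL'⟩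
    swap
    · have := hL' 2 m le_rfl (by omega) le_rfl
      omega
    rcases sL_cases m r with ⟨s0, hc⟩ | ⟨s1, hc⟩
    swap
    · omega
    have dec : ∀ a b, 2 ≤ a → a < b → b ≤ m + 1 → r b < r a := fun a b h1 h2 h3 => by
      have := hL' (a - 1) (b - 1) (by omega) (by omega) (by omega)
      rwa [L_pos r (by omega), L_pos r (by omega), Nat.sub_add_cancel (by omega),
        Nat.sub_add_cancel (by omega)] at this
    have low : r 1 < r (m + 1) := by
      rcases R_last m r with ⟨-, e⟩ | ⟨-, e⟩
      swap
      · omega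
      -- The deletion at this bond is neither `x` nor the left child, so it is the right child. This
      -- carries the bound on entry 1 from the end of the right child to the last entry of `r`;
      -- entry 1 then becomes the minimum and the first entry of the left child, which is
      -- impossible.
      have b3 : Bond (m + 1) r 3 := by
        intro k hk h1 h2
        have d3 := dec 3 m (by omega) (by omega) (by omega)
        have d4 := dec 4 m (by omega) (by omega) (by omega)
        have d34 := dec 3 4 (by omega) (by omega) (by omega)
        simp only [Nat.reduceAdd] at h2 ⊢
        rcases Nat.lt_or_ge k 3 with hk3 | hk3
        · interval_cases k
          · omega
          · omega
          · have := dec 2 4 (by omega) (by omega) (by omega)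
            omega
        · have := dec 3 k (by omega) (by omega) (by omega)
          have := dec 4 k (by omega) (by omega) (by omega)
          omega
      have hrn : ¬ Eqv m (L m r) (R m r) := fun he =>
        h.nr (loop_of_L_R (by omega) h.hr.inj h.hr.con he)
      have i0 : del r 3 0 = r 0 := del_lt (by omega)
      have i1 : del r 3 1 = r 1 := del_lt (by omega)
      have i2 : del r 3 2 = r 2 := del_lt (by omega)
      have im : del r 3 m = r (m + 1) := del_ge (by omega)
      rcases hT.eqv_of_three hx h.hr.T_L h.hr.T_R (h.hr.T_bond (by omega) (by omega) b3)
        (mt Eqv.symm er) (mt Eqv.symm er') hrn with hh | hh | hh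
      · have := (kx.eqv hh.symm) 1 2 (by omega) (by omega)
        omega
      · have := (hh 0 (by omega) 1 (by omega)).2 hL
        omega
      · have := (hh 1 (by omega) m (by omega)).2 g2
        omega
    refine absurd hc (not_con_of_first (by omega) fun j h1 h2 => ?_)
    rw [del_ge (by omega), del_ge (by omega)]
    change r 1 < _
    rcases Nat.lt_or_ge j m with hj | hj
    · have := dec (j + 1) (m + 1) (by omega) (by omega) le_rfl
      omega
    · rwa [show j = m by omega]

/-- Configuration of a left, a right and an isolated member. -/
theorem left_right (hT : Ctx m T col) (hm : 6 ≤ m) (hx : T x) (kx : IsS m x ∨ IsD m x)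
    (h : Triple m T p q r) (ep : Eqv m (L m p) x) (eq : Eqv m (R m q) x) 
    (h1 : ¬ Eqv m (L m r) x) (h2 : ¬ Eqv m (R m r) x) : False := by
  have lx : IsLoop m x := by
    rcases kx with k | k
    · exact Or.inr (Or.inl k)
    · exact Or.inl k
  have hrn : ¬ Eqv m (L m r) (R m r) := fun he =>
    h.nr (loop_of_L_R (by omega) h.hr.inj h.hr.con he)
  obtain ⟨b, hb, hbm, hcl⟩ := adj_pair_children hT hm hx lx h.hp h.hq h.np h.nq h.pq
    (adj_of_left hm lx h.hp ep) (adj_of_right hm lx h.hq eq)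
  have l0 := L_zero m r
  have e1 : L m r 1 = r 2 := L_pos r le_rfl
  have e2 : L m r 2 = r 3 := L_pos r (by omega)
  have f0 : R m r 0 = r 0 := R_lt r (by omega)
  have f1 : R m r 1 = r 1 := R_lt r (by omega)
  have f2 : R m r 2 = r 2 := R_lt r (by omega)
  have f3 : R m r 3 = r 3 := R_lt r (by omega)
  have lp := lx.eqv ep.symm
  have lq := lx.eqv eq.symm
  -- The children of `r` are the two classes other than `x`, in either order. In the straight order
  -- the shapes contradict each other on overlapping entries; the crossed order is
  -- `left_right_core`, with features that detect a deviation from the loop pattern at the left or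
  -- the right end.
  have cases : (Eqv m (L m r) (del p b) ∧ Eqv m (R m r) (del q b)) ∨
      (Eqv m (L m r) (del q b) ∧ Eqv m (R m r) (del p b)) := by
    rcases (hcl _ h.hr.T_L).resolve_left h1 with a | a <;>
    rcases (hcl _ h.hr.T_R).resolve_left h2 with c | c
    · exact absurd (a.trans c.symm) hrn
    · exact Or.inl ⟨a, c⟩
    · exact Or.inr ⟨a, c⟩
    · exact absurd (a.trans c.symm) hrn
  rcases kx with kx | kx
  · have sp := h.hp.leftS (by omega) h.np (kx.eqv ep.symm)
    have sq := h.hq.rightS (by omega) h.nq (kx.eqv eq.symm)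
    have sp' := sp.del hb (by omega)
    have sq' := sq.del hbm
    rcases cases with ⟨a, c⟩ | ⟨a, c⟩
    · have := (sp'.eqv (by omega) a.symm).1
      have := (sq'.eqv c.symm).2 0 1 (by omega) (by omega)
      have := (sq'.eqv c.symm).2 1 2 (by omega) (by omega)
      omega
    · refine left_right_core hm (TL := fun w => w 1 < w 0) (TR := fun w => w (m - 1) < w (m - 2))
        (fun he => (he _ (by omega) _ (by omega)).1) (fun he => (he _ (by omega) _ (by omega)).1)
        (fun a b _ => by rw [a, b]; exact id) (fun a b _ => by rw [a, b]; exact id)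
        h.hp h.hq h.hr lp lq hcl ?_ ?_ ?_ ?_ ?_ ?_ a c
      · have := kx.1 0 1 (by omega) (by omega); omega
      · have := kx.1 (m - 2) (m - 1) (by omega) (by omega); omega
      · have := sq'.2 0 1 (by omega) (by omega); omega
      · have : del p b (m - 2) < del p b (m - 1) := by
          rcases sp'.2 with ⟨k, -⟩ | ⟨-, -, -, k⟩ <;> exact k _ _ (by omega) (by omega) (by omega)
        omega
      · intro a h3 h4
        rw [del_lt (by omega), del_lt (by omega)]
        exact sp.1
      · intro a h3
        rw [del_ge (by omega), del_ge (by omega), show m - 1 + 1 = m by omega,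
          show m - 2 + 1 = m - 1 by omega]
        exact sq.1
  · have sp : LeftD (m + 1) p :=
      left_shape_D h.hp.inj h.hp.con (by omega) h.np (kx.eqv ep.symm)
    have sq := h.hq.rightD (by omega) h.nq (kx.eqv eq.symm)
    have sp' := sp.del hb (by omega)
    have hY : ∀ i j, i < j → j + 2 ≤ m → del q b j < del q b i := fun i j h3 h4 => by
      unfold del
      split_ifs <;> exact sq.dec (by omega) (by omega)
    rcases cases with ⟨a, c⟩ | ⟨a, c⟩
    · have d : ∀ i j, i < j → j + 2 ≤ m → R m r j < R m r i := fun i j h3 h4 =>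
        (c j (by omega) i (by omega)).2 (hY i j h3 h4)
      have d1 := d 0 2 (by omega) (by omega)
      have d2 := d 1 2 (by omega) (by omega)
      have d3 : r 4 < r 2 := by
        have := d 2 4 (by omega) (by omega)
        rwa [R_lt r (by omega : 4 < m), R_lt r (by omega : 2 < m)] at this
      have e3 : L m r 3 = r 4 := L_pos r (by omega)
      rcases sp'.eqv (by omega) a.symm with ⟨k, -⟩ | ⟨-, k, k'⟩
      · omega
      · have := k' 3 m (by omega) (by omega) (by omega)
        omega
    · refine left_right_core hm (TL := fun w => w 0 < w 1 ∨ w 1 < w 2)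
        (TR := fun w => w (m - 1) < w m ∨ w (m - 2) < w (m - 1))
        (fun he => Or.imp (he _ (by omega) _ (by omega)).1 (he _ (by omega) _ (by omega)).1)
        (fun he => Or.imp (he _ (by omega) _ (by omega)).1 (he _ (by omega) _ (by omega)).1)
        (fun a b c => by rw [a, b, c]; exact id) (fun a b c => by rw [a, b, c]; exact id)
        h.hp h.hq h.hr lp lq hcl ?_ ?_ ?_ ?_ ?_ ?_ a c
      · have := kx 0 1 (by omega) (by omega)
        have := kx 1 2 (by omega) (by omega)
        omega
      · have := kx (m - 2) (m - 1) (by omega) (by omega)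
        have := kx (m - 1) m (by omega) (by omega)
        omega
      · have := hY 0 1 (by omega) (by omega)
        have := hY 1 2 (by omega) (by omega)
        omega
      · have d : ∀ i j, 2 ≤ i → i < j → j ≤ m → del p b j < del p b i := by
          rcases sp' with ⟨-, k⟩ | ⟨-, -, k⟩
          · exact fun i j h3 h4 h5 => k i j (by omega) h4 h5
          · exact k
        have := d (m - 2) (m - 1) (by omega) (by omega) (by omega)
        have := d (m - 1) m (by omega) (by omega) (by omega)
        omega
      · intro a h3 h4
        rw [del_lt (by omega : 0 < a), del_lt (by omega : 1 < a)]
        rcases sp with ⟨k, -⟩ | ⟨-, k, k'⟩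
        · exact Or.inl k
        · right
          unfold del
          split_ifs
          · have := k' 2 (m + 1) (by omega) (by omega) (by omega); omega
          · have := k' 3 (m + 1) (by omega) (by omega) (by omega)
            simp only [Nat.reduceAdd]
            omega
      · intro a h3
        rw [del_ge (by omega : a ≤ m - 1), del_ge (by omega : a ≤ m), del_ge (by omega : a ≤ m - 2),
          show m - 1 + 1 = m by omega, show m - 2 + 1 = m - 1 by omega]
        rcases sq with ⟨k, -⟩ | ⟨-, k, k'⟩
        · exact Or.inl k
        · have := k' 0 (m - 1) (by omega) (by omega)
          change q 0 < q m at k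
          omega

/-- The cases depend on which members have `x` as left or as right child. Two on the same side, or
one on each side, are excluded by shape. A single one is excluded because the other two would
alternate. If there are none, `p` and `r` are both opposite to `q`, hence parallel, and have a loop
child. -/
theorem one_loop_of (hT : Ctx m T col) (hm : 6 ≤ m) (hx : T x) (kx : IsS m x ∨ IsD m x)
    (hone : ∀ w, T w → IsLoop m w → Eqv m w x)
    (hLL : ∀ {p q r}, Triple m T p q r → Eqv m (L m p) x → Eqv m (L m q) x → False)
    (hRR : ∀ {p q r}, Triple m T p q r → Eqv m (R m p) x → Eqv m (R m q) x → False) 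
    (h : Triple m T p q r) : False := by
  have lx : IsLoop m x := by
    rcases kx with k | k
    · exact Or.inr (Or.inl k)
    · exact Or.inl k
  have hLR : ∀ {p q r}, Triple m T p q r → Eqv m (L m p) x → Eqv m (R m q) x → False := by
    intro p q r h ep eq
    by_cases h1 : Eqv m (L m r) x
    · exact hLL h.swap' ep h1
    by_cases h2 : Eqv m (R m r) x
    · exact hRR h.swap.swap' eq h2
    exact left_right hT hm hx kx h ep eq h1 h2
  have hA : ∀ {p q r}, Triple m T p q r → (Eqv m (L m p) x ∨ Eqv m (R m p) x) → False := by
    intro p q r h hp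
    by_cases hq : Eqv m (L m q) x ∨ Eqv m (R m q) x
    · rcases hp with hp | hp <;> rcases hq with hq | hq
      · exact hLL h hp hq
      · exact hLR h hp hq
      · exact hLR h.swap hq hp
      · exact hRR h hp hq
    by_cases hr : Eqv m (L m r) x ∨ Eqv m (R m r) x
    · rcases hp with hp | hp <;> rcases hr with hr | hr
      · exact hLL h.swap' hp hr
      · exact hLR h.swap' hp hr
      · exact hLR h.swap'.swap hr hp
      · exact hRR h.swap' hp hr
    push Not at hq hr
    have hpn : ¬ Eqv m (L m p) (R m p) := fun he =>
      h.np (loop_of_L_R (by omega) h.hp.inj h.hp.con he)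
    have hp' : ¬ Eqv m (L m p) x ∨ ¬ Eqv m (R m p) x := by
      by_contra hcon
      push Not at hcon
      exact hpn (hcon.1.trans hcon.2.symm)
    have ap : Adj m p (x 2 < x 3) := by
      rcases hp with hp | hp
      · exact adj_of_left hm lx h.hp hp
      · exact adj_of_right hm lx h.hp hp
    exact adj_nonadj_nonadj hT hm hx hone h.hp h.hq h.hr h.nq h.nr h.qr hq.1 hq.2 hr.1 hr.2 ap hp'
  by_cases hp : Eqv m (L m p) x ∨ Eqv m (R m p) x
  · exact hA h hp
  by_cases hq : Eqv m (L m q) x ∨ Eqv m (R m q) x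
  · exact hA h.swap hq
  by_cases hr : Eqv m (L m r) x ∨ Eqv m (R m r) x
  · exact hA h.swap'.swap hr
  push Not at hp hq hr
  obtain ⟨a1, a2⟩ := nonadj_pair hT hm hx hone h.hp h.hq h.np h.nq h.pq hp.1 hp.2 hq.1 hq.2
  obtain ⟨b1, b2⟩ := nonadj_pair hT hm hx hone h.hr h.hq h.nr h.nq (mt Eqv.symm h.qr) hr.1 hr.2
    hq.1 hq.2
  rcases parallel (by omega) hT h.hp h.hr h.pr (a1.trans b1.symm) (a2.symm.trans b2) with k | k
  · exact hp.1 (hone _ h.hp.T_L k)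
  · exact hp.2 (hone _ h.hp.T_R k)

theorem one_loop_S (hT : Ctx m T col) (hm : 6 ≤ m) (hx : T x) (kx : IsS m x)
    (hone : ∀ w, T w → IsLoop m w → Eqv m w x) (h : Triple m T p q r) : False :=
  one_loop_of hT hm hx (Or.inl kx) hone (fun h => left_left_S hT hm hx kx h)
    (fun h => right_right_S hT hm hx kx h) h

theorem one_loop_case (hT : Ctx m T col) (hm : 6 ≤ m) (hx : T x) (lx : IsLoop m x)
    (hone : ∀ w, T w → IsLoop m w → Eqv m w x) (h : Triple m T p q r) : False := by
  have hx' : T (rc m (rc m x)) := hT.cl hx (rc_rc m x).symm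
  rcases lx with kx | kx | kx
  · refine one_loop_of hT hm hx (Or.inr kx) hone (fun h => left_left_D hT hm hx kx h)
      (fun h ep eq => ?_) h
    exact left_left_D (x := rc m x) hT.rc hm hx' kx.rc (h.rc hT) ((L_rc _).trans ep.rc)
      ((L_rc _).trans eq.rc)
  · exact one_loop_S hT hm hx kx hone h
  · refine one_loop_S (x := rc m x) hT.rc hm hx' kx.rc (fun w hw lw => ?_) (h.rc hT)
    have := hone _ hw lw.rc
    exact (rc_rc m w).symm.trans this.rc

end Pattern

/-! ### No four members for lengths at least eight -/

namespace Pattern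

variable {m : ℕ} {T : (ℕ → ℤ) → Prop} {col : (ℕ → ℤ) → Fin 3} {p q r s x y : ℕ → ℤ} {u : Prop}

theorem exists_kind_of_mem (hm : 6 ≤ m) (hp : Mem m T p) {c : Fin 3} (h : Kind c (m + 1) p) :
    ∃ x, T x ∧ Kind c m x :=
  ⟨_, hp.T_L, h.del (by omega) ((sL_le m p).trans (by omega)) (con_L hp.inj hp.con)⟩

theorem Kind.inj {c d : Fin 3} (hm : 6 ≤ m) (h : Kind c m p) (h' : Kind d m p) : c = d := by
  rcases h with ⟨rfl, h⟩ | ⟨rfl, h⟩ | ⟨rfl, h⟩ <;> rcases h' with ⟨rfl, h'⟩ | ⟨rfl, h'⟩ | ⟨rfl, h'⟩ <;>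
    first
    | rfl
    | (exfalso
       first
        | (have := h 1 2 (by omega) (by omega); have := h'.1 1 2 (by omega) (by omega); omega)
        | (have := h.1 1 2 (by omega) (by omega); have := h' 1 2 (by omega) (by omega); omega)
        | (have := h.1 0 1 (by omega) (by omega); have := h'.2 1 (by omega) (by omega); omega)
        | (have := h'.1 0 1 (by omega) (by omega); have := h.2 1 (by omega) (by omega); omega))

/-- Four different patterns have at least four different children altogether. -/
theorem not_four_mem (hT : Ctx m T col) (hm : 6 ≤ m) {F : Fin 4 → ℕ → ℤ}
    (hF : ∀ i, Mem m T (F i)) (hne : ∀ i j, i ≠ j → ¬ Eqv (m + 1) (F i) (F j)) : False := by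
  classical
  by_cases h0 : ∀ x, T x → ¬ IsLoop m x
  · exact no_loop_case hm hT h0 (hF 0) (hF 1) (hF 2) (hF 3) (hne _ _ (by decide))
      (hne _ _ (by decide)) (hne _ _ (by decide)) (hne _ _ (by decide)) (hne _ _ (by decide))
      (hne _ _ (by decide))
  push Not at h0
  obtain ⟨x, hx, lx⟩ := h0
  by_cases hone : ∀ w, T w → IsLoop m w → Eqv m w x
  · have hloop : ∀ i j, i ≠ j → IsLoop (m + 1) (F i) → ¬ IsLoop (m + 1) (F j) := by
      intro i j hij hi hj
      obtain ⟨c, hc⟩ := isLoop_iff_kind.1 hi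
      obtain ⟨d, hd⟩ := isLoop_iff_kind.1 hj
      obtain ⟨y, hy, ky⟩ := exists_kind_of_mem hm (hF i) hc
      obtain ⟨z, hz, kz⟩ := exists_kind_of_mem hm (hF j) hd
      obtain ⟨e, he⟩ := isLoop_iff_kind.1 lx
      have key : ∀ {c y}, T y → Kind c m y → c = e := fun hy ky => by
        have h1 := hone _ hy ky.isLoop
        refine ky.inj hm ?_
        rcases he with ⟨h, k⟩ | ⟨h, k⟩ | ⟨h, k⟩
        · exact Or.inl ⟨h, k.eqv h1.symm⟩
        · exact Or.inr (Or.inl ⟨h, k.eqv h1.symm⟩)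
        · exact Or.inr (Or.inr ⟨h, k.eqv h1.symm⟩)
      have := key hy ky
      have := key hz kz
      subst c d
      exact hne i j hij (hc.unique hd)
    obtain ⟨i, hi⟩ : ∃ i, ∀ j, j ≠ i → ¬ IsLoop (m + 1) (F j) := by
      by_cases hex : ∃ i, IsLoop (m + 1) (F i)
      · obtain ⟨i, hi⟩ := hex
        exact ⟨i, fun j hj => hloop i j (Ne.symm hj) hi⟩
      · push Not at hex
        exact ⟨0, fun j _ => hex j⟩
    have ex : ∀ i : Fin 4, ∃ a b c, a ≠ i ∧ b ≠ i ∧ c ≠ i ∧ a ≠ b ∧ a ≠ c ∧ b ≠ c := by decide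
    obtain ⟨a, b, c, ha, hb, hc, hab, hac, hbc⟩ := ex i
    exact one_loop_case hT hm hx lx hone ⟨hF a, hF b, hF c, hi a ha, hi b hb, hi c hc,
      hne a b hab, hne a c hac, hne b c hbc⟩
  push Not at hone
  obtain ⟨y, hy, ly, hyx⟩ := hone
  -- Two members of the same kind coincide, and `two_loops_case` allows only one member that is not
  -- a loop pattern. The map is thus a bijection of four-element sets, and all three kinds occur
  -- together with a further member.
  let κ : Fin 4 → Option (Fin 3) := fun i =>
    if h : ∃ c, Kind c (m + 1) (F i) then some h.choose else none
  have hnone : ∀ i, κ i = none → ¬ IsLoop (m + 1) (F i) := fun i hi hl => by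
    have h := isLoop_iff_kind.1 hl
    simp [κ, h] at hi
  have hsome : ∀ i c, κ i = some c → Kind c (m + 1) (F i) := fun i c hi => by
    by_cases h : ∃ c, Kind c (m + 1) (F i)
    · have he : κ i = some h.choose := dif_pos h
      rw [he] at hi
      cases hi
      exact h.choose_spec
    · have he : κ i = none := dif_neg h
      rw [he] at hi
      cases hi
  have hinj : Function.Injective κ := by
    intro i j hij
    by_contra hne'
    rcases h : κ i with _ | c
    · exact two_loops_case hT hm hy hx ly lx hyx (hF i) (hF j) (hnone i h) (hnone j (hij ▸ h))
        (hne i j hne')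
    · exact hne i j hne' ((hsome i c h).unique (hsome j c (hij ▸ h)))
  have hsur := ((Fintype.bijective_iff_injective_and_card κ).2 ⟨hinj, by simp⟩).2
  obtain ⟨i, hi⟩ := hsur none
  have key : ∀ c : Fin 3, ∃ x, T x ∧ Kind c m x := fun c => by
    obtain ⟨j, hj⟩ := hsur (some c)
    exact exists_kind_of_mem hm (hF j) (hsome j c hj)
  obtain ⟨a, ha, ka⟩ := key 0
  obtain ⟨b, hb, kb⟩ := key 1
  obtain ⟨c, hc, kc⟩ := key 2
  refine three_loops_case hT hm ha hb hc ?_ ?_ ?_ (hF i) (hnone i hi)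
  · rcases ka with ⟨h, k⟩ | ⟨h, k⟩ | ⟨h, k⟩
    · exact k
    all_goals exact absurd h (by decide)
  · rcases kb with ⟨h, k⟩ | ⟨h, k⟩ | ⟨h, k⟩
    swap
    · exact k
    all_goals exact absurd h (by decide)
  · rcases kc with ⟨h, k⟩ | ⟨h, k⟩ | ⟨h, k⟩
    on_goal 3 => exact k
    all_goals exact absurd h (by decide)

end Pattern

/-! ### Exhaustive search for lengths six and seven -/

namespace Pattern

/-- Reading the entry `w`, when the `j` entries before it have maximum `M` and code `c`; the rest is
read by `next`. -/
def readEntry (next : ℕ → ℕ → ℕ → ℕ) (M j c w : ℕ) : ℕ :=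
  bif Nat.ble M w then next w (Nat.succ j) (Nat.add w (Nat.mul 8 c))
  else next M (Nat.succ j) (Nat.add w (Nat.mul 8 c))

/-- A positive number determining the one line notation obtained from `l` by deleting the value `v`,
or zero if that is decomposable; `j` entries with maximum `M` and code `c` have been read. The
definitions here use recursors because the kernel evaluates those fastest. -/
def scan (v : ℕ) (l : List ℕ) : ℕ → ℕ → ℕ → ℕ :=
  List.rec (motive := fun _ => ℕ → ℕ → ℕ → ℕ) (fun _ _ c => c)
    (fun u _ next M j c =>
      bif Nat.beq u v then next M j c
      else bif Nat.ble j M then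
        bif Nat.ble u v then readEntry next M j c u else readEntry next M j c (Nat.pred u)
      else 0) l

def elemNat (a : ℕ) (l : List ℕ) : Bool :=
  List.rec (motive := fun _ => Bool) false (fun b _ r => bif Nat.beq a b then true else r) l

def hasThree (l : List ℕ) : Bool :=
  List.rec (motive := fun _ => Bool) false (fun _ t _ =>
    List.rec (motive := fun _ => Bool) false (fun _ t _ =>
      List.rec (motive := fun _ => Bool) false (fun _ _ _ => true) t) t) l

/-- The codes of the indecomposable deletions of values in `t`, together with `acc`, unless there are
more than three of them. -/
def childCodes (l t : List ℕ) : List ℕ → Option (List ℕ) :=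
  List.rec (motive := fun _ => List ℕ → Option (List ℕ)) some
    (fun v _ next acc =>
      Nat.rec (motive := fun _ => Option (List ℕ)) (next acc)
        (fun k _ => bif elemNat k acc then next acc
          else bif hasThree acc then none else next (k :: acc))
        (scan v l 0 0 1)) t

/-- The indecomposable permutations in `L`, of length `n`, with at most three indecomposable
deletions, and these deletions. -/
def entriesIn (n : ℕ) (L : List (List ℕ)) : List (ℕ × List ℕ) :=
  List.rec (motive := fun _ => List (ℕ × List ℕ)) []
    (fun l _ r => Nat.rec (motive := fun _ => List (ℕ × List ℕ)) r
        (fun k _ => Option.rec (motive := fun _ => List (ℕ × List ℕ)) r (fun s => (k, s) :: r)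
          (childCodes l l []))
        (scan n l 0 0 1)) L

def entries (n : ℕ) : List (ℕ × List ℕ) := entriesIn n (List.range n).permutations'

inductive SearchTree : Type
  | leaf : SearchTree
  | node : ℕ → List (ℕ × List ℕ) → SearchTree → SearchTree → SearchTree

noncomputable def SearchTree.add (k : ℕ) (v : ℕ × List ℕ) (t : SearchTree) : SearchTree :=
  SearchTree.rec (motive := fun _ => SearchTree) (.node k [v] .leaf .leaf)
    (fun k' vs l r l' r' =>
      bif Nat.beq k k' then .node k' (v :: vs) l r
      else bif Nat.ble k k' then .node k' vs l' r else .node k' vs l r') t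

noncomputable def SearchTree.find (k : ℕ) (t : SearchTree) : List (ℕ × List ℕ) :=
  SearchTree.rec (motive := fun _ => List (ℕ × List ℕ)) []
    (fun k' vs _ _ l' r' => bif Nat.beq k k' then vs else bif Nat.ble k k' then l' else r') t

def firstNat (l : List ℕ) : ℕ := List.rec (motive := fun _ => ℕ) 0 (fun a _ _ => a) l

/-- The entries sorted by their first children. -/
noncomputable def searchTree (E : List (ℕ × List ℕ)) : SearchTree :=
  List.rec (motive := fun _ => SearchTree) .leaf (fun e _ t => t.add (firstNat e.2) e) E

def forAll (p : ℕ × List ℕ → Bool) (l : List (ℕ × List ℕ)) : Bool :=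
  List.rec (motive := fun _ => Bool) true (fun a _ r => bif p a then r else false) l

/-- All entries with children in a set of size three containing `U` satisfy `p`. -/
noncomputable def forCandidates (p : ℕ × List ℕ → Bool) (E : List (ℕ × List ℕ)) (U : List ℕ) :
    Bool :=
  bif hasThree U then
    List.rec (motive := fun _ => Bool) true
      (fun k _ r => bif forAll p ((searchTree E).find k) then r else false) U
  else forAll p E

/-- The union of `U` and `V` satisfies `p` or has more than three elements. -/
def forUnion (p : List ℕ → Bool) (V U : List ℕ) : Bool :=
  List.rec (motive := fun _ => List ℕ → Bool) p
    (fun a _ next U => bif elemNat a U then next U else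
      bif hasThree U then true else next (a :: U)) V U

/-- `E` does not contain four different entries with at most three children altogether. -/
noncomputable def noFour (E : List (ℕ × List ℕ)) : Bool :=
  forAll (fun e => forAll (fun f =>
    -- Among four entries with at most three children, two share their first child; these are taken
    -- as `e` and `f`. Ordering `e`, `f` and `g`, `h` by code avoids repeated tests.
    bif Nat.ble e.1 f.1 then true else
    forUnion (fun U => forCandidates (fun g =>
      bif Nat.beq g.1 e.1 then true else
      bif Nat.beq g.1 f.1 then true else
      forUnion (fun V => forCandidates (fun h =>
        bif Nat.beq h.1 e.1 then true else
        bif Nat.beq h.1 f.1 then true else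
        bif Nat.ble g.1 h.1 then true else
        forUnion (fun _ => false) h.2 V) E V) g.2 U) E U) f.2 e.2)
    ((searchTree E).find (firstNat e.2))) E

-- Evaluated in the kernel over all permutations of length six. This length and the next lie outside
-- the range `m ≥ 6` of the general argument.
set_option maxRecDepth 100000 in
theorem noFour_six : noFour (entries 6) = true := by decide +kernel

set_option maxRecDepth 100000 in
theorem noFour_seven : noFour (entries 7) = true := by decide +kernel

end Pattern

/-! ### Correctness of the search -/

namespace Pattern

theorem beq_eq_false {a b : ℕ} (h : a ≠ b) : Nat.beq a b = false := by
  rw [← Bool.not_eq_true, Nat.beq_eq]; exact h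

theorem ble_eq_false {a b : ℕ} (h : b < a) : Nat.ble a b = false := by
  rw [← Bool.not_eq_true, Nat.ble_eq]; omega

theorem ble_eq_true {a b : ℕ} (h : a ≤ b) : Nat.ble a b = true := by rwa [Nat.ble_eq]

theorem elemNat_cons (a b : ℕ) (t : List ℕ) :
    elemNat a (b :: t) = bif Nat.beq a b then true else elemNat a t := rfl

theorem elemNat_iff {a : ℕ} {l : List ℕ} : elemNat a l = true ↔ a ∈ l := by
  induction l with
  | nil => exact ⟨fun h => (Bool.false_ne_true h).elim, fun h => absurd h List.not_mem_nil⟩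
  | cons b t ih =>
    rw [elemNat_cons]
    by_cases h : a = b
    · subst h; simp
    · simp [beq_eq_false h, ih, h]

theorem hasThree_iff : ∀ {l : List ℕ}, hasThree l = true ↔ 3 ≤ l.length
  | [] => ⟨fun h => (Bool.false_ne_true h).elim, fun h => by simp at h⟩
  | [_] => ⟨fun h => (Bool.false_ne_true h).elim, fun h => by simp at h⟩
  | [_, _] => ⟨fun h => (Bool.false_ne_true h).elim, fun h => by simp at h⟩
  | _ :: _ :: _ :: t => ⟨fun _ => by simp, fun _ => rfl⟩

theorem length_le_of_subset {U K : List ℕ} (hU : U.Nodup) (h : U ⊆ K) : U.length ≤ K.length :=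
  (hU.subperm h).length_le

theorem hasThree_eq_false {a : ℕ} {U K : List ℕ} (hK : K.length ≤ 3) (hU : (a :: U).Nodup)
    (h : a :: U ⊆ K) : hasThree U = false := by
  rw [← Bool.not_eq_true, hasThree_iff]
  have := length_le_of_subset hU h
  rw [List.length_cons] at this
  omega

theorem SearchTree.find_node (k k' : ℕ) (vs : List (ℕ × List ℕ)) (l r : SearchTree) :
    (SearchTree.node k' vs l r).find k =
      bif Nat.beq k k' then vs else bif Nat.ble k k' then l.find k else r.find k := rfl

theorem SearchTree.add_node (k k' : ℕ) (v : ℕ × List ℕ) (vs : List (ℕ × List ℕ))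
    (l r : SearchTree) : (SearchTree.node k' vs l r).add k v =
      bif Nat.beq k k' then .node k' (v :: vs) l r
      else bif Nat.ble k k' then .node k' vs (l.add k v) r else .node k' vs l (r.add k v) := rfl

theorem SearchTree.mem_find_add {k k' : ℕ} {v w : ℕ × List ℕ} {t : SearchTree}
    (h : (k = k' ∧ v = w) ∨ v ∈ t.find k') : v ∈ (t.add k w).find k' := by
  induction t with
  | leaf =>
    rcases h with ⟨rfl, rfl⟩ | h
    · change v ∈ (SearchTree.node k [v] .leaf .leaf).find k
      simp [SearchTree.find_node]
    · exact absurd h List.not_mem_nil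
  | node k₀ vs l r ihl ihr =>
    rw [SearchTree.find_node] at h
    rw [SearchTree.add_node]
    by_cases h1 : k = k₀
    · subst h1
      rw [Nat.beq_refl, cond_true, SearchTree.find_node]
      by_cases h2 : k' = k
      · subst h2
        rw [Nat.beq_refl, cond_true] at h ⊢
        rcases h with ⟨-, rfl⟩ | h
        · exact List.mem_cons_self
        · exact List.mem_cons_of_mem _ h
      · rw [beq_eq_false h2, cond_false] at h ⊢
        exact h.resolve_left fun h => h2 h.1.symm
    · rw [beq_eq_false h1, cond_false]
      rcases h4 : Nat.ble k k₀ with _ | _ <;> simp only [cond_true, cond_false] <;>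
        rw [SearchTree.find_node] <;>
      · by_cases h5 : k' = k₀
        · rw [h5, Nat.beq_refl, cond_true] at h ⊢
          exact h.resolve_left fun h => h1 h.1
        · rw [beq_eq_false h5, cond_false] at h ⊢
          rcases h6 : Nat.ble k' k₀ with _ | _ <;> rw [h6] at h <;>
            simp only [cond_true, cond_false] at h ⊢ <;>
          · first
            | exact ihl h
            | exact ihr h
            | (rcases h with ⟨rfl, -⟩ | h
               · rw [h4] at h6; cases h6
               · exact h)

theorem mem_find {E : List (ℕ × List ℕ)} {e : ℕ × List ℕ} (he : e ∈ E) :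
    e ∈ (searchTree E).find (firstNat e.2) := by
  induction E with
  | nil => simp at he
  | cons a t ih =>
    refine SearchTree.mem_find_add ?_
    rcases List.mem_cons.1 he with rfl | he
    · exact Or.inl ⟨rfl, rfl⟩
    · exact Or.inr (ih he)

theorem firstNat_mem : ∀ {l : List ℕ}, l ≠ [] → firstNat l ∈ l
  | [], h => absurd rfl h
  | _ :: _, _ => List.mem_cons_self

theorem forAll_cons (p : ℕ × List ℕ → Bool) (a : ℕ × List ℕ) (l : List (ℕ × List ℕ)) :
    forAll p (a :: l) = bif p a then forAll p l else false := rfl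

theorem of_forAll {p : ℕ × List ℕ → Bool} {l : List (ℕ × List ℕ)} {e : ℕ × List ℕ}
    (h : forAll p l = true) (he : e ∈ l) : p e = true := by
  induction l with
  | nil => simp at he
  | cons a t ih =>
    rw [forAll_cons] at h
    rcases h' : p a with _ | _ <;> rw [h'] at h
    · cases h
    · rcases List.mem_cons.1 he with rfl | he
      · exact h'
      · exact ih h he

/-- Once `U` has three elements it exhausts `K`, so the first child of `e` lies in `U` and the
search tree delivers `e`. -/
theorem of_forCandidates {p : ℕ × List ℕ → Bool} {E : List (ℕ × List ℕ)} {e : ℕ × List ℕ}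
    {U K : List ℕ} (h : forCandidates p E U = true) (he : e ∈ E) (hU : U.Nodup) (hUK : U ⊆ K)
    (hK : K.length ≤ 3) (he0 : e.2 ≠ []) (heK : e.2 ⊆ K) : p e = true := by
  unfold forCandidates at h
  rcases h' : hasThree U with _ | _ <;> rw [h'] at h
  · exact of_forAll h he
  · rw [hasThree_iff] at h'
    have hp : U.Perm K := (hU.subperm hUK).perm_of_length_le (by omega)
    have hmem := hp.mem_iff.2 (heK (firstNat_mem he0))
    rw [cond_true] at h
    clear h' hp hU hUK
    induction U with
    | nil => simp at hmem
    | cons a t ih =>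
      change (bif forAll p ((searchTree E).find a) then _ else false) = true at h
      rcases h' : forAll p ((searchTree E).find a) with _ | _ <;> rw [h'] at h
      · cases h
      · rcases List.mem_cons.1 hmem with hm | hm
        · exact of_forAll h' (hm ▸ mem_find he)
        · exact ih h hm

theorem of_forUnion {p : List ℕ → Bool} {V K : List ℕ} (hK : K.length ≤ 3) (hV : V ⊆ K) :
    ∀ {U : List ℕ}, forUnion p V U = true → U.Nodup → U ⊆ K →
      ∃ W : List ℕ, p W = true ∧ W.Nodup ∧ W ⊆ K := by
  induction V with
  | nil => exact fun h h1 h2 => ⟨_, h, h1, h2⟩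
  | cons a t ih =>
    intro U h h1 h2
    have ht : t ⊆ K := fun x hx => hV (List.mem_cons_of_mem _ hx)
    change (bif elemNat a U then forUnion p t U else
      bif hasThree U then true else forUnion p t (a :: U)) = true at h
    by_cases ha : a ∈ U
    · rw [elemNat_iff.2 ha] at h
      exact ih ht h h1 h2
    · have h3 : (a :: U).Nodup := List.nodup_cons.2 ⟨ha, h1⟩
      have h4 : a :: U ⊆ K := List.cons_subset.2 ⟨hV List.mem_cons_self, h2⟩
      rw [Bool.eq_false_iff.2 (mt elemNat_iff.1 ha), hasThree_eq_false hK h3 h4] at h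
      exact ih ht h h3 h4

/-- The pigeonhole principle provides two entries with a common first child. The running unions of
children stay inside `K`, so the search never leaves this branch by exceeding three children, and it
ends at the constant `false`. -/
theorem noFour_sound {E : List (ℕ × List ℕ)} (hE : noFour E = true) {K : List ℕ}
    (hK : K.length ≤ 3) {e : Fin 4 → ℕ × List ℕ} (he : ∀ i, e i ∈ E)
    (hne : ∀ i j, i ≠ j → (e i).1 ≠ (e j).1) (h0 : ∀ i, (e i).2 ≠ []) (hn : ∀ i, (e i).2.Nodup)
    (hs : ∀ i, (e i).2 ⊆ K) : False := by
  obtain ⟨a, b, hab, hkey⟩ : ∃ a b, (e b).1 < (e a).1 ∧ firstNat (e a).2 = firstNat (e b).2 := by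
    have hc : K.toFinset.card < (Finset.univ : Finset (Fin 4)).card := by
      have := K.toFinset_card_le
      simp
      omega
    obtain ⟨a, -, b, -, h1, h2⟩ := Finset.exists_ne_map_eq_of_card_lt_of_maps_to hc
      (f := fun i => firstNat (e i).2)
      (fun i _ => List.mem_toFinset.2 (hs i (firstNat_mem (h0 i))))
    rcases lt_or_gt_of_ne (hne a b h1) with h | h
    · exact ⟨b, a, h, h2.symm⟩
    · exact ⟨a, b, h, h2⟩
  obtain ⟨c, d, hca, hcb, hda, hdb, hdc⟩ : ∃ c d, c ≠ a ∧ c ≠ b ∧ d ≠ a ∧ d ≠ b ∧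
      (e d).1 < (e c).1 := by
    have key : ∀ a b : Fin 4, a ≠ b → ∃ c d, c ≠ a ∧ c ≠ b ∧ d ≠ a ∧ d ≠ b ∧ d ≠ c := by decide
    obtain ⟨c, d, h1, h2, h3, h4, h5⟩ := key a b fun h => by subst h; omega
    rcases lt_or_gt_of_ne (hne d c h5) with h | h
    · exact ⟨c, d, h1, h2, h3, h4, h⟩
    · exact ⟨d, c, h3, h4, h1, h2, h⟩
  unfold noFour at hE
  have hE := of_forAll (of_forAll hE (he a)) (e := e b) (hkey ▸ mem_find (he b))
  rw [ble_eq_false hab, cond_false] at hE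
  obtain ⟨U, hE, n1, s1⟩ := of_forUnion hK (hs b) hE (hn a) (hs a)
  have hE := of_forCandidates hE (he c) n1 s1 hK (h0 c) (hs c)
  rw [beq_eq_false (hne _ _ hca), beq_eq_false (hne _ _ hcb), cond_false, cond_false] at hE
  obtain ⟨V, hE, n2, s2⟩ := of_forUnion hK (hs c) hE n1 s1
  have hE := of_forCandidates hE (he d) n2 s2 hK (h0 d) (hs d)
  rw [beq_eq_false (hne _ _ hda), beq_eq_false (hne _ _ hdb), ble_eq_false hdc, cond_false,
    cond_false, cond_false] at hE
  obtain ⟨W, hE, -⟩ := of_forUnion hK (hs d) hE n2 s2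
  exact Bool.false_ne_true hE

theorem childCodes_cons (l : List ℕ) (v : ℕ) (t acc : List ℕ) : childCodes l (v :: t) acc =
    Nat.rec (motive := fun _ => Option (List ℕ)) (childCodes l t acc)
      (fun k _ => bif elemNat k acc then childCodes l t acc
        else bif hasThree acc then none else childCodes l t (k :: acc)) (scan v l 0 0 1) := rfl

/-- Subsets of `K` have at most three elements, so the accumulator never overflows and every code is
recorded. -/
theorem childCodes_spec {l K : List ℕ} (hK : K.length ≤ 3) (t : List ℕ) :
    ∀ acc : List ℕ, acc.Nodup → acc ⊆ K → (∀ v ∈ t, ∀ k, scan v l 0 0 1 = k + 1 → k ∈ K) →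
    ∃ s, childCodes l t acc = some s ∧ s.Nodup ∧ s ⊆ K ∧ acc ⊆ s ∧
      ∀ v ∈ t, ∀ k, scan v l 0 0 1 = k + 1 → k ∈ s := by
  induction t with
  | nil => exact fun acc h1 h2 _ => ⟨acc, rfl, h1, h2, fun _ h => h, by simp⟩
  | cons v t ih =>
    intro acc h1 h2 h3
    have h3' := fun w hw => h3 w (List.mem_cons_of_mem v hw)
    rw [childCodes_cons]
    rcases h : scan v l 0 0 1 with _ | k
    · obtain ⟨s, a, b, c, d, e⟩ := ih acc h1 h2 h3'
      exact ⟨s, a, b, c, d, List.forall_mem_cons.2 ⟨fun k hk => by omega, e⟩⟩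
    · by_cases hk : k ∈ acc
      · obtain ⟨s, a, b, c, d, e⟩ := ih acc h1 h2 h3'
        refine ⟨s, by simpa [elemNat_iff.2 hk] using a, b, c, d,
          List.forall_mem_cons.2 ⟨fun k' hk' => d ?_, e⟩⟩
        rwa [show k' = k by omega]
      · have n1 : (k :: acc).Nodup := List.nodup_cons.2 ⟨hk, h1⟩
        have s1 : k :: acc ⊆ K := List.cons_subset.2 ⟨h3 v List.mem_cons_self k h, h2⟩
        obtain ⟨s, a, b, c, d, e⟩ := ih _ n1 s1 h3'
        rw [List.cons_subset] at d
        refine ⟨s, ?_, b, c, d.2, List.forall_mem_cons.2 ⟨fun k' hk' => ?_, e⟩⟩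
        · simpa [Bool.eq_false_iff.2 (mt elemNat_iff.1 hk), hasThree_eq_false hK n1 s1] using a
        · rw [show k' = k by omega]; exact d.1

theorem entriesIn_cons (n : ℕ) (l : List ℕ) (L : List (List ℕ)) : entriesIn n (l :: L) =
    Nat.rec (motive := fun _ => List (ℕ × List ℕ)) (entriesIn n L)
      (fun k _ => Option.rec (motive := fun _ => List (ℕ × List ℕ)) (entriesIn n L)
        (fun s => (k, s) :: entriesIn n L) (childCodes l l [])) (scan n l 0 0 1) := rfl

theorem mem_entriesIn {n k : ℕ} {l s : List ℕ} {L : List (List ℕ)} (hl : l ∈ L)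
    (hk : scan n l 0 0 1 = k + 1) (hs : childCodes l l [] = some s) : (k, s) ∈ entriesIn n L := by
  induction L with
  | nil => simp at hl
  | cons a t ih =>
    rw [entriesIn_cons]
    rcases List.mem_cons.1 hl with rfl | hl
    · rw [hk, hs]; exact List.mem_cons_self
    · rcases scan n a 0 0 1 with _ | k'
      · exact ih hl
      · rcases childCodes a a [] with _ | s'
        · exact ih hl
        · exact List.mem_cons_of_mem _ (ih hl)

/-- No proper prefix of `l` is filled by the smallest values, where `j` entries with maximum `M` have
already been read. -/
def NoFilledPrefix (l : List ℕ) (M j : ℕ) : Prop :=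
  ∀ k < l.length, j + k ≤ M ∨ ∃ i < k, j + k ≤ l.getD i 0

/-- A prefix is filled exactly when its maximum is smaller than its length. Maximum and length are
therefore all the state that `scan` has to carry. -/
theorem noFilledPrefix_cons {x : ℕ} {t : List ℕ} {M j : ℕ} :
    NoFilledPrefix (x :: t) M j ↔ j ≤ M ∧ NoFilledPrefix t (max M x) (j + 1) := by
  have step : ∀ k, (j + (k + 1) ≤ M ∨ ∃ i < k + 1, j + (k + 1) ≤ (x :: t).getD i 0) ↔
      (j + 1 + k ≤ max M x ∨ ∃ i < k, j + 1 + k ≤ t.getD i 0) := by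
    intro k
    constructor
    · rintro (h | ⟨i, hi, h⟩)
      · left; omega
      · cases i with
        | zero => left; simp at h; omega
        | succ i => right; exact ⟨i, by omega, by simp at h ⊢; omega⟩
    · rintro (h | ⟨i, hi, h⟩)
      · by_cases h' : j + (k + 1) ≤ M
        · exact Or.inl h'
        · right; exact ⟨0, by omega, by simp; omega⟩
      · right; exact ⟨i + 1, by omega, by simp at h ⊢; omega⟩
  constructor
  · intro h
    refine ⟨?_, fun k hk => (step k).1 (h (k + 1) (by simpa using hk))⟩
    simpa using h 0 (by simp)
  · rintro ⟨h1, h2⟩ k hk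
    cases k with
    | zero => exact Or.inl h1
    | succ k => exact (step k).2 (h2 k (by simpa using hk))

/-- Continues the code `c` by `l`. -/
def codeOf : List ℕ → ℕ → ℕ
  | [], c => c
  | a :: t, c => codeOf t (a + 8 * c)

theorem codeOf_pos : ∀ (l : List ℕ) {c : ℕ}, 0 < c → 0 < codeOf l c
  | [], _, h => h
  | _ :: t, _, h => codeOf_pos t (by omega)

/-- The entries are digits in base 8. -/
theorem codeOf_inj : ∀ {l l' : List ℕ} {c c' : ℕ}, l.length = l'.length → (∀ x ∈ l, x < 8) →
    (∀ x ∈ l', x < 8) → codeOf l c = codeOf l' c' → l = l' ∧ c = c'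
  | [], [], _, _, _, _, _, h => ⟨rfl, h⟩
  | a :: t, b :: t', c, c', hl, h1, h2, h => by
    have ha := h1 a List.mem_cons_self
    have hb := h2 b List.mem_cons_self
    obtain ⟨rfl, h⟩ := codeOf_inj (l := t) (l' := t') (by simpa using hl)
      (fun x hx => h1 x (List.mem_cons_of_mem _ hx)) (fun x hx => h2 x (List.mem_cons_of_mem _ hx)) h
    exact ⟨by rw [show a = b by omega], by omega⟩

/-- The one line notation obtained by deleting the value `v`. -/
def dropValue (v : ℕ) (l : List ℕ) : List ℕ :=
  (l.filter (· ≠ v)).map fun u => if u ≤ v then u else u - 1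

theorem readEntry_eq (next : ℕ → ℕ → ℕ → ℕ) (M j c w : ℕ) :
    readEntry next M j c w = next (max M w) (j + 1) (w + 8 * c) := by
  unfold readEntry
  by_cases h : M ≤ w
  · rw [ble_eq_true h, max_eq_right h]; rfl
  · rw [ble_eq_false (by omega), max_eq_left (by omega)]; rfl

theorem scan_cons (v u : ℕ) (t : List ℕ) (M j c : ℕ) : scan v (u :: t) M j c =
    bif Nat.beq u v then scan v t M j c
    else bif Nat.ble j M then
      bif Nat.ble u v then readEntry (scan v t) M j c u else readEntry (scan v t) M j c (Nat.pred u)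
    else 0 := rfl

open Classical in
theorem scan_eq {v : ℕ} {l : List ℕ} : ∀ M j c, scan v l M j c =
    if NoFilledPrefix (dropValue v l) M j then codeOf (dropValue v l) c else 0 := by
  induction l with
  | nil => exact fun M j c => (if_pos fun k hk => absurd hk (Nat.not_lt_zero k)).symm
  | cons u t ih =>
    intro M j c
    rw [scan_cons]
    by_cases h1 : u = v
    · subst h1
      rw [Nat.beq_refl, cond_true, ih, show dropValue u (u :: t) = dropValue u t by simp [dropValue]]
    · have hd : dropValue v (u :: t) = (if u ≤ v then u else u - 1) :: dropValue v t := by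
        simp [dropValue, h1]
      rw [hd, noFilledPrefix_cons, beq_eq_false h1, cond_false]
      by_cases h2 : j ≤ M
      · rw [ble_eq_true h2, cond_true]
        simp only [h2, true_and, codeOf]
        by_cases h3 : u ≤ v
        · rw [ble_eq_true h3, cond_true, readEntry_eq, ih]
          simp only [if_pos h3]
        · rw [ble_eq_false (by omega), cond_false, readEntry_eq, ih]
          simp only [if_neg h3, Nat.pred_eq_sub_one]
      · rw [ble_eq_false (by omega), cond_false, if_neg fun h => h2 h.1]

end Pattern

/-! ### One line notation of patterns -/

namespace Pattern

variable {m : ℕ} {T : (ℕ → ℤ) → Prop} {col : (ℕ → ℤ) → Fin 3} {p q r s x y : ℕ → ℤ}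

/-- The number of entries below the entry at position `i`. -/
def rank (m : ℕ) (p : ℕ → ℤ) (i : ℕ) : ℕ := ((Finset.range (m + 1)).filter fun j => p j < p i).card

/-- The one line notation of a pattern. -/
def ranks (m : ℕ) (p : ℕ → ℤ) : List ℕ := (List.range (m + 1)).map (rank m p)

theorem length_ranks : (ranks m p).length = m + 1 := by simp [ranks]

theorem ranks_getElem {i : ℕ} (h : i < (ranks m p).length) : (ranks m p)[i] = rank m p i := by
  simp [ranks]

theorem ranks_getD {i : ℕ} (h : i ≤ m) : (ranks m p).getD i 0 = rank m p i := by
  rw [List.getD_eq_getElem _ _ (by rw [length_ranks]; omega), ranks_getElem]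

theorem rank_lt_iff {i j : ℕ} (hi : i ≤ m) : rank m p i < rank m p j ↔ p i < p j := by
  constructor
  · intro h
    by_contra hcon
    refine absurd (Finset.card_le_card ?_) (not_le.2 h)
    intro k hk
    rw [Finset.mem_filter] at hk ⊢
    exact ⟨hk.1, by omega⟩
  · intro h
    refine Finset.card_lt_card ⟨fun k hk => ?_, fun hs => ?_⟩
    · rw [Finset.mem_filter] at hk ⊢
      exact ⟨hk.1, by omega⟩
    · have := @hs i (by rw [Finset.mem_filter, Finset.mem_range]; exact ⟨by omega, h⟩)
      rw [Finset.mem_filter] at this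
      omega

theorem rank_le {i : ℕ} (hi : i ≤ m) : rank m p i ≤ m := by
  have : rank m p i < (Finset.range (m + 1)).card := by
    refine Finset.card_lt_card ⟨Finset.filter_subset _ _, fun hs => ?_⟩
    have := @hs i (by rw [Finset.mem_range]; omega)
    rw [Finset.mem_filter] at this
    omega
  rw [Finset.card_range] at this
  omega

theorem ranks_eq_iff : ranks m p = ranks m q ↔ Eqv m p q := by
  constructor
  · intro h i hi j hj
    have e : ∀ i ≤ m, rank m p i = rank m q i := fun i hi => by
      rw [← ranks_getD hi, ← ranks_getD hi, h]
    rw [← rank_lt_iff hi, ← rank_lt_iff (p := q) hi, e i hi, e j hj]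
  · intro h
    refine List.map_congr_left fun i hi => ?_
    rw [List.mem_range] at hi
    refine congrArg Finset.card (Finset.filter_congr fun j hj => ?_)
    rw [Finset.mem_range] at hj
    exact h j (by omega) i (by omega)

theorem rank_inj (hp : Inj m p) {i j : ℕ} (hi : i ≤ m) (hj : j ≤ m)
    (h : rank m p i = rank m p j) : i = j := by
  have h1 := rank_lt_iff (p := p) (j := j) hi
  have h2 := rank_lt_iff (p := p) (j := i) hj
  exact hp i hi j hj (by omega)

theorem nodup_ranks (hp : Inj m p) : (ranks m p).Nodup := by
  refine List.Nodup.map_on (fun i hi j hj h => ?_) List.nodup_range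
  rw [List.mem_range] at hi hj
  exact rank_inj hp (by omega) (by omega) h

theorem mem_ranks_le {v : ℕ} (hv : v ∈ ranks m p) : v ≤ m := by
  obtain ⟨i, hi, rfl⟩ := List.mem_map.1 hv
  rw [List.mem_range] at hi
  exact rank_le (by omega)

theorem ranks_mem_permutations' (hp : Inj m p) :
    ranks m p ∈ (List.range (m + 1)).permutations' := by
  rw [List.mem_permutations']
  refine ((nodup_ranks hp).subperm fun v hv => ?_).perm_of_length_le (by rw [length_ranks]; simp)
  have := mem_ranks_le hv
  rw [List.mem_range]
  omega

/-- If no inversion crosses the gap `k`, the first `k` entries have ranks below `k`. Conversely, if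
they do, a later entry below one of them would be a further entry with rank below `k`, and ranks are
distinct. -/
theorem noFilledPrefix_ranks_iff (hp : Inj m p) : NoFilledPrefix (ranks m p) 0 0 ↔ Con m p := by
  unfold NoFilledPrefix
  rw [length_ranks]
  have key : ∀ k, 0 < k → k ≤ m → ((0 + k ≤ 0 ∨ ∃ i < k, 0 + k ≤ (ranks m p).getD i 0) ↔
      ∃ i, i < k ∧ ∃ j, k ≤ j ∧ j ≤ m ∧ p j < p i) := by
    intro k hk hkm
    constructor
    · rintro (h | ⟨i, hi, h⟩)
      · omega
      · rw [ranks_getD (by omega)] at h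
        by_contra hcon
        push Not at hcon
        have : rank m p i < k := by
          have : rank m p i < (Finset.range k).card := by
            refine Finset.card_lt_card ⟨fun j hj => ?_, fun hs => ?_⟩
            · rw [Finset.mem_filter, Finset.mem_range] at hj
              rw [Finset.mem_range]
              by_contra hjk
              have := hcon i hi j (by omega) (by omega)
              omega
            · have := @hs i (by rw [Finset.mem_range]; omega)
              rw [Finset.mem_filter] at this
              omega
          rwa [Finset.card_range] at this
        omega
    · rintro ⟨i, hi, j, hj, hjm, h⟩
      right
      by_contra hcon
      push Not at hcon
      have h1 : ∀ i < k, rank m p i < k := fun i hi => by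
        have := hcon i hi
        rw [ranks_getD (by omega)] at this
        omega
      have h2 := (rank_lt_iff (p := p) (j := i) hjm).2 h
      have h3 : ∀ a ∈ insert j (Finset.range k), rank m p a ∈ Finset.range k := fun a ha => by
        rw [Finset.mem_insert, Finset.mem_range] at ha
        rw [Finset.mem_range]
        rcases ha with rfl | ha
        · have := h1 i hi; omega
        · exact h1 a ha
      have h4 : (Finset.range k).card < (insert j (Finset.range k)).card := by
        rw [Finset.card_insert_of_notMem (by rw [Finset.mem_range]; omega)]; omega
      obtain ⟨a, ha, b, hb, hab, he⟩ := Finset.exists_ne_map_eq_of_card_lt_of_maps_to h4 h3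
      rw [Finset.mem_insert, Finset.mem_range] at ha hb
      exact hab (rank_inj hp (by omega) (by omega) he)
  refine ⟨fun h k hk hkm => (key k hk hkm).1 (h k (by omega)), fun h k hkm => ?_⟩
  rcases Nat.eq_zero_or_pos k with rfl | hk
  · exact Or.inl le_rfl
  · exact (key k hk (by omega)).2 (h k hk (by omega))

theorem rank_del {a i : ℕ} (ha : a ≤ m + 1) :
    rank m (del p a) i + (if p a < del p a i then 1 else 0) =
      ((Finset.range (m + 2)).filter fun j => p j < del p a i).card := by
  unfold rank
  rw [Finset.card_filter, Finset.card_filter, Finset.sum_range, Finset.sum_range,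
    Fin.sum_univ_succAbove _ (⟨a, by omega⟩ : Fin (m + 1 + 1)), add_comm]
  congr 1
  refine Finset.sum_congr rfl fun j _ => ?_
  congr 2
  unfold del
  by_cases h : (j : ℕ) < a
  · rw [if_pos h, Fin.succAbove_of_castSucc_lt _ _ (by simpa [Fin.lt_def] using h)]
    rfl
  · rw [if_neg h, Fin.succAbove_of_le_castSucc _ _ (by simpa [Fin.le_def] using h)]
    rfl

/-- Deleting an entry lowers by one exactly the ranks that exceed its own. -/
theorem dropValue_ranks (hp : Inj (m + 1) p) {a : ℕ} (ha : a ≤ m + 1) :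
    dropValue (rank (m + 1) p a) (ranks (m + 1) p) = ranks m (del p a) := by
  have hf : (ranks (m + 1) p).filter (· ≠ rank (m + 1) p a) = (ranks (m + 1) p).eraseIdx a := by
    have h : a < (ranks (m + 1) p).length := by rw [length_ranks]; omega
    rw [← (nodup_ranks hp).erase_getElem a h, (nodup_ranks hp).erase_eq_filter, ranks_getElem]
    refine List.filter_congr fun x _ => ?_
    rw [Bool.eq_iff_iff]; simp
  have hl : ((ranks (m + 1) p).eraseIdx a).length = m + 1 := by
    rw [List.length_eraseIdx_of_lt (by rw [length_ranks]; omega), length_ranks]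
    rfl
  unfold dropValue
  rw [hf]
  refine List.ext_getElem (by rw [List.length_map, hl, length_ranks]) fun i h1 h2 => ?_
  rw [length_ranks] at h2
  rw [List.getElem_map, ranks_getElem, List.getElem_eraseIdx]
  have hk : ∃ k ≤ m + 1, del p a i = p k ∧
      (if h : i < a then (ranks (m + 1) p)[i]'(by rw [length_ranks]; omega) else
        (ranks (m + 1) p)[i + 1]'(by rw [length_ranks]; omega)) = rank (m + 1) p k := by
    split_ifs with h
    · exact ⟨i, by omega, del_lt h, ranks_getElem _⟩
    · exact ⟨i + 1, by omega, del_ge (by omega), ranks_getElem _⟩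
  obtain ⟨k, hk, e1, e2⟩ := hk
  rw [e2]
  have e3 := rank_del (p := p) (i := i) ha
  rw [e1] at e3
  change _ = rank (m + 1) p k at e3
  have h3 := rank_lt_iff (p := p) (j := k) ha
  by_cases h : rank (m + 1) p k ≤ rank (m + 1) p a
  · rw [if_neg (fun h' => by have := h3.2 h'; omega)] at e3
    rw [if_pos h]
    omega
  · rw [if_pos (h3.1 (by omega))] at e3
    rw [if_neg h]
    omega

theorem dropValue_of_lt {v : ℕ} {l : List ℕ} (h : ∀ u ∈ l, u < v) : dropValue v l = l := by
  unfold dropValue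
  rw [List.filter_eq_self.2 fun u hu => by have := h u hu; simp; omega]
  exact (List.map_congr_left fun u hu => if_pos (h u hu).le).trans (List.map_id _)

/-- The code of a pattern. -/
def code (m : ℕ) (p : ℕ → ℤ) : ℕ := codeOf (ranks m p) 1 - 1

theorem codeOf_ranks : codeOf (ranks m p) 1 = code m p + 1 := by
  have := codeOf_pos (ranks m p) one_pos
  unfold code
  omega

theorem code_eq_iff (hm : m ≤ 7) : code m p = code m q ↔ Eqv m p q := by
  rw [← ranks_eq_iff]
  refine ⟨fun h => (codeOf_inj (c := 1) (c' := 1) (by rw [length_ranks, length_ranks]) ?_ ?_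
    (by rw [codeOf_ranks, codeOf_ranks, h])).1, fun h => by unfold code; rw [h]⟩
  all_goals
    intro x hx
    have := mem_ranks_le hx
    omega

theorem scan_ranks (hp : Inj (m + 1) p) {a : ℕ} (ha : a ≤ m + 1) {k : ℕ} :
    scan (rank (m + 1) p a) (ranks (m + 1) p) 0 0 1 = k + 1 ↔
      Con m (del p a) ∧ k = code m (del p a) := by
  classical
  rw [scan_eq, dropValue_ranks hp ha, noFilledPrefix_ranks_iff (inj_del hp a), codeOf_ranks]
  split_ifs with h
  · simp [h, eq_comm]
  · simp [h]

theorem exists_codes (hT : Ctx m T col) : ∃ K : List ℕ, K.length ≤ 3 ∧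
    ∀ w, T w → code m w ∈ K := by
  classical
  let f : Fin 3 → ℕ := fun c => if h : ∃ w, T w ∧ col w = c then code m h.choose else 0
  refine ⟨List.ofFn f, by simp, fun w hw => ?_⟩
  rw [List.mem_ofFn]
  refine ⟨col w, ?_⟩
  have h : ∃ w', T w' ∧ col w' = col w := ⟨w, hw, rfl⟩
  have he : f (col w) = code m h.choose := dif_pos h
  rw [he, code, ranks_eq_iff.2 ((hT.col_iff h.choose_spec.1 hw).1 h.choose_spec.2), code]

theorem not_four_mem_of_noFour (hT : Ctx m T col) (hm : m ≤ 6) (hno : noFour (entries (m + 2)) = true)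
    {F : Fin 4 → ℕ → ℤ} (hF : ∀ i, Mem m T (F i))
    (hne : ∀ i j, i ≠ j → ¬ Eqv (m + 1) (F i) (F j)) : False := by
  classical
  obtain ⟨K, hK, hKT⟩ := exists_codes hT
  have hex : ∀ i, ∃ s, (code (m + 1) (F i), s) ∈ entries (m + 2) ∧ s ≠ [] ∧ s.Nodup ∧ s ⊆ K := by
    intro i
    have hp := (hF i).inj
    obtain ⟨s, h1, h2, h3, -, h5⟩ := childCodes_spec (l := ranks (m + 1) (F i)) hK
      (ranks (m + 1) (F i)) [] List.nodup_nil (List.nil_subset _) fun v hv k hk => by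
        obtain ⟨r, hr, rfl⟩ := List.mem_map.1 hv
        rw [List.mem_range] at hr
        obtain ⟨h1, rfl⟩ := (scan_ranks hp (by omega)).1 hk
        exact hKT _ ((hF i).child r (by omega) h1)
    refine ⟨s, mem_entriesIn (ranks_mem_permutations' hp) ?_ h1, ?_, h2, h3⟩
    · rw [scan_eq, dropValue_of_lt fun u hu => Nat.lt_succ_of_le (mem_ranks_le hu),
        if_pos ((noFilledPrefix_ranks_iff hp).2 (hF i).con), codeOf_ranks]
    · have hL := sL_le m (F i)
      exact List.ne_nil_of_mem (h5 _ (List.mem_map_of_mem (List.mem_range.2 (by omega))) _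
        ((scan_ranks hp (by omega)).2 ⟨con_L hp (hF i).con, rfl⟩))
  choose s h1 h2 h3 h4 using hex
  exact noFour_sound hno hK (e := fun i => (code (m + 1) (F i), s i)) h1
    (fun i j hij h => hne i j hij ((code_eq_iff (by omega)).1 h)) h2 h3 h4

theorem not_four_mem_of_le (hT : Ctx m T col) (hm : 4 ≤ m) {F : Fin 4 → ℕ → ℤ}
    (hF : ∀ i, Mem m T (F i)) (hne : ∀ i j, i ≠ j → ¬ Eqv (m + 1) (F i) (F j)) : False := by
  rcases Nat.lt_or_ge m 6 with h | h
  · have h' : m = 4 ∨ m = 5 := by omega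
    rcases h' with rfl | rfl
    · exact not_four_mem_of_noFour hT (by omega) noFour_six hF hne
    · exact not_four_mem_of_noFour hT (by omega) noFour_seven hF hne
  · exact not_four_mem hT h hF hne

end Pattern

/-! ### Permutations as patterns and the lower bound -/

namespace Pattern

open FinPerm

/-- The pattern of a permutation. -/
def ofPerm {n : ℕ} (π : Equiv.Perm (Fin n)) : ℕ → ℤ :=
  fun i => if h : i < n then ((π ⟨i, h⟩ : ℕ) : ℤ) else 0

theorem ofPerm_val {n : ℕ} (π : Equiv.Perm (Fin n)) (i : Fin n) : ofPerm π i = ((π i : ℕ) : ℤ) :=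
  dif_pos i.2

theorem ofPerm_lt_iff {n : ℕ} (π : Equiv.Perm (Fin n)) (i j : Fin n) :
    ofPerm π i < ofPerm π j ↔ π i < π j := by
  rw [ofPerm_val, ofPerm_val, Nat.cast_lt, Fin.lt_def]

theorem inj_ofPerm {m : ℕ} (π : Equiv.Perm (Fin (m + 1))) : Inj m (ofPerm π) := by
  intro i hi j hj h
  have h1 := ofPerm_val π ⟨i, by omega⟩
  have h2 := ofPerm_val π ⟨j, by omega⟩
  have h3 : π ⟨i, by omega⟩ = π ⟨j, by omega⟩ := by
    apply Fin.ext
    dsimp only at h1 h2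
    omega
  simpa using π.injective h3

/-- The entries below `π i` correspond under `π` to the values smaller than `π i`, of which there
are `π i` since values start at 0. A permutation is thus recovered from its pattern. -/
theorem rank_ofPerm {m : ℕ} (π : Equiv.Perm (Fin (m + 1))) (i : Fin (m + 1)) :
    rank m (ofPerm π) i = π i := by
  have h1 : rank m (ofPerm π) i = (Finset.univ.filter fun j => π j < π i).card := by
    unfold rank
    rw [Finset.card_filter, Finset.card_filter, Finset.sum_range]
    exact Finset.sum_congr rfl fun j _ => if_congr (ofPerm_lt_iff π j i) rfl rfl
  have h2 : (Finset.univ.filter fun j => π j < π i).map π.toEmbedding = Finset.Iio (π i) := by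
    ext v
    simp only [Finset.mem_map, Finset.mem_filter, Finset.mem_univ, true_and, Finset.mem_Iio]
    exact ⟨fun ⟨j, hj, h⟩ => h ▸ hj, fun h => ⟨π.symm v, by simpa using h, by simp⟩⟩
  rw [h1, ← Finset.card_map π.toEmbedding, h2, Fin.card_Iio]

theorem ofPerm_injective {m : ℕ} {π σ : Equiv.Perm (Fin (m + 1))}
    (h : Eqv m (ofPerm π) (ofPerm σ)) : π = σ := by
  refine Equiv.ext fun i => Fin.ext ?_
  have h1 := ranks_eq_iff.2 h
  rw [← rank_ofPerm, ← rank_ofPerm, ← ranks_getD (by omega : (i : ℕ) ≤ m), h1,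
    ranks_getD (by omega)]

theorem exists_ofPerm {m : ℕ} {p : ℕ → ℤ} (hp : Inj m p) :
    ∃ π : Equiv.Perm (Fin (m + 1)), Eqv m (ofPerm π) p := by
  have hb : Function.Bijective fun i : Fin (m + 1) =>
      (⟨rank m p i, by have := rank_le (p := p) (show (i : ℕ) ≤ m by omega); omega⟩ : Fin (m + 1)) :=
    Finite.injective_iff_bijective.1 fun i j h =>
      Fin.ext (rank_inj hp (by omega) (by omega) (Fin.mk.inj_iff.1 h))
  refine ⟨Equiv.ofBijective _ hb, fun i hi j hj => ?_⟩
  rw [ofPerm_lt_iff _ ⟨i, by omega⟩ ⟨j, by omega⟩, ← rank_lt_iff hi]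
  rfl

theorem isSumIndecomposable_iff {m : ℕ} (π : Equiv.Perm (Fin (m + 1))) :
    IsSumIndecomposable ⟨m + 1, π⟩ ↔ Con m (ofPerm π) := by
  constructor
  · intro h k hk hkm
    by_contra hcon
    push Not at hcon
    apply h
    have hlt : ∀ i j : Fin (m + 1), (i : ℕ) < k → k ≤ (j : ℕ) → π i < π j := fun i j hi hj => by
      have h1 := hcon i hi j hj (by omega)
      have h2 := inj_ofPerm π
      have h3 := h2.ne (show (i : ℕ) ≤ m by omega) (show (j : ℕ) ≤ m by omega) (by omega)
      rw [← ofPerm_lt_iff]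
      omega
    obtain ⟨l, hl⟩ : ∃ l, m + 1 = k + l := ⟨m + 1 - k, by omega⟩
    have hl0 : 0 < l := by omega
    -- The length has to be a variable to be replaced by `k + l` in the types.
    generalize m + 1 = n at *
    subst hl
    -- All values up to that of a position in the first block come from the first block, so there
    -- are at most `k` of them. Dually, all `k` values of the first block lie below each value of
    -- the second.
    have low : ∀ i : Fin k, (π (Fin.castAdd l i) : ℕ) < k := fun i => by
      have h1 : (Finset.Iic (π (Fin.castAdd l i))).map π.symm.toEmbedding ⊆
          Finset.univ.map (Fin.castAddEmb l) := fun j hj => by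
        obtain ⟨v, hv, rfl⟩ := Finset.mem_map.1 hj
        rw [Finset.mem_Iic] at hv
        rw [Finset.mem_map]
        by_contra hcon'
        have h2 : k ≤ (π.symm v : ℕ) := by
          by_contra h3
          exact hcon' ⟨⟨π.symm v, by omega⟩, Finset.mem_univ _, rfl⟩
        have := hlt (Fin.castAdd l i) (π.symm v) i.2 h2
        rw [Equiv.apply_symm_apply] at this
        exact absurd this (not_lt.2 hv)
      have h2 := Finset.card_le_card h1
      rw [Finset.card_map, Finset.card_map, Fin.card_Iic, Finset.card_univ, Fintype.card_fin] at h2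
      omega
    have high : ∀ i : Fin l, k ≤ (π (Fin.natAdd k i) : ℕ) := fun i => by
      have h1 : (Finset.univ.map (Fin.castAddEmb l)).map π.toEmbedding ⊆
          Finset.Iio (π (Fin.natAdd k i)) := fun v hv => by
        obtain ⟨j, hj, rfl⟩ := Finset.mem_map.1 hv
        obtain ⟨j, -, rfl⟩ := Finset.mem_map.1 hj
        rw [Finset.mem_Iio]
        exact hlt _ _ j.2 (by simp)
      have h2 := Finset.card_le_card h1
      rwa [Finset.card_map, Finset.card_map, Fin.card_Iio, Finset.card_univ, Fintype.card_fin] at h2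
    have b1 : Function.Bijective fun i : Fin k => (⟨π (Fin.castAdd l i), low i⟩ : Fin k) :=
      Finite.injective_iff_bijective.1 fun i j h => by
        have := π.injective (Fin.ext (Fin.mk.inj_iff.1 h))
        exact Fin.castAdd_injective _ _ this
    have b2 : Function.Bijective fun i : Fin l =>
        (⟨π (Fin.natAdd k i) - k, by have := high i; omega⟩ : Fin l) :=
      Finite.injective_iff_bijective.1 fun i j h => by
        have h1 := Fin.mk.inj_iff.1 h
        have h2 := high i
        have h3 := high j
        have := π.injective (a₁ := Fin.natAdd k i) (a₂ := Fin.natAdd k j) (Fin.ext (by omega))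
        exact Fin.natAdd_injective _ _ this
    refine ⟨k, l, Equiv.ofBijective _ b1, Equiv.ofBijective _ b2, hk, hl0, ?_⟩
    congr 1
    refine Equiv.ext fun i => ?_
    refine Fin.addCases (fun i => ?_) (fun i => ?_) i
    · rw [directSum_castAdd]; exact Fin.ext rfl
    · rw [directSum_natAdd]
      refine Fin.ext ?_
      have := high i
      simp
      omega
  · rintro hc ⟨k, l, π', σ, hk, hl, he⟩
    generalize hn : m + 1 = n at *
    cases he
    obtain ⟨i, hi, j, hj, hjm, hlt⟩ := hc k hk (by omega)
    have e1 : ofPerm (directSum π' σ) i = ((π' ⟨i, hi⟩ : ℕ) : ℤ) := by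
      have := ofPerm_val (directSum π' σ) (Fin.castAdd l ⟨i, hi⟩)
      rw [directSum_castAdd] at this
      exact this
    have e2 : (k : ℤ) ≤ ofPerm (directSum π' σ) j := by
      have := ofPerm_val (directSum π' σ) (Fin.natAdd k ⟨j - k, by omega⟩)
      rw [directSum_natAdd] at this
      simp only [Fin.val_natAdd, Nat.add_sub_cancel' hj] at this
      rw [this]
      push_cast
      omega
    have := (π' ⟨i, hi⟩).2
    omega

theorem isContained_of_del {m r : ℕ} (hr : r ≤ m + 1) {π : Equiv.Perm (Fin (m + 2))}
    {τ : Equiv.Perm (Fin (m + 1))} (h : Eqv m (ofPerm τ) (del (ofPerm π) r)) :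
    IsContained ⟨m + 1, τ⟩ ⟨m + 2, π⟩ := by
  have hv : ∀ i : Fin (m + 1), del (ofPerm π) r i =
      ofPerm π ((⟨r, by omega⟩ : Fin (m + 2)).succAbove i) := fun i => by
    unfold del
    by_cases hi : (i : ℕ) < r
    · rw [if_pos hi, Fin.succAbove_of_castSucc_lt _ _ (by simpa [Fin.lt_def] using hi)]
      rfl
    · rw [if_neg hi, Fin.succAbove_of_le_castSucc _ _ (by simpa [Fin.le_def] using hi)]
      rfl
  refine ⟨(Fin.succAboveOrderEmb ⟨r, by omega⟩ : Fin (m + 1) ↪o Fin (m + 2)),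
    fun (i j : Fin (m + 1)) => ?_⟩
  have h1 := h i (by omega) j (by omega)
  rw [hv, hv, ofPerm_lt_iff, ofPerm_lt_iff] at h1
  exact h1

theorem four_le_of_four_le {C : Set FinPerm} (hC : IsClass C) {m : ℕ} (hm : 4 ≤ m)
    (h : 4 ≤ numSumIndecomposables C (m + 2)) : 4 ≤ numSumIndecomposables C (m + 1) := by
  classical
  by_contra hlt
  unfold numSumIndecomposables at h hlt
  set S := sumIndecomposables C (m + 1) with hS
  obtain ⟨g⟩ : Nonempty (S ↪ Fin 3) := Function.Embedding.nonempty_of_card_le (by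
    rw [Fintype.card_fin, ← Nat.card_eq_fintype_card, Nat.card_coe_set_eq]; omega)
  obtain ⟨f⟩ : Nonempty (Fin 4 ↪ sumIndecomposables C (m + 2)) :=
    Function.Embedding.nonempty_of_card_le (by
      rw [Fintype.card_fin, ← Nat.card_eq_fintype_card, Nat.card_coe_set_eq]; omega)
  -- `T` consists of the patterns of the indecomposables of length `m + 1` in the class, and an
  -- injection of these into `Fin 3` colours them. The default colour 0 outside `T` is never used.
  let T : (ℕ → ℤ) → Prop := fun x => ∃ τ : S, Eqv m (ofPerm τ.1) x
  let col : (ℕ → ℤ) → Fin 3 := fun x => if h : T x then g h.choose else 0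
  have hT : Ctx m T col := by
    refine ⟨fun ⟨τ, h⟩ he => ⟨τ, h.trans he⟩, fun {x y} hx hy => ?_⟩
    have e1 : col x = g hx.choose := dif_pos hx
    have e2 : col y = g hy.choose := dif_pos hy
    rw [e1, e2, g.injective.eq_iff]
    constructor
    · intro h
      have := hy.choose_spec
      rw [← h] at this
      exact hx.choose_spec.symm.trans this
    · exact fun h => Subtype.ext (ofPerm_injective
        ((hx.choose_spec.trans h).trans hy.choose_spec.symm))
  refine not_four_mem_of_le hT hm (F := fun i => ofPerm (f i).1) (fun i => ?_) fun i j hij he =>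
    hij (f.injective (Subtype.ext (ofPerm_injective he)))
  obtain ⟨π, hπC, hπ⟩ := f i
  refine ⟨inj_ofPerm π, (isSumIndecomposable_iff π).1 hπ, fun r hr hc => ?_⟩
  obtain ⟨τ, hτ⟩ := exists_ofPerm (inj_del (inj_ofPerm π) r)
  exact ⟨⟨τ, hC _ hπC _ (isContained_of_del hr hτ),
    (isSumIndecomposable_iff τ).2 (hτ.symm.con hc)⟩, hτ⟩

end Pattern

/-! ### The class generated by finitely many permutations -/

namespace Pattern

open FinPerm

/-- The embedding misses exactly one index `r`, and an increasing map is determined by its range. -/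
theorem eqv_ofPerm_of_isContained {m : ℕ} {π : Equiv.Perm (Fin (m + 2))}
    {τ : Equiv.Perm (Fin (m + 1))} (h : IsContained ⟨m + 1, τ⟩ ⟨m + 2, π⟩) :
    ∃ r ≤ m + 1, Eqv m (ofPerm τ) (del (ofPerm π) r) := by
  obtain ⟨e, he⟩ := h
  change Fin (m + 1) ↪o Fin (m + 2) at e
  obtain ⟨r, hr⟩ : ∃ r, r ∉ Set.range e := by
    by_contra hcon
    push Not at hcon
    have := Fintype.card_le_of_surjective e fun r => hcon r
    simp at this
  have hrange : Set.range e = Set.range r.succAbove := by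
    rw [Fin.range_succAbove]
    refine Set.eq_of_subset_of_ncard_le (fun v hv => ?_) ?_
    · rintro rfl; exact hr hv
    · rw [Set.ncard_compl, ← Nat.card_coe_set_eq (Set.range e),
        Nat.card_range_of_injective e.injective]
      simp
  have heq : ⇑e = r.succAbove :=
    StrictMono.range_inj e.strictMono (Fin.strictMono_succAbove r) |>.1 hrange
  refine ⟨r, by omega, fun i hi j hj => ?_⟩
  have h1 : τ (⟨i, by omega⟩ : Fin (m + 1)) < τ (⟨j, by omega⟩ : Fin (m + 1)) ↔
      π (e ⟨i, by omega⟩) < π (e ⟨j, by omega⟩) :=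
    he (⟨i, by omega⟩ : Fin (m + 1)) (⟨j, by omega⟩ : Fin (m + 1))
  have hv : ∀ i (hi : i ≤ m), ofPerm π (e ⟨i, by omega⟩) = del (ofPerm π) r i := fun i hi => by
    rw [heq]
    unfold del
    by_cases hir : i < r
    · rw [if_pos hir, Fin.succAbove_of_castSucc_lt _ _ (by simpa [Fin.lt_def] using hir)]
      rfl
    · rw [if_neg hir, Fin.succAbove_of_le_castSucc _ _ (by simpa [Fin.le_def] using hir)]
      rfl
  rw [← hv i hi, ← hv j hj, ofPerm_lt_iff, ← h1, ofPerm_lt_iff τ ⟨i, by omega⟩ ⟨j, by omega⟩]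

theorem isContained_trans {ρ σ τ : FinPerm} (h : IsContained ρ σ) (h' : IsContained σ τ) :
    IsContained ρ τ := by
  obtain ⟨e, he⟩ := h
  obtain ⟨f, hf⟩ := h'
  exact ⟨e.trans f, fun i j => (he i j).trans (hf _ _)⟩

theorem eq_of_isContained {m : ℕ} {π τ : Equiv.Perm (Fin (m + 1))}
    (h : IsContained ⟨m + 1, τ⟩ ⟨m + 1, π⟩) : τ = π := by
  obtain ⟨e, he⟩ := h
  change Fin (m + 1) ↪o Fin (m + 1) at e
  have hid : ⇑e = id := by
    refine StrictMono.range_inj e.strictMono strictMono_id |>.1 ?_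
    rw [Set.range_id, Set.range_eq_univ]
    exact Finite.injective_iff_surjective.1 e.injective
  refine ofPerm_injective fun i hi j hj => ?_
  rw [ofPerm_lt_iff τ ⟨i, by omega⟩ ⟨j, by omega⟩, ofPerm_lt_iff π ⟨i, by omega⟩ ⟨j, by omega⟩]
  refine (he _ _).trans ?_
  change π (e _) < π (e _) ↔ _
  rw [hid]
  rfl

/-- The class generated by finitely many patterns with known children. -/
theorem exists_class {m a b : ℕ} {P : Fin a → ℕ → ℤ} {Q : Fin b → ℕ → ℤ}
    (iP : ∀ i, Inj (m + 1) (P i)) (cP : ∀ i, Con (m + 1) (P i))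
    (nP : ∀ i j, Eqv (m + 1) (P i) (P j) → i = j)
    (iQ : ∀ j, Inj m (Q j)) (cQ : ∀ j, Con m (Q j)) (nQ : ∀ i j, Eqv m (Q i) (Q j) → i = j)
    (hc : ∀ i, ∀ r ≤ m + 1, Con m (del (P i) r) → ∃ j, Eqv m (del (P i) r) (Q j))
    (hp : ∀ j, ∃ i, ∃ r ≤ m + 1, Eqv m (Q j) (del (P i) r)) :
    ∃ C : Set FinPerm, IsClass C ∧ numSumIndecomposables C (m + 2) = a ∧
      numSumIndecomposables C (m + 1) = b := by
  choose π hπ using fun i => exists_ofPerm (iP i)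
  choose τ hτ using fun j => exists_ofPerm (iQ j)
  refine ⟨{σ | ∃ i, IsContained σ ⟨m + 2, π i⟩},
    fun σ ⟨i, hi⟩ ρ hρ => ⟨i, isContained_trans hρ hi⟩, ?_, ?_⟩
  · have : sumIndecomposables {σ | ∃ i, IsContained σ ⟨m + 2, π i⟩} (m + 2) = Set.range π := by
      ext σ
      constructor
      · rintro ⟨⟨i, hi⟩, -⟩
        exact ⟨i, (eq_of_isContained hi).symm⟩
      · rintro ⟨i, rfl⟩
        exact ⟨⟨i, RelEmbedding.refl _, fun _ _ => Iff.rfl⟩,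
          (isSumIndecomposable_iff _).2 ((hπ i).symm.con (cP i))⟩
    unfold numSumIndecomposables
    rw [this, ← Nat.card_coe_set_eq, Nat.card_range_of_injective, Nat.card_fin]
    intro i j h
    refine nP i j ((hπ i).symm.trans ?_)
    rw [h]
    exact hπ j
  · have : sumIndecomposables {σ | ∃ i, IsContained σ ⟨m + 2, π i⟩} (m + 1) = Set.range τ := by
      ext σ
      constructor
      · rintro ⟨⟨i, hi⟩, hσ⟩
        obtain ⟨r, hr, he⟩ := eqv_ofPerm_of_isContained hi
        have he' := he.trans (eqv_del (hπ i) r)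
        obtain ⟨j, hj⟩ := hc i r hr (he'.con ((isSumIndecomposable_iff _).1 hσ))
        exact ⟨j, ofPerm_injective ((hτ j).trans (he'.trans hj).symm)⟩
      · rintro ⟨j, rfl⟩
        obtain ⟨i, r, hr, he⟩ := hp j
        exact ⟨⟨i, isContained_of_del hr ((hτ j).trans (he.trans (eqv_del (hπ i) r).symm))⟩,
          (isSumIndecomposable_iff _).2 ((hτ j).symm.con (cQ j))⟩
    unfold numSumIndecomposables
    rw [this, ← Nat.card_coe_set_eq, Nat.card_range_of_injective, Nat.card_fin]
    intro i j h
    refine nQ i j ((hτ i).symm.trans ?_)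
    rw [h]
    exact hτ j

end Pattern

/-! ### Point sets along an increasing oscillation and their inversion graphs -/

namespace Pattern

variable {m : ℕ} {p q : ℕ → ℤ} {S S' : Finset ℕ} {u v w : ℕ}

/-- The horizontal coordinate of the points of an increasing oscillation (even points), each
accompanied by a twin (odd points). -/
def px (v : ℕ) : ℤ := if v % 4 < 2 then v + 2 else v - 2

/-- The vertical coordinate of the points of an increasing oscillation (even points), each
accompanied by a twin (odd points). -/
def py (v : ℕ) : ℤ := if v % 4 < 2 then v + 2 else v + 6

theorem px_inj (h : px u = px v) : u = v := by
  unfold px at h; split_ifs at h <;> omega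

theorem py_inj (h : py u = py v) : u = v := by
  unfold py at h; split_ifs at h <;> omega

theorem px_lt_of_gap (h : u / 2 + 2 ≤ v / 2) : px u < px v := by
  unfold px; split_ifs <;> omega

theorem py_lt_of_gap (h : u / 2 + 2 ≤ v / 2) : py u < py v := by
  unfold py; split_ifs <;> omega

/-- The pattern `p` reads the points of `S` from left to right, using `e`. -/
def DrawsBy (m : ℕ) (p : ℕ → ℤ) (S : Finset ℕ) (e : ℕ → ℕ) : Prop :=
  (∀ v, v ∈ S ↔ ∃ i ≤ m, e i = v) ∧ (∀ i j, i < j → j ≤ m → px (e i) < px (e j)) ∧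
    ∀ i ≤ m, ∀ j ≤ m, (p i < p j ↔ py (e i) < py (e j))

def Draws (m : ℕ) (p : ℕ → ℤ) (S : Finset ℕ) : Prop := ∃ e, DrawsBy m p S e

theorem DrawsBy.inj {e : ℕ → ℕ} (h : DrawsBy m p S e) {i j : ℕ} (hi : i ≤ m) (hj : j ≤ m)
    (hij : e i = e j) : i = j := by
  rcases lt_trichotomy i j with h1 | h1 | h1
  · have := h.2.1 i j h1 hj; rw [hij] at this; omega
  · exact h1
  · have := h.2.1 j i h1 hi; rw [hij] at this; omega

theorem DrawsBy.lt_iff {e : ℕ → ℕ} (h : DrawsBy m p S e) {i j : ℕ} (hi : i ≤ m) (hj : j ≤ m) :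
    px (e i) < px (e j) ↔ i < j := by
  rcases lt_trichotomy i j with h1 | h1 | h1
  · have := h.2.1 i j h1 hj; omega
  · subst h1; simp
  · have := h.2.1 j i h1 hi; omega

theorem DrawsBy.card_filter {e : ℕ → ℕ} (h : DrawsBy m p S e) {P : ℕ → Prop} [DecidablePred P] :
    (S.filter P).card = ((Finset.range (m + 1)).filter fun i => P (e i)).card := by
  symm
  refine Finset.card_bij (fun i _ => e i) (fun i hi => ?_) (fun i hi j hj hij => ?_) fun v hv => ?_
  · rw [Finset.mem_filter, Finset.mem_range] at hi
    rw [Finset.mem_filter]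
    exact ⟨(h.1 _).2 ⟨i, by omega, rfl⟩, hi.2⟩
  · rw [Finset.mem_filter, Finset.mem_range] at hi hj
    exact h.inj (by omega) (by omega) hij
  · rw [Finset.mem_filter] at hv
    obtain ⟨i, hi, rfl⟩ := (h.1 v).1 hv.1
    exact ⟨i, by rw [Finset.mem_filter, Finset.mem_range]; exact ⟨by omega, hv.2⟩, rfl⟩

theorem DrawsBy.index {e : ℕ → ℕ} (h : DrawsBy m p S e) {i : ℕ} (hi : i ≤ m) :
    (S.filter fun v => px v < px (e i)).card = i := by
  rw [h.card_filter]
  have : ((Finset.range (m + 1)).filter fun j => px (e j) < px (e i)) = Finset.range i := by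
    ext j
    rw [Finset.mem_filter, Finset.mem_range, Finset.mem_range]
    constructor
    · rintro ⟨h1, h2⟩; exact (h.lt_iff (by omega) hi).1 h2
    · intro h1; exact ⟨by omega, (h.lt_iff (by omega) hi).2 h1⟩
  rw [this, Finset.card_range]

/-- The index of a point is the number of points of `S` to its left, so the reading order is
determined by `S`. -/
theorem Draws.eqv (hp : Draws m p S) (hq : Draws m q S) : Eqv m p q := by
  obtain ⟨e, he⟩ := hp
  obtain ⟨f, hf⟩ := hq
  have key : ∀ i ≤ m, e i = f i := fun i hi => by
    obtain ⟨j, hj, h1⟩ := (hf.1 _).1 ((he.1 _).2 ⟨i, hi, rfl⟩)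
    have h2 := he.index hi
    rw [← h1, hf.index hj] at h2
    rw [← h1, h2]
  intro i hi j hj
  rw [he.2.2 i hi j hj, hf.2.2 i hi j hj, key i hi, key j hj]

theorem exists_draws (h : S.card = m + 1) : ∃ p, Inj m p ∧ Draws m p S := by
  have hc : (S.image px).card = m + 1 := by
    rw [Finset.card_image_of_injective _ fun _ _ => px_inj, h]
  have hmem : ∀ i : Fin (m + 1), ∃ v ∈ S, px v = (S.image px).orderEmbOfFin hc i := fun i =>
    Finset.mem_image.1 (Finset.orderEmbOfFin_mem _ hc i)
  choose e he1 he2 using hmem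
  have hlt : ∀ i j : Fin (m + 1), i < j → px (e i) < px (e j) := fun i j hij => by
    rw [he2, he2]
    exact (OrderEmbedding.lt_iff_lt _).2 hij
  let e' : ℕ → ℕ := fun i => if h : i < m + 1 then e ⟨i, h⟩ else 0
  have he' : ∀ i (h : i ≤ m), e' i = e ⟨i, by omega⟩ := fun i h => dif_pos (by omega)
  have hd : DrawsBy m (fun i => py (e' i)) S e' := by
    refine ⟨fun v => ⟨fun hv => ?_, ?_⟩, fun i j hij hj => ?_, fun i hi j hj => Iff.rfl⟩
    · have h1 : px v ∈ Set.range ((S.image px).orderEmbOfFin hc) := by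
        rw [Finset.range_orderEmbOfFin]
        exact Finset.mem_coe.2 (Finset.mem_image_of_mem _ hv)
      obtain ⟨i, hi⟩ := h1
      refine ⟨i, by omega, ?_⟩
      rw [he' i (by omega)]
      exact px_inj ((he2 i).trans hi)
    · rintro ⟨i, hi, rfl⟩
      rw [he' i hi]
      exact he1 _
    · rw [he' i (by omega), he' j hj]
      exact hlt _ _ hij
  exact ⟨_, fun i hi j hj hij => hd.inj hi hj (py_inj hij), e', hd⟩

theorem DrawsBy.del {e : ℕ → ℕ} (h : DrawsBy (m + 1) p S e) {r : ℕ} (hr : r ≤ m + 1) :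
    Draws m (del p r) (S.erase (e r)) := by
  refine ⟨fun i => if i < r then e i else e (i + 1), fun v => ?_, fun i j hij hj => ?_,
    fun i hi j hj => ?_⟩
  · rw [Finset.mem_erase, h.1]
    constructor
    · rintro ⟨hne, i, hi, rfl⟩
      have hir : i ≠ r := fun h => hne (h ▸ rfl)
      rcases lt_or_gt_of_ne hir with h1 | h1
      · exact ⟨i, by omega, if_pos h1⟩
      · refine ⟨i - 1, by omega, ?_⟩
        dsimp only
        rw [if_neg (by omega), Nat.sub_add_cancel (by omega)]
    · rintro ⟨i, hi, rfl⟩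
      dsimp only
      split_ifs with h1
      · exact ⟨fun h2 => by have := h.inj (by omega) hr h2; omega, i, by omega, rfl⟩
      · exact ⟨fun h2 => by have := h.inj (by omega) hr h2; omega, i + 1, by omega, rfl⟩
  · dsimp only
    split_ifs <;> first | omega | exact h.2.1 _ _ (by omega) (by omega)
  · unfold Pattern.del
    dsimp only
    split_ifs <;> exact h.2.2 _ (by omega) _ (by omega)

theorem Draws.exists_erase (h : Draws (m + 1) p S) (hv : v ∈ S) :
    ∃ r ≤ m + 1, Draws m (del p r) (S.erase v) := by
  obtain ⟨e, he⟩ := h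
  obtain ⟨r, hr, rfl⟩ := (he.1 v).1 hv
  exact ⟨r, hr, he.del hr⟩

theorem Draws.del (h : Draws (m + 1) p S) {r : ℕ} (hr : r ≤ m + 1) :
    ∃ v ∈ S, Draws m (del p r) (S.erase v) := by
  obtain ⟨e, he⟩ := h
  exact ⟨e r, (he.1 _).2 ⟨r, hr, rfl⟩, he.del hr⟩

theorem Draws.image (h : Draws m p S) {f : ℕ → ℕ}
    (hf : ∀ u ∈ S, ∀ v ∈ S, (px u < px v → px (f u) < px (f v)) ∧
      (py u < py v ↔ py (f u) < py (f v))) (hS : ∀ v, v ∈ S' ↔ ∃ u ∈ S, f u = v) :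
    Draws m p S' := by
  obtain ⟨e, he⟩ := h
  have hm : ∀ i ≤ m, e i ∈ S := fun i hi => (he.1 _).2 ⟨i, hi, rfl⟩
  refine ⟨fun i => f (e i), fun v => ?_, fun i j hij hj => ?_, fun i hi j hj => ?_⟩
  · rw [hS]
    constructor
    · rintro ⟨u, hu, rfl⟩
      obtain ⟨i, hi, rfl⟩ := (he.1 _).1 hu
      exact ⟨i, hi, rfl⟩
    · rintro ⟨i, hi, rfl⟩
      exact ⟨e i, hm i hi, rfl⟩
  · exact (hf _ (hm i (by omega)) _ (hm j hj)).1 (he.2.1 i j hij hj)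
  · rw [he.2.2 i hi j hj]
    exact (hf _ (hm i hi) _ (hm j hj)).2

/-- The oscillation repeats after two steps, and each step takes two numbers, one for the point and
one for its twin. -/
theorem Draws.shift (h : Draws m p S) (h4 : ∀ v ∈ S, 4 ≤ v) (hS : ∀ v, v ∈ S' ↔ v + 4 ∈ S) :
    Draws m p S' := by
  refine h.image (f := fun v => v - 4) (fun u hu v hv => ?_) fun v => ?_
  · have := h4 u hu
    have := h4 v hv
    unfold px py
    constructor <;> split_ifs <;> omega
  · rw [hS]
    constructor
    · exact fun h => ⟨_, h, by simp⟩
    · rintro ⟨u, hu, rfl⟩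
      rwa [Nat.sub_add_cancel (h4 u hu)]

/-- A point and its twin are adjacent in both coordinates, so either can stand for the other when
only one is present. -/
theorem Draws.twin (h : Draws m p S) {t : ℕ} (ht : t % 2 = 1) (htS : t ∈ S) (ht' : t - 1 ∉ S)
    (hS : ∀ v, v ∈ S' ↔ (v ∈ S ∧ v ≠ t) ∨ v = t - 1) : Draws m p S' := by
  refine h.image (f := fun v => if v = t then t - 1 else v) (fun u hu v hv => ?_) fun v => ?_
  · have hu' : u ≠ t - 1 := fun h => ht' (h ▸ hu)
    have hv' : v ≠ t - 1 := fun h => ht' (h ▸ hv)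
    by_cases h1 : u = t <;> by_cases h2 : v = t <;> simp only [h1, h2, if_true, if_false]
    · simp
    on_goal 3 => simp
    all_goals unfold px py; constructor <;> split_ifs <;> omega
  · rw [hS]
    constructor
    · rintro (⟨h1, h2⟩ | rfl)
      · exact ⟨v, h1, if_neg h2⟩
      · exact ⟨t, htS, if_pos rfl⟩
    · rintro ⟨u, hu, rfl⟩
      split_ifs with h1
      · exact Or.inr rfl
      · exact Or.inl ⟨hu, h1⟩

/-- Two points form an inversion. -/
def Cross (u v : ℕ) : Prop := (px u < px v ∧ py v < py u) ∨ (px v < px u ∧ py u < py v)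

theorem Cross.symm (h : Cross u v) : Cross v u := Or.symm h

theorem cross_of_succ (h : v / 2 = u / 2 + 1) : Cross u v := by
  unfold Cross px py; split_ifs <;> omega

theorem Cross.near (h : Cross u v) : u / 2 = v / 2 + 1 ∨ v / 2 = u / 2 + 1 := by
  unfold Cross px py at h; split_ifs at h <;> omega

/-- Steps of the oscillation at distance at least two lie in increasing position. If the step `w` is
missing, everything before it lies to the left of and below everything after it. -/
theorem Draws.not_con (h : Draws m p S) (hu : u ∈ S) (hv : v ∈ S) (hw : ∀ x ∈ S, x / 2 ≠ w)
    (huw : u / 2 < w) (hvw : w < v / 2) : ¬ Con m p := by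
  intro hc
  obtain ⟨e, he⟩ := h
  have hm : ∀ i ≤ m, e i ∈ S := fun i hi => (he.1 _).2 ⟨i, hi, rfl⟩
  obtain ⟨i, hi, rfl⟩ := (he.1 _).1 hu
  have hex : ∃ j, j ≤ m ∧ w < e j / 2 := by
    obtain ⟨j, hj, rfl⟩ := (he.1 _).1 hv
    exact ⟨j, hj, hvw⟩
  classical
  have hj := Nat.find_spec hex
  have hmin : ∀ k < Nat.find hex, k ≤ m → e k / 2 < w := fun k hk hkm => by
    have h1 := Nat.find_min hex hk
    have h2 := hw _ (hm k hkm)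
    push Not at h1
    have := h1 hkm
    omega
  set j := Nat.find hex
  have hij : i < j := (he.lt_iff hi hj.1).1 (px_lt_of_gap (by omega))
  obtain ⟨a, ha, b, hb, hbm, hlt⟩ := hc j (by omega) hj.1
  have h1 := hmin a ha (by omega)
  have h2 : w < e b / 2 := by
    by_contra hcon
    have h2 := hw _ (hm b hbm)
    have := (he.lt_iff hbm hj.1).1 (px_lt_of_gap (by omega))
    omega
  have := (he.2.2 b hbm a (by omega)).1 hlt
  have := py_lt_of_gap (u := e a) (v := e b) (by omega)
  omega

/-- The inversion graph of `S` is connected. -/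
def Linked (S : Finset ℕ) : Prop :=
  ∀ Q : ℕ → Prop, (∀ u ∈ S, ∀ v ∈ S, Cross u v → (Q u ↔ Q v)) → ∀ u ∈ S, ∀ v ∈ S, (Q u ↔ Q v)

theorem Linked.insert (h : Linked S) (hu : u ∈ S) (hv : Cross u v) : Linked (insert v S) := by
  intro Q hQ a ha b hb
  have h1 := h Q fun a ha b hb => hQ a (Finset.mem_insert_of_mem ha) b (Finset.mem_insert_of_mem hb)
  have h2 := hQ u (Finset.mem_insert_of_mem hu) v (Finset.mem_insert_self v S) hv
  have key : ∀ a ∈ Insert.insert v S, (Q a ↔ Q u) := fun a ha => by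
    rcases Finset.mem_insert.1 ha with rfl | ha
    · exact h2.symm
    · exact h1 a ha u hu
  exact (key a ha).trans (key b hb).symm

theorem Linked.singleton (v : ℕ) : Linked {v} := by
  intro Q _ a ha b hb
  rw [Finset.mem_singleton] at ha hb
  rw [ha, hb]

/-- If no inversion crossed a gap, being read before the gap would be invariant under inversions and
so constant on a connected inversion graph. -/
theorem Draws.con (h : Draws m p S) (hS : Linked S) : Con m p := by
  obtain ⟨e, he⟩ := h
  have hm : ∀ i ≤ m, e i ∈ S := fun i hi => (he.1 _).2 ⟨i, hi, rfl⟩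
  intro k hk hkm
  by_contra hcon
  push Not at hcon
  have key := hS (fun v => ∃ i < k, e i = v) (fun u hu v hv huv => ?_) _ (hm 0 (by omega)) _
    (hm k hkm)
  · obtain ⟨i, hi, h1⟩ := key.1 ⟨0, hk, rfl⟩
    have := he.inj (by omega) hkm h1
    omega
  · have half : ∀ {u v}, u ∈ S → v ∈ S → Cross u v → (∃ i < k, e i = u) → ∃ i < k, e i = v := by
      rintro _ v hu hv huv ⟨i, hi, rfl⟩
      obtain ⟨j, hj, rfl⟩ := (he.1 v).1 hv
      by_contra hno
      have hjk : k ≤ j := by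
        by_contra h1
        exact hno ⟨j, by omega, rfl⟩
      have h1 := hcon i hi j hjk hj
      have h2 := he.2.1 i j (by omega) hj
      have h3 := he.2.2 j hj i (by omega)
      rcases huv with ⟨-, h4⟩ | ⟨h4, -⟩ <;> omega
    exact ⟨half hu hv huv, half hv hu huv.symm⟩

theorem Draws.rank_zero (h : Draws m p S) (hv : v ∈ S) (hmin : ∀ u ∈ S, px v ≤ px u) :
    rank m p 0 = (S.filter fun u => py u < py v).card := by
  obtain ⟨e, he⟩ := h
  have h0 : e 0 = v := by
    obtain ⟨i, hi, rfl⟩ := (he.1 _).1 hv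
    have h1 := hmin _ ((he.1 _).2 ⟨0, by omega, rfl⟩)
    rcases Nat.eq_zero_or_pos i with rfl | h2
    · rfl
    · have := he.2.1 0 i h2 hi
      omega
  subst h0
  rw [he.card_filter]
  refine congrArg Finset.card (Finset.filter_congr fun j hj => ?_)
  rw [Finset.mem_range] at hj
  exact he.2.2 j (by omega) 0 (by omega)

/-- Two entries form an inversion. -/
def Inversion (p : ℕ → ℤ) (i j : ℕ) : Prop := (i < j ∧ p j < p i) ∨ (j < i ∧ p i < p j)

/-- Some entry takes part in three inversions. -/
def Claw (m : ℕ) (p : ℕ → ℤ) : Prop :=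
  ∃ i ≤ m, ∃ a ≤ m, ∃ b ≤ m, ∃ c ≤ m, a ≠ b ∧ a ≠ c ∧ b ≠ c ∧
    Inversion p i a ∧ Inversion p i b ∧ Inversion p i c

theorem Claw.eqv (h : Claw m p) (he : Eqv m p q) : Claw m q := by
  obtain ⟨i, hi, a, ha, b, hb, c, hc, h1, h2, h3, h4, h5, h6⟩ := h
  have key : ∀ a ≤ m, Inversion p i a → Inversion q i a := fun a ha h =>
    h.imp (fun h => ⟨h.1, (he a ha i hi).1 h.2⟩) fun h => ⟨h.1, (he i hi a ha).1 h.2⟩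
  exact ⟨i, hi, a, ha, b, hb, c, hc, h1, h2, h3, key a ha h4, key b hb h5, key c hc h6⟩

theorem DrawsBy.inversion_iff {e : ℕ → ℕ} (h : DrawsBy m p S e) {i j : ℕ} (hi : i ≤ m)
    (hj : j ≤ m) : Inversion p i j ↔ Cross (e i) (e j) := by
  unfold Inversion Cross
  rw [h.lt_iff hi hj, h.lt_iff hj hi, h.2.2 i hi j hj, h.2.2 j hj i hi]

theorem Draws.claw_iff (h : Draws m p S) : Claw m p ↔ ∃ u ∈ S, ∃ a ∈ S, ∃ b ∈ S, ∃ c ∈ S,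
    a ≠ b ∧ a ≠ c ∧ b ≠ c ∧ Cross u a ∧ Cross u b ∧ Cross u c := by
  obtain ⟨e, he⟩ := h
  have hm : ∀ i ≤ m, e i ∈ S := fun i hi => (he.1 _).2 ⟨i, hi, rfl⟩
  constructor
  · rintro ⟨i, hi, a, ha, b, hb, c, hc, h1, h2, h3, h4, h5, h6⟩
    exact ⟨e i, hm i hi, e a, hm a ha, e b, hm b hb, e c, hm c hc, fun h => h1 (he.inj ha hb h),
      fun h => h2 (he.inj ha hc h), fun h => h3 (he.inj hb hc h), (he.inversion_iff hi ha).1 h4,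
      (he.inversion_iff hi hb).1 h5, (he.inversion_iff hi hc).1 h6⟩
  · rintro ⟨u, hu, a, ha, b, hb, c, hc, h1, h2, h3, h4, h5, h6⟩
    obtain ⟨i, hi, rfl⟩ := (he.1 _).1 hu
    obtain ⟨a, ha', rfl⟩ := (he.1 _).1 ha
    obtain ⟨b, hb', rfl⟩ := (he.1 _).1 hb
    obtain ⟨c, hc', rfl⟩ := (he.1 _).1 hc
    exact ⟨i, hi, a, ha', b, hb', c, hc', fun h => h1 (h ▸ rfl), fun h => h2 (h ▸ rfl),
      fun h => h3 (h ▸ rfl), (he.inversion_iff hi ha').2 h4,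
      (he.inversion_iff hi hb').2 h5, (he.inversion_iff hi hc').2 h6⟩

end Pattern

/-! ### Five indecomposables above four -/

namespace Pattern

variable {m : ℕ} {p q : ℕ → ℤ} {S S' : Finset ℕ} {u v w : ℕ}

/-- A path of `c` points of the increasing oscillation. -/
def path (a c : ℕ) : Finset ℕ := (Finset.range c).image fun i => 2 * (a + i)

theorem mem_path {a c : ℕ} : v ∈ path a c ↔ v % 2 = 0 ∧ 2 * a ≤ v ∧ v < 2 * (a + c) := by
  unfold path
  rw [Finset.mem_image]
  constructor
  · rintro ⟨i, hi, rfl⟩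
    rw [Finset.mem_range] at hi
    omega
  · rintro ⟨h1, h2, h3⟩
    exact ⟨v / 2 - a, by rw [Finset.mem_range]; omega, by omega⟩

theorem card_path (a c : ℕ) : (path a c).card = c := by
  unfold path
  rw [Finset.card_image_of_injective, Finset.card_range]
  intro i j h
  dsimp only at h
  omega

theorem linked_path (a c : ℕ) : Linked (path a c) := by
  induction c with
  | zero => intro Q _ u hu; rw [mem_path] at hu; omega
  | succ c ih =>
    have he : path a (c + 1) = insert (2 * (a + c)) (path a c) := by
      ext v
      rw [Finset.mem_insert, mem_path, mem_path]
      omega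
    rcases Nat.eq_zero_or_pos c with rfl | hc
    · have : path a 1 = {2 * a} := by
        ext v
        rw [Finset.mem_singleton, mem_path]
        omega
      rw [this]
      exact Linked.singleton _
    · rw [he]
      exact ih.insert (u := 2 * (a + c - 1)) (by rw [mem_path]; omega) (cross_of_succ (by omega))

/-- Two oscillations, and three oscillations with doubled end points. -/
def big (m : ℕ) : Fin 5 → Finset ℕ
  | 0 => path 0 (m + 2)
  | 1 => path 1 (m + 2)
  | 2 => insert 1 (path 0 (m + 1))
  | 3 => insert (2 * m + 3) (path 1 (m + 1))
  | 4 => insert 1 (insert (2 * m - 1) (path 0 m))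

/-- Two oscillations, and two oscillations with a doubled end point. -/
def small (m : ℕ) : Fin 4 → Finset ℕ
  | 0 => path 0 (m + 1)
  | 1 => path 1 (m + 1)
  | 2 => insert 1 (path 0 m)
  | 3 => insert (2 * m - 1) (path 0 m)

theorem card_big (hm : 4 ≤ m) : ∀ i, (big m i).card = m + 2
  | 0 => card_path _ _
  | 1 => card_path _ _
  | 2 => by
    unfold big
    rw [Finset.card_insert_of_notMem (by rw [mem_path]; omega), card_path]
  | 3 => by
    unfold big
    rw [Finset.card_insert_of_notMem (by rw [mem_path]; omega), card_path]
  | 4 => by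
    unfold big
    rw [Finset.card_insert_of_notMem (by rw [Finset.mem_insert, mem_path]; omega),
      Finset.card_insert_of_notMem (by rw [mem_path]; omega), card_path]

theorem card_small (hm : 4 ≤ m) : ∀ i, (small m i).card = m + 1
  | 0 => card_path _ _
  | 1 => card_path _ _
  | 2 => by
    unfold small
    rw [Finset.card_insert_of_notMem (by rw [mem_path]; omega), card_path]
  | 3 => by
    unfold small
    rw [Finset.card_insert_of_notMem (by rw [mem_path]; omega), card_path]

theorem linked_big (hm : 4 ≤ m) : ∀ i, Linked (big m i)
  | 0 => linked_path _ _
  | 1 => linked_path _ _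
  | 2 => (linked_path 0 (m + 1)).insert (u := 2) (by rw [mem_path]; omega)
      (cross_of_succ (by omega)).symm
  | 3 => (linked_path 1 (m + 1)).insert (u := 2 * m) (by rw [mem_path]; omega)
      (cross_of_succ (by omega))
  | 4 => ((linked_path 0 m).insert (u := 2 * m - 4) (by rw [mem_path]; omega)
      (cross_of_succ (by omega))).insert (u := 2) (by rw [Finset.mem_insert, mem_path]; omega)
      (cross_of_succ (by omega)).symm

theorem linked_small (hm : 4 ≤ m) : ∀ i, Linked (small m i)
  | 0 => linked_path _ _
  | 1 => linked_path _ _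
  | 2 => (linked_path 0 m).insert (u := 2) (by rw [mem_path]; omega) (cross_of_succ (by omega)).symm
  | 3 => (linked_path 0 m).insert (u := 2 * m - 4) (by rw [mem_path]; omega)
      (cross_of_succ (by omega))

theorem Draws.congr (h : Draws m p S) (hS : ∀ v, v ∈ S ↔ v ∈ S') : Draws m p S' :=
  Finset.ext hS ▸ h

-- Deleting one point of a doubled end leaves that end simple, whichever of the two is removed. Any
-- other deletion leaves a step of the path empty.
set_option linter.unusedSimpArgs false in
set_option linter.unnecessarySeqFocus false in
theorem child_big_four (hm : 4 ≤ m) (hv : v ∈ big m 4) (h : Draws m p ((big m 4).erase v))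
    (hc : Con m p) : Draws m p (small m 2) ∨ Draws m p (small m 3) := by
  simp only [big, Finset.mem_insert, mem_path] at hv
  by_cases h0 : v = 0
  · subst h0
    refine Or.inr (h.twin (t := 1) rfl ?_ ?_ fun v => ?_) <;>
      simp only [big, small, Finset.mem_insert, Finset.mem_erase, mem_path, true_and, true_or, or_true, and_true] <;> omega
  by_cases h1 : v = 1
  · refine Or.inr (h.congr fun v => ?_)
    simp only [big, small, Finset.mem_insert, Finset.mem_erase, mem_path, true_and, true_or, or_true, and_true] <;> omega
  by_cases h2 : v = 2 * m - 2
  · subst h2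
    refine Or.inl (h.twin (t := 2 * m - 1) (by omega) ?_ ?_ fun v => ?_) <;>
      simp only [big, small, Finset.mem_insert, Finset.mem_erase, mem_path, true_and, true_or, or_true, and_true] <;> omega
  by_cases h3 : v = 2 * m - 1
  · refine Or.inl (h.congr fun v => ?_)
    simp only [big, small, Finset.mem_insert, Finset.mem_erase, mem_path, true_and, true_or, or_true, and_true] <;> omega
  refine absurd hc (h.not_con (u := 0) (v := 2 * m - 2) (w := v / 2) ?_ ?_ (fun x hx => ?_)
    (by omega) (by omega))
  · simp only [big, small, Finset.mem_insert, Finset.mem_erase, mem_path, true_and, true_or, or_true, and_true] <;> omega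
  · simp only [big, small, Finset.mem_insert, Finset.mem_erase, mem_path, true_and, true_or, or_true, and_true] <;> omega
  · simp only [big, small, Finset.mem_insert, Finset.mem_erase, mem_path] at hx; omega

set_option linter.unusedSimpArgs false in
set_option linter.unnecessarySeqFocus false in
theorem child_big (hm : 4 ≤ m) (hc : Con m p) : ∀ i v, v ∈ big m i →
    Draws m p ((big m i).erase v) → ∃ j, Draws m p (small m j)
  | 0, v, hv, h => by
    simp only [big, mem_path] at hv
    by_cases h0 : v = 0
    · refine ⟨1, h.congr fun v => ?_⟩
      simp only [big, small, Finset.mem_erase, mem_path, true_and, true_or, or_true, and_true] <;> omega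
    by_cases h1 : v = 2 * m + 2
    · refine ⟨0, h.congr fun v => ?_⟩
      simp only [big, small, Finset.mem_erase, mem_path, true_and, true_or, or_true, and_true] <;> omega
    refine absurd hc (h.not_con (u := 0) (v := 2 * m + 2) (w := v / 2) ?_ ?_ (fun x hx => ?_)
      (by omega) (by omega))
    · simp only [big, small, Finset.mem_erase, mem_path, true_and, true_or, or_true, and_true] <;> omega
    · simp only [big, small, Finset.mem_erase, mem_path, true_and, true_or, or_true, and_true] <;> omega
    · simp only [big, small, Finset.mem_erase, mem_path] at hx; omega
  | 1, v, hv, h => by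
    simp only [big, mem_path] at hv
    by_cases h0 : v = 2
    · refine ⟨0, h.shift (fun v hv => ?_) fun v => ?_⟩
      · simp only [big, small, Finset.mem_erase, mem_path] at hv; omega
      · simp only [big, small, Finset.mem_erase, mem_path, true_and, true_or, or_true, and_true] <;> omega
    by_cases h1 : v = 2 * m + 4
    · refine ⟨1, h.congr fun v => ?_⟩
      simp only [big, small, Finset.mem_erase, mem_path, true_and, true_or, or_true, and_true] <;> omega
    refine absurd hc (h.not_con (u := 2) (v := 2 * m + 4) (w := v / 2) ?_ ?_ (fun x hx => ?_)
      (by omega) (by omega))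
    · simp only [big, small, Finset.mem_erase, mem_path, true_and, true_or, or_true, and_true] <;> omega
    · simp only [big, small, Finset.mem_erase, mem_path, true_and, true_or, or_true, and_true] <;> omega
    · simp only [big, small, Finset.mem_erase, mem_path] at hx; omega
  | 2, v, hv, h => by
    simp only [big, Finset.mem_insert, mem_path] at hv
    by_cases h0 : v = 0
    · subst h0
      refine ⟨0, h.twin (t := 1) rfl ?_ ?_ fun v => ?_⟩ <;>
        simp only [big, small, Finset.mem_insert, Finset.mem_erase, mem_path, true_and, true_or, or_true, and_true] <;> omega
    by_cases h1 : v = 1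
    · refine ⟨0, h.congr fun v => ?_⟩
      simp only [big, small, Finset.mem_insert, Finset.mem_erase, mem_path, true_and, true_or, or_true, and_true] <;> omega
    by_cases h2 : v = 2 * m
    · refine ⟨2, h.congr fun v => ?_⟩
      simp only [big, small, Finset.mem_insert, Finset.mem_erase, mem_path, true_and, true_or, or_true, and_true] <;> omega
    refine absurd hc (h.not_con (u := 0) (v := 2 * m) (w := v / 2) ?_ ?_ (fun x hx => ?_)
      (by omega) (by omega))
    · simp only [big, small, Finset.mem_insert, Finset.mem_erase, mem_path, true_and, true_or, or_true, and_true] <;> omega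
    · simp only [big, small, Finset.mem_insert, Finset.mem_erase, mem_path, true_and, true_or, or_true, and_true] <;> omega
    · simp only [big, small, Finset.mem_insert, Finset.mem_erase, mem_path] at hx; omega
  | 3, v, hv, h => by
    simp only [big, Finset.mem_insert, mem_path] at hv
    by_cases h0 : v = 2
    · refine ⟨3, h.shift (fun v hv => ?_) fun v => ?_⟩
      · simp only [big, small, Finset.mem_insert, Finset.mem_erase, mem_path] at hv; omega
      · simp only [big, small, Finset.mem_insert, Finset.mem_erase, mem_path, true_and, true_or, or_true, and_true] <;> omega
    by_cases h1 : v = 2 * m + 2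
    · subst h1
      refine ⟨1, h.twin (t := 2 * m + 3) (by omega) ?_ ?_ fun v => ?_⟩ <;>
        simp only [big, small, Finset.mem_insert, Finset.mem_erase, mem_path, true_and, true_or, or_true, and_true] <;> omega
    by_cases h2 : v = 2 * m + 3
    · refine ⟨1, h.congr fun v => ?_⟩
      simp only [big, small, Finset.mem_insert, Finset.mem_erase, mem_path, true_and, true_or, or_true, and_true] <;> omega
    refine absurd hc (h.not_con (u := 2) (v := 2 * m + 2) (w := v / 2) ?_ ?_ (fun x hx => ?_)
      (by omega) (by omega))
    · simp only [big, small, Finset.mem_insert, Finset.mem_erase, mem_path, true_and, true_or, or_true, and_true] <;> omega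
    · simp only [big, small, Finset.mem_insert, Finset.mem_erase, mem_path, true_and, true_or, or_true, and_true] <;> omega
    · simp only [big, small, Finset.mem_insert, Finset.mem_erase, mem_path] at hx; omega
  | 4, v, hv, h => (child_big_four hm hv h hc).elim (fun h => ⟨2, h⟩) fun h => ⟨3, h⟩

theorem exists_parent (hm : 4 ≤ m) : ∀ j, ∃ i, ∃ v ∈ big m i,
    ∀ p, Draws m p ((big m i).erase v) → Draws m p (small m j)
  | 0 => ⟨0, 2 * m + 2, by unfold big; rw [mem_path]; omega, fun p h => h.congr fun v => by
      unfold big small; simp only [Finset.mem_erase, mem_path]; omega⟩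
  | 1 => ⟨0, 0, by unfold big; rw [mem_path]; omega, fun p h => h.congr fun v => by
      unfold big small; simp only [Finset.mem_erase, mem_path]; omega⟩
  | 2 => ⟨2, 2 * m, by unfold big; rw [Finset.mem_insert, mem_path]; omega,
      fun p h => h.congr fun v => by
        unfold big small; simp only [Finset.mem_insert, Finset.mem_erase, mem_path]; omega⟩
  | 3 => ⟨4, 1, by unfold big; rw [Finset.mem_insert]; exact Or.inl rfl,
      fun p h => h.congr fun v => by
        unfold big small; simp only [Finset.mem_insert, Finset.mem_erase, mem_path]; omega⟩

/-- Each point of a path crosses at most its two neighbours. Doubling an end gives the point next to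
that end a third inversion, so a claw detects a doubled end. -/
theorem not_claw_path {a c : ℕ} (h : Draws m p (path a c)) : ¬ Claw m p := by
  rw [h.claw_iff]
  rintro ⟨u, hu, x, hx, y, hy, z, hz, h1, h2, h3, h4, h5, h6⟩
  rw [mem_path] at hu hx hy hz
  have := h4.near
  have := h5.near
  have := h6.near
  omega

theorem claw_small_two (hm : 4 ≤ m) (h : Draws m p (small m 2)) : Claw m p := by
  rw [h.claw_iff]
  refine ⟨2, ?_, 0, ?_, 1, ?_, 4, ?_, by omega, by omega, by omega,
    (cross_of_succ (by omega)).symm, (cross_of_succ (by omega)).symm, cross_of_succ (by omega)⟩ <;>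
  · unfold small
    rw [Finset.mem_insert, mem_path]
    omega

theorem claw_small_three (hm : 4 ≤ m) (h : Draws m p (small m 3)) : Claw m p := by
  rw [h.claw_iff]
  refine ⟨2 * m - 4, ?_, 2 * m - 6, ?_, 2 * m - 2, ?_, 2 * m - 1, ?_, by omega, by omega, by omega,
    (cross_of_succ (by omega)).symm, cross_of_succ (by omega), cross_of_succ (by omega)⟩ <;>
  · unfold small
    rw [Finset.mem_insert, mem_path]
    omega

theorem claw_big_three (hm : 4 ≤ m) (h : Draws (m + 1) p (big m 3)) : Claw (m + 1) p := by
  rw [h.claw_iff]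
  refine ⟨2 * m, ?_, 2 * m - 2, ?_, 2 * m + 2, ?_, 2 * m + 3, ?_, by omega, by omega, by omega,
    (cross_of_succ (by omega)).symm, cross_of_succ (by omega), cross_of_succ (by omega)⟩ <;>
  · unfold big
    rw [Finset.mem_insert, mem_path]
    omega

/-- The point 2 has the smallest horizontal coordinate of all. It lies above exactly the points of
the neighbouring steps and their twins. -/
theorem Draws.rank_zero_eq (h : Draws m p S) (h2 : 2 ∈ S) {F : Finset ℕ}
    (hF : ∀ u, u ∈ F ↔ u ∈ S ∧ (u = 0 ∨ u = 1 ∨ u = 4 ∨ u = 5)) : rank m p 0 = F.card := by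
  rw [h.rank_zero h2 fun u _ => by unfold px; split_ifs <;> omega]
  congr 1
  ext u
  rw [Finset.mem_filter, hF]
  have : py u < py 2 ↔ (u = 0 ∨ u = 1 ∨ u = 4 ∨ u = 5) := by
    unfold py; split_ifs <;> omega
  rw [this]

theorem rank_zero_big (hm : 4 ≤ m) : ∀ i, Draws (m + 1) p (big m i) →
    rank (m + 1) p 0 = ![2, 1, 3, 1, 3] i
  | 0, h => h.rank_zero_eq (F := {0, 4}) (by unfold big; rw [mem_path]; omega) fun u => by
      unfold big; simp only [Finset.mem_insert, Finset.mem_singleton, mem_path]; omega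
  | 1, h => h.rank_zero_eq (F := {4}) (by unfold big; rw [mem_path]; omega) fun u => by
      unfold big; simp only [Finset.mem_singleton, mem_path]; omega
  | 2, h => h.rank_zero_eq (F := {0, 1, 4}) (by unfold big; rw [Finset.mem_insert, mem_path]; omega)
      fun u => by
        unfold big; simp only [Finset.mem_insert, Finset.mem_singleton, mem_path]; omega
  | 3, h => h.rank_zero_eq (F := {4}) (by unfold big; rw [Finset.mem_insert, mem_path]; omega)
      fun u => by
        unfold big; simp only [Finset.mem_insert, Finset.mem_singleton, mem_path]; omega
  | 4, h => h.rank_zero_eq (F := {0, 1, 4})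
      (by unfold big; rw [Finset.mem_insert, Finset.mem_insert, mem_path]; omega) fun u => by
        unfold big; simp only [Finset.mem_insert, Finset.mem_singleton, mem_path]; omega

theorem rank_zero_small (hm : 4 ≤ m) : ∀ i, Draws m p (small m i) → rank m p 0 = ![2, 1, 3, 2] i
  | 0, h => h.rank_zero_eq (F := {0, 4}) (by unfold small; rw [mem_path]; omega) fun u => by
      unfold small; simp only [Finset.mem_insert, Finset.mem_singleton, mem_path]; omega
  | 1, h => h.rank_zero_eq (F := {4}) (by unfold small; rw [mem_path]; omega) fun u => by
      unfold small; simp only [Finset.mem_singleton, mem_path]; omega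
  | 2, h => h.rank_zero_eq (F := {0, 1, 4})
      (by unfold small; rw [Finset.mem_insert, mem_path]; omega) fun u => by
        unfold small; simp only [Finset.mem_insert, Finset.mem_singleton, mem_path]; omega
  | 3, h => h.rank_zero_eq (F := {0, 4})
      (by unfold small; rw [Finset.mem_insert, mem_path]; omega) fun u => by
        unfold small; simp only [Finset.mem_insert, Finset.mem_singleton, mem_path]; omega

theorem Eqv.rank_zero (h : Eqv m p q) : rank m p 0 = rank m q 0 := by
  rw [← ranks_getD (Nat.zero_le m), ← ranks_getD (Nat.zero_le m), ranks_eq_iff.2 h]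

/-- Removing the twin from the first pattern leaves a path, while all indecomposable children of the
second keep one doubled end and hence a claw. -/
theorem not_eqv_big (hm : 4 ≤ m) (hp : Draws (m + 1) p (big m 2)) (hq : Draws (m + 1) q (big m 4)) :
    ¬ Eqv (m + 1) p q := by
  intro h
  obtain ⟨r, hr, h1⟩ := hp.exists_erase (v := 1) (Finset.mem_insert_self _ _)
  have h2 : Draws m (Pattern.del p r) (path 0 (m + 1)) := h1.congr fun v => by
    unfold big; simp only [Finset.mem_insert, Finset.mem_erase, mem_path]; omega
  have h3 := eqv_del h r
  obtain ⟨v, hv, h4⟩ := hq.del hr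
  refine not_claw_path h2 (Claw.eqv ?_ h3.symm)
  rcases child_big_four hm hv h4 (h3.con (h2.con (linked_path _ _))) with h5 | h5
  · exact claw_small_two hm h5
  · exact claw_small_three hm h5

theorem exists_five_four (hm : 4 ≤ m) : ∃ C : Set FinPerm, FinPerm.IsClass C ∧
    FinPerm.numSumIndecomposables C (m + 2) = 5 ∧ FinPerm.numSumIndecomposables C (m + 1) = 4 := by
  choose P iP dP using fun i => exists_draws (card_big hm i)
  choose Q iQ dQ using fun j => exists_draws (card_small hm j)
  refine exists_class iP (fun i => (dP i).con (linked_big hm i)) (fun i j h => ?_) iQ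
    (fun j => (dQ j).con (linked_small hm j)) (fun i j h => ?_) (fun i r hr hc => ?_) fun j => ?_
  -- The rank of the first entry separates all pairs but two. These are `P 1`, `P 3`, told apart by
  -- a claw, and `P 2`, `P 4`, told apart by their children.
  · have hr := h.rank_zero
    rw [rank_zero_big hm i (dP i), rank_zero_big hm j (dP j)] at hr
    have n13 : ¬ Eqv (m + 1) (P 1) (P 3) := fun h =>
      not_claw_path (dP 1) ((claw_big_three hm (dP 3)).eqv h.symm)
    have n24 := not_eqv_big hm (dP 2) (dP 4)
    fin_cases i <;> fin_cases j <;> first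
      | rfl
      | exact absurd hr (by decide)
      | exact absurd h n13
      | exact absurd h.symm n13
      | exact absurd h n24
      | exact absurd h.symm n24
  · have hr := h.rank_zero
    rw [rank_zero_small hm i (dQ i), rank_zero_small hm j (dQ j)] at hr
    have n03 : ¬ Eqv m (Q 0) (Q 3) := fun h =>
      not_claw_path (dQ 0) ((claw_small_three hm (dQ 3)).eqv h.symm)
    fin_cases i <;> fin_cases j <;> first
      | rfl
      | exact absurd hr (by decide)
      | exact absurd h n03
      | exact absurd h.symm n03
  · obtain ⟨v, hv, h⟩ := (dP i).del hr
    obtain ⟨j, hj⟩ := child_big hm hc i v hv h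
    exact ⟨j, hj.eqv (dQ j)⟩
  · obtain ⟨i, v, hv, h⟩ := exists_parent hm j
    obtain ⟨r, hr, h1⟩ := (dP i).exists_erase hv
    exact ⟨i, r, hr, (dQ j).eqv (h _ h1)⟩

end Pattern

theorem mainTheorem5 :
    (∀ C : Set FinPerm, FinPerm.IsClass C → ∀ n : ℕ, 6 ≤ n →
      4 ≤ FinPerm.numSumIndecomposables C n → 4 ≤ FinPerm.numSumIndecomposables C (n - 1)) ∧
    (∀ n : ℕ, 6 ≤ n → ∃ C : Set FinPerm, FinPerm.IsClass C ∧
      FinPerm.numSumIndecomposables C n = 5 ∧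
      FinPerm.numSumIndecomposables C (n - 1) = 4) := by
  refine ⟨fun C hC n hn h => ?_, fun n hn => ?_⟩
  · obtain ⟨m, rfl⟩ : ∃ m, n = m + 2 := ⟨n - 2, by omega⟩
    exact Pattern.four_le_of_four_le hC (by omega) h
  · obtain ⟨m, rfl⟩ : ∃ m, n = m + 2 := ⟨n - 2, by omega⟩
    exact Pattern.exists_five_four (by omega)
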